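/- Let $\ell$ be an odd prime and let $L/K$ be a Galois extension of number fields whose Galois group is a finite $\ell$-group. Assume that $L$ satisfies the Leopoldt conjecture for $\ell$, i.e. that the natural map $\mathbb Z_\ell\otimes_{\mathbb Z}\mathcal O_L^\times\to\prod_{w\mid\ell}\mathcal R_{L_w}$ is injective, where $\mathcal R_F=\varprojlim_n F^\times/F^{\times\ell^n}$ denotes the $\ell$-adic compactification of the multiplicative group of a field $F$. For a field $F$ let $\mu_F$ be the group of roots of unity of $\ell$-power order in $F$. For a number field $F$ let $\mathcal D'_F$ be the free $\mathbb Z_\ell$-module on the prime ideals of $F$ not dividing $\ell$, and let $\mathcal P^{bp}_F\subset\mathcal D'_F$ be the submodule of the (prime-to-$\ell$ parts of the) divisors of the pseudo-infinitesimal elements of $F$, i.e. of those $\alpha\in\mathbb Z_\ell\otimes_{\mathbb Z}F^\times$ whose image in $\mathcal R_{F_v}$ lies in (the image of) $\mu_{F_v}$ for every place $v\mid\ell$. Let $\mathrm{Cl}^{bp}_F=\mathcal D'_F/\mathcal P^{bp}_F$ be the group of pseudo-infinitesimal classes; its $\mathbb Z_\ell$-torsion submodule $\mathcal T^{bp}_F$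 is the Bertrandias-Payan module of $F$. Extension of ideals, $\mathfrak p\mapsto\prod_{\mathfrak P\mid\mathfrak p}\mathfrak P^{e(\mathfrak P/\mathfrak p)}$, induces maps $\mathrm{Cl}^{bp}_K\to\mathrm{Cl}^{bp}_L$ and $\mathcal T^{bp}_K\to\mathcal T^{bp}_L$. A subextension $F/K$ of $L/K$ is called locally cyclotomic if, for every place $v$ of $K$ and every place $w$ of $F$ above $v$, the local extension $F_w/K_v$ is contained in the cyclotomic $\mathbb Z_\ell$-extension of $K_v$ (for $v$ infinite this means $F_w=K_v$). Let $L'$ be the compositum of the locally cyclotomic subextensions of $L/K$. Then $L'$ is the largest locally cyclotomic subextension of $L/K$, it is Galois over $K$, and $\mu_L\subset L'$, i.e. $\mu_{L'}=\mu_L$. Put $G'=\mathrm{Gal}(L'/K)$, which therefore acts on $\mu_L=\mu_{L'}$. The capitulation kernel is given by isomorphisms of groups $$\ker\bigl(\mathrm{Cl}^{bp}_K\to\mathrm{Cl}^{bp}_L\bigr)\;\simeq\;H^1(G',\mu_L)\qquad\text{and}\qquad \ker\bigl(\mathcal T^{bp}_K\to\mathcal T^{bp}_L\bigr)\;\simeq\;H^1(G',\mu_L).$$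 -/

import Mathlib

open NumberField IsDedekindDomain
open scoped TensorProduct

namespace BertrandiasPayan

noncomputable section

/-! ### `ℓ`-adified unit groups -/

/-- `ℤ_ℓ ⊗_ℤ R^×` for a commutative ring `R`, written additively. For a number field `R = K` this
is the `ℓ`-adified group of principal ideles `ℛ_K = ℤ_ℓ ⊗_ℤ K^×`. -/
abbrev AdicUnits (ℓ : ℕ) [Fact ℓ.Prime] (R : Type*) [CommRing R] : Type _ :=
  ℤ_[ℓ] ⊗[ℤ] Additive Rˣ

/-- The map `ℤ_ℓ ⊗ R^× → ℤ_ℓ ⊗ S^×` induced by a ring homomorphism `R → S`. -/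
def AdicUnits.map (ℓ : ℕ) [Fact ℓ.Prime] {R S : Type*} [CommRing R] [CommRing S] (f : R →+* S) :
    AdicUnits ℓ R →ₗ[ℤ_[ℓ]] AdicUnits ℓ S :=
  LinearMap.baseChange ℤ_[ℓ] (MonoidHom.toAdditive (Units.map (f : R →* S))).toIntLinearMap

/-- The `ℓ`-adic compactification `ℛ_F = lim_n F^× / F^{× ℓ^n}` of the multiplicative group of a
field `F`, as a `ℤ_ℓ`-module. It is realised as the `ℓ`-adic completion
`lim_n (ℤ_ℓ ⊗ F^×) / ℓ^n (ℤ_ℓ ⊗ F^×)`: for every abelian group `A` one has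
`(ℤ_ℓ ⊗ A) / ℓ^n = (ℤ / ℓ^n) ⊗ A = A / ℓ^n A`. -/
abbrev CompletedUnits (ℓ : ℕ) [Fact ℓ.Prime] (F : Type*) [Field F] : Type _ :=
  AdicCompletion (Ideal.span {(ℓ : ℤ_[ℓ])}) (AdicUnits ℓ F)

/-- The group `μ_F` of roots of unity of `ℓ`-power order in a field `F`. -/
abbrev rootsOfUnityPrimary (ℓ : ℕ) (F : Type*) [Field F] : Subgroup Fˣ :=
  CommGroup.primaryComponent Fˣ ℓ

/-- The image of `μ_F` in `ℛ_F`. -/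
def completedRoots (ℓ : ℕ) [Fact ℓ.Prime] (F : Type*) [Field F] :
    Submodule ℤ_[ℓ] (CompletedUnits ℓ F) :=
  Submodule.span ℤ_[ℓ] (Set.range fun ζ : rootsOfUnityPrimary ℓ F ↦
    AdicCompletion.of (Ideal.span {(ℓ : ℤ_[ℓ])}) (AdicUnits ℓ F)
      (1 ⊗ₜ[ℤ] Additive.ofMul (ζ : Fˣ)))

/-- The localisation map `ℛ_K = ℤ_ℓ ⊗ K^× → ℛ_{K_v}` at a finite place `v`. -/
def localization (ℓ : ℕ) [Fact ℓ.Prime] (K : Type*) [Field K] [NumberField K]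
    (v : HeightOneSpectrum (𝓞 K)) :
    AdicUnits ℓ K →ₗ[ℤ_[ℓ]] CompletedUnits ℓ (v.adicCompletion K) :=
  (AdicCompletion.of (Ideal.span {(ℓ : ℤ_[ℓ])}) (AdicUnits ℓ (v.adicCompletion K))).comp
    (AdicUnits.map ℓ (algebraMap K (v.adicCompletion K)))

/-- The Leopoldt conjecture for the prime `ℓ` in the number field `K`: the semi-localisation map
`ℤ_ℓ ⊗ 𝓞_K^× → ∏_{v ∣ ℓ} ℛ_{K_v}` is injective. -/
def LeopoldtConjecture (ℓ : ℕ) [Fact ℓ.Prime] (K : Type*) [Field K] [NumberField K] : Prop :=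
  ∀ ε : AdicUnits ℓ (𝓞 K),
    (∀ v : HeightOneSpectrum (𝓞 K), (ℓ : 𝓞 K) ∈ v.asIdeal →
      localization ℓ K v (AdicUnits.map ℓ (algebraMap (𝓞 K) K) ε) = 0) → ε = 0

/-! ### Divisors prime to `ℓ` and pseudo-infinitesimal classes -/

/-- The finite places of `K` that do not divide `ℓ`. -/
abbrev TamePlace (ℓ : ℕ) (K : Type*) [Field K] [NumberField K] : Type _ :=
  {v : HeightOneSpectrum (𝓞 K) // (ℓ : 𝓞 K) ∉ v.asIdeal}

/-- The group `𝒟'_K = ℤ_ℓ ⊗_ℤ Id'_K` of divisors of `K` prime to `ℓ`: the free `ℤ_ℓ`-module on the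
finite places not dividing `ℓ`. -/
abbrev Divisor (ℓ : ℕ) [Fact ℓ.Prime] (K : Type*) [Field K] [NumberField K] : Type _ :=
  TamePlace ℓ K →₀ ℤ_[ℓ]

/-- The normalised valuation `ord_v(x) ∈ ℤ` of `x ∈ K^×`. -/
def ord {K : Type*} [Field K] [NumberField K] (v : HeightOneSpectrum (𝓞 K)) (x : Kˣ) : ℤ :=
  -(v.valuation K (x : K)).log

theorem ord_mul {K : Type*} [Field K] [NumberField K] (v : HeightOneSpectrum (𝓞 K)) (x y : Kˣ) :
    ord v (x * y) = ord v x + ord v y := by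
  simp only [ord, Units.val_mul, map_mul]
  rw [WithZero.log_mul (by simp) (by simp)]
  ring

theorem ord_one {K : Type*} [Field K] [NumberField K] (v : HeightOneSpectrum (𝓞 K)) :
    ord v (1 : Kˣ) = 0 := by
  simp [ord]

theorem finite_ord_ne_zero {K : Type*} [Field K] [NumberField K] (x : Kˣ) :
    {v : HeightOneSpectrum (𝓞 K) | ord v x ≠ 0}.Finite := by
  refine ((HeightOneSpectrum.Support.finite (𝓞 K) (x : K)).union
    (HeightOneSpectrum.Support.finite (𝓞 K) ((x⁻¹ : Kˣ) : K))).subset ?_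
  intro v hv
  by_contra hcon
  simp only [HeightOneSpectrum.Support, Set.mem_union, Set.mem_ofPred_eq, not_or, not_lt] at hcon
  obtain ⟨h1, h2⟩ := hcon
  rw [Units.val_inv_eq_inv_val, map_inv₀] at h2
  have h3 : v.valuation K (x : K) = 1 := by
    refine le_antisymm h1 ?_
    have h0 : (0 : WithZero (Multiplicative ℤ)) < v.valuation K (x : K) :=
      zero_lt_iff.mpr (by simp)
    exact (inv_le_one₀ h0).mp h2
  exact hv (by simp [ord, h3])

/-- The prime-to-`ℓ` part of the divisor of an element of `K^×`. -/
def unitDivisor (ℓ : ℕ) [Fact ℓ.Prime] (K : Type*) [Field K] [NumberField K] :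
    Additive Kˣ →+ Divisor ℓ K where
  toFun x := Finsupp.ofSupportFinite (fun v ↦ ((ord v.1 x.toMul : ℤ) : ℤ_[ℓ])) (by
    refine Set.Finite.subset
      (Set.Finite.preimage Subtype.val_injective.injOn (finite_ord_ne_zero x.toMul)) ?_
    intro v hv
    simp only [Function.mem_support, ne_eq, Int.cast_eq_zero] at hv
    exact hv)
  map_zero' := by
    ext v
    simp [Finsupp.ofSupportFinite, ord_one]
  map_add' x y := by
    ext v
    simp [Finsupp.ofSupportFinite, ord_mul]
    rfl

/-- The divisor map `ℛ_K = ℤ_ℓ ⊗ K^× → 𝒟'_K`. -/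
def divisor (ℓ : ℕ) [Fact ℓ.Prime] (K : Type*) [Field K] [NumberField K] :
    AdicUnits ℓ K →ₗ[ℤ_[ℓ]] Divisor ℓ K :=
  LinearMap.liftBaseChange ℤ_[ℓ] (unitDivisor ℓ K).toIntLinearMap

/-- The group `ℛ_K^bp` of pseudo-infinitesimal elements: the elements of `ℛ_K` that are locally
roots of unity at all the places dividing `ℓ`. -/
def pseudoInfinitesimal (ℓ : ℕ) [Fact ℓ.Prime] (K : Type*) [Field K] [NumberField K] :
    Submodule ℤ_[ℓ] (AdicUnits ℓ K) :=
  ⨅ v : {v : HeightOneSpectrum (𝓞 K) // (ℓ : 𝓞 K) ∈ v.asIdeal},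
    (completedRoots ℓ (v.1.adicCompletion K)).comap (localization ℓ K v.1)

/-- The group `𝒫_K^bp` of divisors of pseudo-infinitesimal elements. -/
def principalBP (ℓ : ℕ) [Fact ℓ.Prime] (K : Type*) [Field K] [NumberField K] :
    Submodule ℤ_[ℓ] (Divisor ℓ K) :=
  (pseudoInfinitesimal ℓ K).map (divisor ℓ K)

/-- The group `Cl_K^bp = 𝒟'_K / 𝒫_K^bp` of pseudo-infinitesimal classes. -/
abbrev ClBP (ℓ : ℕ) [Fact ℓ.Prime] (K : Type*) [Field K] [NumberField K] : Type _ :=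
  Divisor ℓ K ⧸ principalBP ℓ K

/-- The Bertrandias-Payan module `𝒯_K^bp`: the `ℤ_ℓ`-torsion submodule of `Cl_K^bp`. -/
abbrev TorsionBP (ℓ : ℕ) [Fact ℓ.Prime] (K : Type*) [Field K] [NumberField K] :
    Submodule ℤ_[ℓ] (ClBP ℓ K) :=
  Submodule.torsion ℤ_[ℓ] (ClBP ℓ K)

/-! ### Local extensions -/

section Local

variable (K : Type*) [Field K] [NumberField K] {L : Type*} [Field L] [NumberField L] [Algebra K L]

instance under_liesOver (w : HeightOneSpectrum (𝓞 L)) :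
    w.asIdeal.LiesOver (w.under (𝓞 K)).asIdeal :=
  ⟨rfl⟩

/-- The local extension `K_v → L_w`, where `w` is a finite place of `L` and `v` is the place of `K`
under `w`: the continuous extension of `K → L`. -/
def localExtension (w : HeightOneSpectrum (𝓞 L)) :
    (w.under (𝓞 K)).adicCompletion K →+* w.adicCompletion L :=
  ((HeightOneSpectrum.adicCompletion.equiv L w).symm.toRingHom.comp
    (UniformSpace.Completion.mapRingHom
      (algebraMap (WithVal ((w.under (𝓞 K)).valuation K)) (WithVal (w.valuation L)))
      (HeightOneSpectrum.uniformContinuous_algebraMap_liesOver K L (w.under (𝓞 K)) w).continuous)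
    ).comp (HeightOneSpectrum.adicCompletion.equiv K (w.under (𝓞 K))).toRingHom

theorem localExtension_algebraMap (w : HeightOneSpectrum (𝓞 L)) (x : K) :
    localExtension K w (algebraMap K _ x) = algebraMap L _ (algebraMap K L x) := by
  apply HeightOneSpectrum.adicCompletion.ext
  exact UniformSpace.Completion.mapRingHom_coe
    (HeightOneSpectrum.uniformContinuous_algebraMap_liesOver K L (w.under (𝓞 K)) w).continuous _

end Local

/-! ### Extension of divisors and of classes -/

section Extension

theorem natCast_mem_under (ℓ : ℕ) {K L : Type*} [Field K] [NumberField K] [Field L] [NumberField L]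
    [Algebra K L] (w : HeightOneSpectrum (𝓞 L)) :
    (ℓ : 𝓞 K) ∈ (w.under (𝓞 K)).asIdeal ↔ (ℓ : 𝓞 L) ∈ w.asIdeal := by
  simp [HeightOneSpectrum.under, Ideal.under_def, Ideal.mem_comap]

/-- The place of `K` under a place of `L` not dividing `ℓ`. -/
def TamePlace.under {ℓ : ℕ} (K : Type*) {L : Type*} [Field K] [NumberField K] [Field L]
    [NumberField L] [Algebra K L] (w : TamePlace ℓ L) : TamePlace ℓ K :=
  ⟨w.1.under (𝓞 K), fun h ↦ w.2 ((natCast_mem_under ℓ w.1).mp h)⟩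

theorem TamePlace.finite_fiber {ℓ : ℕ} {K L : Type*} [Field K] [NumberField K] [Field L]
    [NumberField L] [Algebra K L] (v : TamePlace ℓ K) :
    {w : TamePlace ℓ L | w.under K = v}.Finite := by
  have hfin : (v.1.asIdeal.primesOver (𝓞 L)).Finite := by
    have : v.1.asIdeal.IsMaximal := v.1.isMaximal
    exact IsDedekindDomain.primesOver_finite v.1.asIdeal (𝓞 L)
  refine Set.Finite.subset (hfin.preimage (f := fun w : TamePlace ℓ L ↦ w.1.asIdeal) ?_) ?_
  · intro a _ b _ hab
    exact Subtype.ext (HeightOneSpectrum.ext hab)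
  · rintro w rfl
    exact ⟨w.1.isPrime, ⟨rfl⟩⟩

/-- Extension of divisors `𝒟'_K → 𝒟'_L`. A prime `𝔭` of `K` goes to `𝔭 𝓞_L = ∏_{𝔓 ∣ 𝔭} 𝔓^e(𝔓/𝔭)`, so
the coefficient of the image of `a` at `𝔓` is `e(𝔓/𝔭)` times the coefficient of `a` at
`𝔭 = 𝔓 ∩ 𝓞_K`. -/
def extendDivisor (ℓ : ℕ) [Fact ℓ.Prime] (K L : Type*) [Field K] [NumberField K] [Field L]
    [NumberField L] [Algebra K L] : Divisor ℓ K →ₗ[ℤ_[ℓ]] Divisor ℓ L where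
  toFun a := Finsupp.ofSupportFinite
    (fun w ↦ ((w.under K).1.asIdeal.ramificationIdx' w.1.asIdeal : ℤ_[ℓ]) * a (w.under K)) (by
      refine Set.Finite.subset
        (a.support.finite_toSet.biUnion fun v _ ↦ TamePlace.finite_fiber (L := L) v) ?_
      intro w hw
      simp only [Function.mem_support, ne_eq, mul_eq_zero, not_or] at hw
      simpa using hw.2)
  map_add' a b := by
    ext w
    exact mul_add _ _ _
  map_smul' c a := by
    ext w
    exact mul_left_comm _ _ _

theorem extendDivisor_apply (ℓ : ℕ) [Fact ℓ.Prime] (K L : Type*) [Field K] [NumberField K] [Field L]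
    [NumberField L] [Algebra K L] (a : Divisor ℓ K) (w : TamePlace ℓ L) :
    extendDivisor ℓ K L a w =
      ((w.under K).1.asIdeal.ramificationIdx' w.1.asIdeal : ℤ_[ℓ]) * a (w.under K) :=
  rfl

theorem divisor_tmul (ℓ : ℕ) [Fact ℓ.Prime] (K : Type*) [Field K] [NumberField K] (c : ℤ_[ℓ])
    (x : Kˣ) (v : TamePlace ℓ K) :
    divisor ℓ K (c ⊗ₜ[ℤ] Additive.ofMul x) v = c * ((ord v.1 x : ℤ) : ℤ_[ℓ]) := by
  simp only [divisor, LinearMap.liftBaseChange_tmul, Finsupp.smul_apply, smul_eq_mul]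
  rfl

theorem ord_under {K L : Type*} [Field K] [NumberField K] [Field L] [NumberField L] [Algebra K L]
    (w : HeightOneSpectrum (𝓞 L)) (x : Kˣ) :
    ord w (Units.map (algebraMap K L : K →* L) x) =
      ((w.under (𝓞 K)).asIdeal.ramificationIdx' w.asIdeal : ℤ) * ord (w.under (𝓞 K)) x := by
  have h := HeightOneSpectrum.valuation_liesOver L (w.under (𝓞 K)) w (x : K)
  simp only [ord, Units.coe_map, MonoidHom.coe_coe]
  rw [← h, WithZero.log_pow]
  simp

/-- The divisor map commutes with extension. -/
theorem extendDivisor_divisor (ℓ : ℕ) [Fact ℓ.Prime] (K L : Type*) [Field K] [NumberField K]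
    [Field L] [NumberField L] [Algebra K L] (α : AdicUnits ℓ K) :
    extendDivisor ℓ K L (divisor ℓ K α) =
      divisor ℓ L (AdicUnits.map ℓ (algebraMap K L) α) := by
  induction α using TensorProduct.induction_on with
  | zero => simp
  | add a b ha hb => simp only [map_add, ha, hb]
  | tmul c x =>
    ext w
    have h := ord_under (K := K) w.1 x.toMul
    have h1 := divisor_tmul ℓ K c x.toMul (w.under K)
    have h2 := divisor_tmul ℓ L c (Units.map (algebraMap K L : K →* L) x.toMul) w
    rw [h] at h2
    rw [extendDivisor_apply]
    refine (congrArg _ h1).trans (Eq.trans ?_ h2.symm)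
    push_cast
    exact mul_left_comm _ _ _

/-- The map `ℛ_F → ℛ_E` induced by a field homomorphism `F → E`. -/
def CompletedUnits.map (ℓ : ℕ) [Fact ℓ.Prime] {F E : Type*} [Field F] [Field E] (f : F →+* E) :
    CompletedUnits ℓ F →ₗ[ℤ_[ℓ]] CompletedUnits ℓ E :=
  (AdicCompletion.map (Ideal.span {(ℓ : ℤ_[ℓ])}) (AdicUnits.map ℓ f)).restrictScalars ℤ_[ℓ]

theorem completedRoots_le_comap (ℓ : ℕ) [Fact ℓ.Prime] {F E : Type*} [Field F] [Field E]
    (f : F →+* E) :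
    completedRoots ℓ F ≤ (completedRoots ℓ E).comap (CompletedUnits.map ℓ f) := by
  refine Submodule.span_le.mpr ?_
  rintro _ ⟨⟨ζ, n, hζ⟩, rfl⟩
  refine Submodule.subset_span ⟨⟨Units.map (f : F →* E) ζ, n, ?_⟩, ?_⟩
  · rw [← map_pow, hζ, map_one]
  · exact (AdicCompletion.map_of (Ideal.span {(ℓ : ℤ_[ℓ])}) (AdicUnits.map ℓ f)
      (1 ⊗ₜ[ℤ] Additive.ofMul ζ)).symm

theorem localization_map (ℓ : ℕ) [Fact ℓ.Prime] {K L : Type*} [Field K] [NumberField K] [Field L]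
    [NumberField L] [Algebra K L] (w : HeightOneSpectrum (𝓞 L)) (α : AdicUnits ℓ K) :
    localization ℓ L w (AdicUnits.map ℓ (algebraMap K L) α) =
      CompletedUnits.map ℓ (localExtension K w) (localization ℓ K (w.under (𝓞 K)) α) := by
  refine Eq.trans ?_ (AdicCompletion.map_of _ (AdicUnits.map ℓ (localExtension K w)) _).symm
  refine congrArg (AdicCompletion.of _ _) ?_
  induction α using TensorProduct.induction_on with
  | zero => simp
  | add a b ha hb => simp only [map_add, ha, hb]
  | tmul c x =>
    refine congrArg (fun y : (w.adicCompletion L)ˣ ↦ c ⊗ₜ[ℤ] Additive.ofMul y) ?_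
    exact Units.ext (localExtension_algebraMap K w (x.toMul : K)).symm

theorem map_mem_pseudoInfinitesimal (ℓ : ℕ) [Fact ℓ.Prime] {K : Type*} (L : Type*) [Field K]
    [NumberField K] [Field L] [NumberField L] [Algebra K L] {α : AdicUnits ℓ K}
    (hα : α ∈ pseudoInfinitesimal ℓ K) :
    AdicUnits.map ℓ (algebraMap K L) α ∈ pseudoInfinitesimal ℓ L := by
  simp only [pseudoInfinitesimal, Submodule.mem_iInf, Submodule.mem_comap] at hα ⊢
  intro w
  rw [localization_map]
  exact completedRoots_le_comap ℓ _ (hα ⟨w.1.under (𝓞 K), (natCast_mem_under ℓ w.1).mpr w.2⟩)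

theorem principalBP_le_comap (ℓ : ℕ) [Fact ℓ.Prime] (K L : Type*) [Field K] [NumberField K]
    [Field L] [NumberField L] [Algebra K L] :
    principalBP ℓ K ≤ (principalBP ℓ L).comap (extendDivisor ℓ K L) := by
  rintro _ ⟨α, hα, rfl⟩
  exact ⟨_, map_mem_pseudoInfinitesimal ℓ L hα, (extendDivisor_divisor ℓ K L α).symm⟩

/-- The extension map `Cl_K^bp → Cl_L^bp` on pseudo-infinitesimal classes. -/
def extendClass (ℓ : ℕ) [Fact ℓ.Prime] (K L : Type*) [Field K] [NumberField K]
    [Field L] [NumberField L] [Algebra K L] : ClBP ℓ K →ₗ[ℤ_[ℓ]] ClBP ℓ L :=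
  Submodule.mapQ _ _ (extendDivisor ℓ K L) (principalBP_le_comap ℓ K L)

/-- The extension map `𝒯_K^bp → 𝒯_L^bp` on Bertrandias-Payan modules. -/
def extendTorsion (ℓ : ℕ) [Fact ℓ.Prime] (K L : Type*) [Field K] [NumberField K]
    [Field L] [NumberField L] [Algebra K L] : TorsionBP ℓ K →ₗ[ℤ_[ℓ]] TorsionBP ℓ L :=
  (extendClass ℓ K L).restrict (by
    rintro x ⟨a, ha⟩
    exact ⟨a, by simpa [Submonoid.smul_def] using congrArg (extendClass ℓ K L) ha⟩)

end Extension

/-! ### Locally cyclotomic extensions -/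

/-- The field `F(μ_{ℓ^∞})` inside an algebraic closure of `F`. -/
def cyclotomicTower (ℓ : ℕ) (F : Type*) [Field F] : IntermediateField F (AlgebraicClosure F) :=
  IntermediateField.adjoin F {ζ | ∃ n : ℕ, ζ ^ ℓ ^ n = 1}

/-- The cyclotomic `ℤ_ℓ`-extension `F^c` of a local field `F`: the compositum of the finite Galois
extensions of `F` of `ℓ`-power degree that are contained in `F(μ_{ℓ^∞})`. For `ℓ` odd, the Galois
group of `F(μ_{ℓ^∞})/F` is an open subgroup of `ℤ_ℓ^×`, that is a product of a finite group of order
prime to `ℓ` and of a group isomorphic to `ℤ_ℓ`, so that `F^c` is the unique `ℤ_ℓ`-extension of `F`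
in it. -/
def cyclotomicZlExtension (ℓ : ℕ) (F : Type*) [Field F] :
    IntermediateField F (AlgebraicClosure F) :=
  sSup {E | E ≤ cyclotomicTower ℓ F ∧ FiniteDimensional F E ∧ IsGalois F E ∧
    ∃ n : ℕ, Module.finrank F E = ℓ ^ n}

/-- The extension of number fields `L/K` is locally cyclotomic (logarithmically unramified) at `ℓ`:
for every place `w` of `L` above a place `v` of `K`, the local extension `L_w/K_v` is contained in
the cyclotomic `ℤ_ℓ`-extension `K_v^c/K_v`. For an infinite place `v` and `ℓ` odd one has
`K_v^c = K_v`, so that the condition there is `L_w = K_v`. -/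
structure IsLocallyCyclotomic (ℓ : ℕ) (K L : Type*) [Field K] [NumberField K]
    [Field L] [NumberField L] [Algebra K L] : Prop where
  infinite : IsUnramifiedAtInfinitePlaces K L
  finite : ∀ w : HeightOneSpectrum (𝓞 L),
    ∃ φ : w.adicCompletion L →+* AlgebraicClosure ((w.under (𝓞 K)).adicCompletion K),
      φ.comp (localExtension K w) = algebraMap _ _ ∧
      ∀ x, φ x ∈ cyclotomicZlExtension ℓ ((w.under (𝓞 K)).adicCompletion K)

/-- The compositum of the subextensions of `L/K` that are locally cyclotomic over `K`. -/
def maxLocallyCyclotomic (ℓ : ℕ) (K L : Type*) [Field K] [NumberField K]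
    [Field L] [NumberField L] [Algebra K L] : IntermediateField K L :=
  sSup {F : IntermediateField K L | IsLocallyCyclotomic ℓ K F}

/-! ### Galois cohomology of the roots of unity -/

/-- The Galois action on `μ_F`. -/
instance rootsGaloisAction (ℓ : ℕ) (K F : Type*) [Field K] [Field F] [Algebra K F] :
    MulDistribMulAction Gal(F/K) (rootsOfUnityPrimary ℓ F) where
  smul σ ζ := ⟨Units.map (σ : F →* F) ζ.1, by
    obtain ⟨n, hn⟩ := ζ.2
    exact ⟨n, by rw [← map_pow, hn, map_one]⟩⟩
  one_smul _ := rfl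
  mul_smul _ _ _ := rfl
  smul_mul σ x y := Subtype.ext (map_mul _ _ _)
  smul_one σ := Subtype.ext (map_one _)

/-- The cohomology group `H^1(Gal(F/K), μ_F)`. -/
abbrev rootsH1 (ℓ : ℕ) (K F : Type) [Field K] [Field F] [Algebra K F] : Type :=
  groupCohomology.H1 (Rep.ofMulDistribMulAction Gal(F/K) (rootsOfUnityPrimary ℓ F))

end

end BertrandiasPayan

/-! Write `F` for the maximal locally cyclotomic subextension and `ℛ` for `ℤ_ℓ ⊗` multiplicative
group. If a divisor `a` of `K` capitulates, its extension is the divisor of a pseudo-infinitesimal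
`α ∈ ℛ_L`. For `τ ∈ Gal(L/K)` the element `τα - α` is pseudo-infinitesimal with trivial divisor.
Leopoldt then forces it to be a global root of unity (`exists_eq_one_tmul_root`,
`exists_galois_eq_add_root`), so `α` yields a cocycle of roots of unity.

This cocycle lives on `Gal(F/K)` because `α` descends to `F` (`exists_map_eq_of_divisor_eq`). At
every place `w` the local image of `α` comes from `K_v` up to roots of unity: above `ℓ` by
definition, elsewhere because the valuation comes from `K` and local units are roots of unity in the
completion. Let `τ` fix the part of `L` that lies in `K_v^c`. It extends to an automorphism of `L_w`
fixing `L_w ∩ K_v^c`, hence fixing the local roots of unity, since `[L_w : K_v]` is a power of `ℓ`.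
So `τα = α` (`eq_one_of_localization_mem`). As `F` is the intersection of these local parts, Galois
correspondence and flatness of `ℤ_ℓ` bring `α` down to `β ∈ ℛ_F`.

The cohomology class depends only on the class of `a`, again by Leopoldt. If it vanishes, `β`
modified by a root of unity comes from `ℛ_K`, where it is still pseudo-infinitesimal by a norm
argument (`mem_pseudoInfinitesimal_of_map`), so `a` is principal.

Every cohomology class occurs. By Hilbert 90 a cocycle is `σy / y` with `y ∈ F^×`. Locally `y` is a
Kummer radical inside `K_v(μ_{ℓ^∞})`, and for `ℓ` odd and `μ_ℓ ⊆ K` such a radical is `b_v ζ_v` with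
`b_v ∈ K_v` and `ζ_v` a root of unity (`exists_eq_mul_root`). Approximating the `b_v` for `v ∣ ℓ` by
some `κ ∈ ℛ_K` makes `y / κ` pseudo-infinitesimal with divisor extended from `K`
(`exists_pseudoInfinitesimal_of_local_root`).

Finally the kernel on `Cl^bp`, being isomorphic to a cohomology group killed elementwise by powers
of `ℓ`, is torsion, so it is also the kernel on the torsion modules. -/

namespace BertrandiasPayan

noncomputable section

/-! ### The functor `A ↦ ℤ_ℓ ⊗ A` and its `ℓ`-adic completion -/

section Adic

variable (ℓ : ℕ) [Fact ℓ.Prime] {A B C : Type*} [AddCommGroup A] [AddCommGroup B] [AddCommGroup C]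

/-- The map `ℤ_ℓ ⊗ A → ℤ_ℓ ⊗ B` induced by a homomorphism of abelian groups. -/
def adify (f : A →+ B) : ℤ_[ℓ] ⊗[ℤ] A →ₗ[ℤ_[ℓ]] ℤ_[ℓ] ⊗[ℤ] B :=
  LinearMap.baseChange ℤ_[ℓ] f.toIntLinearMap

@[simp] theorem adify_tmul (f : A →+ B) (c : ℤ_[ℓ]) (a : A) : adify ℓ f (c ⊗ₜ a) = c ⊗ₜ f a := rfl

theorem adicUnitsMap_eq_adify {R S : Type*} [CommRing R] [CommRing S] (f : R →+* S) :
    AdicUnits.map ℓ f = adify ℓ (MonoidHom.toAdditive (Units.map (f : R →* S))) := rfl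

theorem adify_comp (g : B →+ C) (f : A →+ B) (x : ℤ_[ℓ] ⊗[ℤ] A) :
    adify ℓ g (adify ℓ f x) = adify ℓ (g.comp f) x := by
  induction x using TensorProduct.induction_on with
  | zero => simp
  | tmul c a => rfl
  | add x y hx hy => simp only [map_add, hx, hy]

theorem adify_exact {f : A →+ B} {g : B →+ C} (h : Function.Exact f g) :
    Function.Exact (adify ℓ f) (adify ℓ g) :=
  Module.Flat.lTensor_exact (R := ℤ) ℤ_[ℓ] (f := f.toIntLinearMap) (g := g.toIntLinearMap) h

theorem adify_injective {f : A →+ B} (h : Function.Injective f) :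
    Function.Injective (adify ℓ f) :=
  Module.Flat.lTensor_preserves_injective_linearMap (R := ℤ) (M := ℤ_[ℓ]) f.toIntLinearMap h

theorem adify_nsmul_id (n : ℕ) (x : ℤ_[ℓ] ⊗[ℤ] A) :
    adify ℓ (nsmulAddMonoidHom n : A →+ A) x = n • x := by
  induction x using TensorProduct.induction_on with
  | zero => simp
  | tmul c a => simp
  | add x y hx hy => simp only [map_add, hx, hy, smul_add]

/-- An abelian group killed by `ℓ ^ n` is a retract of its `ℓ`-adification. -/
theorem exists_retraction {Q : Type*} [AddCommGroup Q] (n : ℕ) (h : ∀ q : Q, ℓ ^ n • q = 0) :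
    ∃ r : ℤ_[ℓ] ⊗[ℤ] Q →+ Q, ∀ q, r (1 ⊗ₜ q) = q := by
  let _ : Module (ZMod (ℓ ^ n)) Q := AddCommGroup.zmodModule h
  refine ⟨TensorProduct.liftAddHom
    { toFun := fun c ↦
        { toFun := fun q ↦ PadicInt.toZModPow n c • q
          map_zero' := smul_zero _
          map_add' := smul_add _ }
      map_zero' := by ext; simp
      map_add' := by intros; ext; simp [add_smul] } ?_, fun q ↦ ?_⟩
  · intro z c q
    change PadicInt.toZModPow n (z • c) • q = PadicInt.toZModPow n c • z • q
    rw [zsmul_eq_mul, map_mul, map_intCast, mul_comm, mul_smul, Int.cast_smul_eq_zsmul]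
  · simp

/-- Every element of `ℤ_ℓ ⊗ Q` is of the form `1 ⊗ q` if `Q` is killed by a power of `ℓ`. -/
theorem exists_eq_one_tmul {Q : Type*} [AddCommGroup Q] (n : ℕ) (h : ∀ q : Q, ℓ ^ n • q = 0)
    (x : ℤ_[ℓ] ⊗[ℤ] Q) : ∃ q, x = 1 ⊗ₜ q := by
  induction x using TensorProduct.induction_on with
  | zero => exact ⟨0, by simp⟩
  | add x y hx hy =>
    obtain ⟨a, rfl⟩ := hx
    obtain ⟨b, rfl⟩ := hy
    exact ⟨a + b, by rw [TensorProduct.tmul_add]⟩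
  | tmul c q =>
    obtain ⟨d, hd⟩ := Ideal.mem_span_singleton'.mp (PadicInt.appr_spec n c)
    refine ⟨c.appr n • q, ?_⟩
    have hc : c = d * (ℓ : ℤ_[ℓ]) ^ n + (c.appr n : ℤ_[ℓ]) := by rw [hd]; ring
    conv_lhs => rw [hc]
    rw [TensorProduct.add_tmul, TensorProduct.tmul_smul]
    have : d * (ℓ : ℤ_[ℓ]) ^ n = (ℓ ^ n) • d := by rw [nsmul_eq_mul]; push_cast; ring
    rw [this, TensorProduct.smul_tmul, h, TensorProduct.tmul_zero, zero_add,
      TensorProduct.smul_tmul', nsmul_eq_mul, mul_one]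

/-- By flatness the `ℓ ^ k`-torsion of `ℤ_ℓ ⊗ A` is `ℤ_ℓ ⊗ A[ℓ ^ k]`, and tensoring with `ℤ_ℓ` adds
nothing to a group killed by `ℓ ^ k`. -/
theorem exists_torsion_of_smul_eq_zero (k : ℕ) (x : ℤ_[ℓ] ⊗[ℤ] A) (hx : ℓ ^ k • x = 0) :
    ∃ a : A, ℓ ^ k • a = 0 ∧ x = 1 ⊗ₜ a := by
  have hex : Function.Exact (nsmulAddMonoidHom (ℓ ^ k) : A →+ A).ker.subtype
      (nsmulAddMonoidHom (ℓ ^ k) : A →+ A) := by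
    intro a
    simp
  obtain ⟨y, rfl⟩ := (adify_exact ℓ hex x).mp (by rw [adify_nsmul_id, hx])
  obtain ⟨q, rfl⟩ := exists_eq_one_tmul ℓ k (fun q ↦ Subtype.ext q.2) y
  exact ⟨q, q.2, rfl⟩

/-- `A / ℓ ^ n` is a retract of its `ℓ`-adification, so divisibility by `ℓ ^ n` is detected after
tensoring. -/
theorem exists_nsmul_of_one_tmul_eq (n : ℕ) (a : A) (z : ℤ_[ℓ] ⊗[ℤ] A)
    (h : 1 ⊗ₜ a = ℓ ^ n • z) : ∃ b : A, a = ℓ ^ n • b := by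
  let Q := A ⧸ (nsmulAddMonoidHom (ℓ ^ n) : A →+ A).range
  have hQ : ∀ q : Q, ℓ ^ n • q = 0 := by
    intro q
    induction q using QuotientAddGroup.induction_on with
    | H a => exact (QuotientAddGroup.eq_zero_iff _).mpr ⟨a, rfl⟩
  obtain ⟨r, hr⟩ := exists_retraction ℓ n hQ
  have h1 := congrArg (fun x ↦ r (adify ℓ (QuotientAddGroup.mk' _) x)) h
  simp only [adify_tmul, hr, map_nsmul, hQ] at h1
  obtain ⟨b, hb⟩ := (QuotientAddGroup.eq_zero_iff _).mp h1
  exact ⟨b, hb.symm⟩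

/-- A homomorphism to `ℤ` extends to `ℤ_ℓ ⊗ A → ℤ_ℓ`. -/
def adifyInt (f : A →+ ℤ) : ℤ_[ℓ] ⊗[ℤ] A →ₗ[ℤ_[ℓ]] ℤ_[ℓ] :=
  LinearMap.liftBaseChange ℤ_[ℓ] ((Int.castAddHom ℤ_[ℓ]).comp f).toIntLinearMap

@[simp] theorem adifyInt_tmul (f : A →+ ℤ) (c : ℤ_[ℓ]) (a : A) :
    adifyInt ℓ f (c ⊗ₜ a) = c * f a := rfl

/-- The `ℓ`-adic completion of `ℤ_ℓ ⊗ A`. -/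
abbrev Completed (A : Type*) [AddCommGroup A] : Type _ :=
  AdicCompletion (Ideal.span {(ℓ : ℤ_[ℓ])}) (ℤ_[ℓ] ⊗[ℤ] A)

/-- The map `ℤ_ℓ ⊗ A → lim (ℤ_ℓ ⊗ A) / ℓ ^ n`. -/
abbrev toCompleted (A : Type*) [AddCommGroup A] : ℤ_[ℓ] ⊗[ℤ] A →ₗ[ℤ_[ℓ]] Completed ℓ A :=
  AdicCompletion.of (Ideal.span {(ℓ : ℤ_[ℓ])}) (ℤ_[ℓ] ⊗[ℤ] A)

/-- The map between completions induced by a homomorphism of abelian groups. -/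
def completedMap (f : A →+ B) : Completed ℓ A →ₗ[ℤ_[ℓ]] Completed ℓ B :=
  (AdicCompletion.map (Ideal.span {(ℓ : ℤ_[ℓ])}) (adify ℓ f)).restrictScalars ℤ_[ℓ]

theorem completedMap_toCompleted (f : A →+ B) (x : ℤ_[ℓ] ⊗[ℤ] A) :
    completedMap ℓ f (toCompleted ℓ A x) = toCompleted ℓ B (adify ℓ f x) :=
  AdicCompletion.map_of _ _ _

theorem completedUnitsMap_eq {F E : Type*} [Field F] [Field E] (f : F →+* E) :
    CompletedUnits.map ℓ f = completedMap ℓ (MonoidHom.toAdditive (Units.map (f : F →* E))) := rfl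

variable {ℓ}

theorem mem_span_pow_smul_top {M : Type*} [AddCommGroup M] [Module ℤ_[ℓ] M] (n : ℕ) (x : M) :
    x ∈ (Ideal.span {(ℓ : ℤ_[ℓ])} ^ n • ⊤ : Submodule ℤ_[ℓ] M) ↔ ∃ y, x = ℓ ^ n • y := by
  rw [Ideal.span_singleton_pow, Submodule.ideal_span_singleton_smul,
    Submodule.mem_smul_pointwise_iff_exists]
  refine ⟨?_, ?_⟩
  · rintro ⟨y, -, rfl⟩
    exact ⟨y, by rw [← Nat.cast_pow, Nat.cast_smul_eq_nsmul]⟩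
  · rintro ⟨y, rfl⟩
    exact ⟨y, trivial, by rw [← Nat.cast_pow, Nat.cast_smul_eq_nsmul]⟩

theorem toCompleted_eq_zero_iff (x : ℤ_[ℓ] ⊗[ℤ] A) :
    toCompleted ℓ A x = 0 ↔ ∀ n, ∃ y, x = ℓ ^ n • y := by
  refine ⟨fun h n ↦ ?_, fun h ↦ AdicCompletion.ext fun n ↦ ?_⟩
  · have h1 := congrArg (fun y ↦ y.val n) h
    exact (mem_span_pow_smul_top n x).mp ((Submodule.Quotient.mk_eq_zero _).mp h1)
  · exact (Submodule.Quotient.mk_eq_zero _).mpr ((mem_span_pow_smul_top n x).mpr (h n))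

theorem toCompleted_val_eq_iff (x y : ℤ_[ℓ] ⊗[ℤ] A) (n : ℕ) :
    (toCompleted ℓ A x).val n = (toCompleted ℓ A y).val n ↔ ∃ z, x - y = ℓ ^ n • z := by
  rw [← mem_span_pow_smul_top]
  exact Submodule.Quotient.eq _

theorem completed_val_eq_of_le {x y : Completed ℓ A} {m n : ℕ} (hmn : m ≤ n)
    (h : x.val n = y.val n) : x.val m = y.val m := by
  have h1 := AdicCompletion.transitionMap_comp_eval_apply (Ideal.span {(ℓ : ℤ_[ℓ])}) _ hmn x
  have h2 := AdicCompletion.transitionMap_comp_eval_apply (Ideal.span {(ℓ : ℤ_[ℓ])}) _ hmn y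
  have h3 : AdicCompletion.eval (Ideal.span {(ℓ : ℤ_[ℓ])}) _ n x =
      AdicCompletion.eval (Ideal.span {(ℓ : ℤ_[ℓ])}) _ n y := h
  exact h1.symm.trans ((congrArg _ h3).trans h2)

/-- The `ℓ`-power torsion of the completion comes from the `ℓ`-power torsion of `A`. -/
theorem exists_torsion_of_completed (k : ℕ) (hfin : {a : A | ℓ ^ k • a = 0}.Finite)
    (y : Completed ℓ A) (hy : ℓ ^ k • y = 0) :
    ∃ a : A, ℓ ^ k • a = 0 ∧ y = toCompleted ℓ A (1 ⊗ₜ a) := by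
  have key : ∀ n, ∃ a : A, ℓ ^ k • a = 0 ∧ y.val n = (toCompleted ℓ A (1 ⊗ₜ a)).val n := by
    intro n
    -- Lifting at level `n + k` leaves room to divide the relation `ℓ ^ k • x ≡ 0` by `ℓ ^ k`: the
    -- correction `ℓ ^ n • z` is invisible at level `n`.
    obtain ⟨x, hx⟩ := Submodule.Quotient.mk_surjective _ (y.val (n + k))
    have hx' : (toCompleted ℓ A x).val (n + k) = y.val (n + k) := hx
    have h1 : (toCompleted ℓ A (ℓ ^ k • x)).val (n + k) = (toCompleted ℓ A 0).val (n + k) := by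
      rw [map_nsmul, AdicCompletion.val_smul_apply, hx', ← AdicCompletion.val_smul_apply, hy,
        map_zero]
    obtain ⟨z, hz⟩ := (toCompleted_val_eq_iff _ _ _).mp h1
    have h2 : ℓ ^ k • (x - ℓ ^ n • z) = 0 := by
      rw [smul_sub, smul_smul, ← pow_add, add_comm, ← hz, sub_zero, sub_self]
    obtain ⟨a, ha, hxa⟩ := exists_torsion_of_smul_eq_zero ℓ k _ h2
    refine ⟨a, ha, ?_⟩
    rw [← completed_val_eq_of_le (Nat.le_add_right n k) hx', toCompleted_val_eq_iff, ← hxa]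
    exact ⟨z, by abel⟩
  choose a ha hya using key
  -- Pigeonhole: one torsion element works at infinitely many levels, hence at all of them.
  have := hfin.to_subtype
  obtain ⟨b, hb⟩ := Finite.exists_infinite_fiber
    (fun n : ℕ ↦ (⟨a n, ha n⟩ : {a : A | ℓ ^ k • a = 0}))
  refine ⟨b, b.2, AdicCompletion.ext fun n ↦ ?_⟩
  obtain ⟨m, hm, hnm⟩ := (Set.infinite_coe_iff.mp hb).exists_gt n
  have hm' : a m = b := congrArg Subtype.val hm
  exact completed_val_eq_of_le hnm.le (hm' ▸ hya m)

/-- An `ℓ`-power torsion element of `A` with trivial image in the completion is trivial. -/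
theorem eq_zero_of_toCompleted_eq_zero (hfin : {a : A | ∃ k, ℓ ^ k • a = 0}.Finite) {a : A}
    (ha : ∃ k, ℓ ^ k • a = 0) (h : toCompleted ℓ A (1 ⊗ₜ a) = 0) : a = 0 := by
  rw [toCompleted_eq_zero_iff] at h
  have key : ∀ n, ∃ b : A, a = ℓ ^ n • b := fun n ↦ by
    obtain ⟨z, hz⟩ := h n
    exact exists_nsmul_of_one_tmul_eq ℓ n a z hz
  choose b hb using key
  obtain ⟨k, hk⟩ := ha
  have hbt : ∀ n, ∃ k, ℓ ^ k • b n = 0 := fun n ↦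
    ⟨k + n, by rw [pow_add, mul_smul, ← hb, hk]⟩
  choose! e he using fun (c : A) (hc : ∃ k, ℓ ^ k • c = 0) ↦ hc
  -- The finite primary torsion has a common exponent `ℓ ^ N`, which kills the `b N` with `a = ℓ ^ N
  -- • b N`.
  have hN : ∃ N, ∀ c, (∃ k, ℓ ^ k • c = 0) → e c ≤ N := by
    obtain ⟨N, hN⟩ := (hfin.image e).bddAbove
    exact ⟨N, fun c hc ↦ hN ⟨c, hc, rfl⟩⟩
  obtain ⟨N, hN⟩ := hN
  rw [hb N, ← Nat.sub_add_cancel (hN _ (hbt N)), pow_add, mul_smul,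
    Nat.sub_add_cancel (hN _ (hbt N)), he _ (hbt N), smul_zero]

/-- A multiple of a torsion element by an integer prime to `ℓ` is harmless. -/
theorem exists_pow_nsmul_eq_zero {M : Type*} [AddCommGroup M] [Module ℤ_[ℓ] M] {d : ℕ}
    (hd : d ≠ 0) {x : M} (hx : d • x = 0) : ∃ k, ℓ ^ k • x = 0 := by
  obtain ⟨k, m, hm, rfl⟩ := Nat.exists_eq_pow_mul_and_not_dvd hd ℓ (Fact.out : ℓ.Prime).ne_one
  refine ⟨k, ?_⟩
  have hu : IsUnit (m : ℤ_[ℓ]) := by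
    rw [PadicInt.isUnit_iff, PadicInt.norm_natCast_eq_one_iff]
    exact (Nat.Prime.coprime_iff_not_dvd Fact.out).mpr hm
  rw [← (hu.smul_eq_zero (x := ℓ ^ k • x)), Nat.cast_smul_eq_nsmul, smul_smul, mul_comm, hx]

/-- If `B / ℓ` is finite and `A → B / ℓ` is onto, then every element of `B` agrees in the completion
with the image of an element of `ℤ_ℓ ⊗ A`. -/
theorem exists_adify_eq (f : A →+ B)
    (hfin : Finite (B ⧸ (nsmulAddMonoidHom ℓ : B →+ B).range))
    (hf : ∀ b, ∃ a c, b = f a + ℓ • c) (b : B) :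
    ∃ x : ℤ_[ℓ] ⊗[ℤ] A, toCompleted ℓ B (adify ℓ f x) = toCompleted ℓ B (1 ⊗ₜ b) := by
  classical
  obtain ⟨T, hT⟩ : ∃ T : Finset A, ∀ b, ∃ a ∈ T, ∃ c, b = f a + ℓ • c := by
    cases nonempty_fintype (B ⧸ (nsmulAddMonoidHom ℓ : B →+ B).range)
    choose r s hr using hf
    refine ⟨Finset.univ.image fun q : B ⧸ (nsmulAddMonoidHom ℓ : B →+ B).range ↦ r q.out,
      fun b ↦ ⟨r (QuotientAddGroup.mk b : B ⧸ (nsmulAddMonoidHom ℓ : B →+ B).range).out,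
        Finset.mem_image_of_mem _ (Finset.mem_univ _), ?_⟩⟩
    obtain ⟨⟨_, z, rfl⟩, hz⟩ := QuotientAddGroup.mk_out_eq_add
      (nsmulAddMonoidHom ℓ : B →+ B).range b
    have h := hr (QuotientAddGroup.mk b : B ⧸ (nsmulAddMonoidHom ℓ : B →+ B).range).out
    refine ⟨s (QuotientAddGroup.mk b : B ⧸ (nsmulAddMonoidHom ℓ : B →+ B).range).out - z, ?_⟩
    rw [smul_sub, ← add_sub_assoc, ← h, hz]
    simp
  choose t htT nxt hnxt using hT
  -- An `ℓ`-adic expansion of `b`: the digits are the `f (t (u n))`, with `t (u n)` in the finite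
  -- set `T`, and the `u n` are the successive remainders.
  let u : ℕ → B := fun n ↦ nxt^[n] b
  have hu : ∀ n, u n = f (t (u n)) + ℓ • u (n + 1) := fun n ↦ by
    simp only [u, Function.iterate_succ_apply']
    exact hnxt _
  have hsum : ∀ n, b = (∑ i ∈ Finset.range n, ℓ ^ i • f (t (u i))) + ℓ ^ n • u n := by
    intro n
    induction n with
    | zero => simp [u]
    | succ n ih =>
      rw [Finset.sum_range_succ, add_assoc, pow_succ, mul_smul, ← smul_add, ← hu]
      exact ih
  -- Grouping the expansion by digit gives a finite combination whose coefficients converge in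
  -- `ℤ_ℓ`; finiteness of `T` keeps the limit in the tensor product.
  let c : A → ℕ → ℤ_[ℓ] := fun a n ↦ ∑ i ∈ Finset.range n, if t (u i) = a then (ℓ : ℤ_[ℓ]) ^ i else 0
  have hc : ∀ a, ∃ z : ℤ_[ℓ], ∀ n, ∃ d, z - c a n = ℓ ^ n • d := by
    intro a
    obtain ⟨z, hz⟩ := IsPrecomplete.prec (I := IsLocalRing.maximalIdeal ℤ_[ℓ]) (M := ℤ_[ℓ])
      inferInstance (f := c a) (fun {m n} hmn ↦ by
        rw [SModEq.sub_mem, PadicInt.maximalIdeal_eq_span_p, mem_span_pow_smul_top]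
        refine ⟨-∑ i ∈ Finset.range (n - m), if t (u (m + i)) = a then (ℓ : ℤ_[ℓ]) ^ i else 0, ?_⟩
        obtain ⟨k, rfl⟩ := Nat.exists_eq_add_of_le hmn
        simp only [c, Finset.sum_range_add, Nat.add_sub_cancel_left, smul_neg, Finset.smul_sum]
        rw [sub_add_cancel_left]
        congr 1
        refine Finset.sum_congr rfl fun i _ ↦ ?_
        split_ifs <;> simp [pow_add])
    refine ⟨z, fun n ↦ ?_⟩
    have := hz n
    rw [SModEq.comm, SModEq.sub_mem, PadicInt.maximalIdeal_eq_span_p, mem_span_pow_smul_top] at this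
    exact this
  choose z hz using hc
  refine ⟨∑ a ∈ T, z a ⊗ₜ a, ?_⟩
  rw [← sub_eq_zero, ← map_sub, toCompleted_eq_zero_iff]
  intro n
  choose d hd using fun a ↦ hz a n
  have h1 : ∑ a ∈ T, c a n ⊗ₜ[ℤ] f a = 1 ⊗ₜ ∑ i ∈ Finset.range n, ℓ ^ i • f (t (u i)) := by
    simp only [c, TensorProduct.sum_tmul, TensorProduct.tmul_sum]
    rw [Finset.sum_comm]
    refine Finset.sum_congr rfl fun i _ ↦ ?_
    rw [Finset.sum_eq_single (t (u i))]
    · rw [if_pos rfl, TensorProduct.tmul_smul, TensorProduct.smul_tmul', nsmul_eq_mul, mul_one,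
        Nat.cast_pow]
    · intro a _ ha
      rw [if_neg ha.symm, TensorProduct.zero_tmul]
    · exact fun h ↦ absurd (htT _) h
  refine ⟨∑ a ∈ T, d a ⊗ₜ f a - 1 ⊗ₜ u n, ?_⟩
  conv_lhs => rw [hsum n]
  rw [TensorProduct.tmul_add, ← h1, map_sum, ← sub_sub, ← Finset.sum_sub_distrib,
    TensorProduct.tmul_smul, smul_sub, Finset.smul_sum]
  congr 1
  refine Finset.sum_congr rfl fun a _ ↦ ?_
  rw [adify_tmul, ← TensorProduct.sub_tmul, hd, TensorProduct.smul_tmul']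

/-- The elements of `ℤ_ℓ ⊗ B` fixed by finitely many automorphisms come from the fixed elements. -/
theorem exists_adify_of_fixed {ι : Type*} [Finite ι] (f : A →+ B) (s : ι → B →+ B)
    (h : ∀ b, (∀ i, s i b = b) → ∃ a, f a = b) (x : ℤ_[ℓ] ⊗[ℤ] B)
    (hx : ∀ i, adify ℓ (s i) x = x) : ∃ y, adify ℓ f y = x := by
  classical
  cases nonempty_fintype ι
  -- The fixed elements are the kernel of this single map. Flatness commutes with the kernel and
  -- finiteness of `ι` commutes the tensor product with the product.
  let g : B →+ (ι → B) := AddMonoidHom.pi fun i ↦ s i - AddMonoidHom.id B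
  have hg : ∀ b i, g b i = s i b - b := fun b i ↦ rfl
  have hex : Function.Exact g.ker.subtype g := fun b ↦ by simp
  have hgx : adify ℓ g x = 0 := by
    have hinj : Function.Injective (TensorProduct.piRight ℤ ℤ_[ℓ] ℤ_[ℓ] fun _ : ι ↦ B) :=
      LinearEquiv.injective _
    apply hinj
    rw [map_zero]
    ext i
    have : ∀ x : ℤ_[ℓ] ⊗[ℤ] B, TensorProduct.piRight ℤ ℤ_[ℓ] ℤ_[ℓ] (fun _ : ι ↦ B) (adify ℓ g x) i =
        adify ℓ (s i) x - x := by
      intro x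
      induction x using TensorProduct.induction_on with
      | zero => simp
      | tmul c b => simp [hg, TensorProduct.tmul_sub]
      | add x y hx hy => simp only [map_add, Pi.add_apply, hx, hy]; abel
    rw [this, hx, sub_self]
    rfl
  obtain ⟨y, rfl⟩ := (adify_exact ℓ hex x).mp hgx
  clear hx hgx
  induction y using TensorProduct.induction_on with
  | zero => exact ⟨0, by simp⟩
  | tmul c b =>
    obtain ⟨a, ha⟩ := h b fun i ↦ by
      have := congrFun (b.2 : g b = 0) i
      simpa [hg, sub_eq_zero] using this
    exact ⟨c ⊗ₜ a, by simp [ha]⟩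
  | add x y hx hy =>
    obtain ⟨a, ha⟩ := hx
    obtain ⟨b, hb⟩ := hy
    exact ⟨a + b, by simp only [map_add, ha, hb]⟩

end Adic

/-! ### Multiplicative groups of local fields -/

section LocalField

theorem norm_div_sub_one_lt {F : Type*} [NormedField F] {x y : F} {r s : ℝ} (hs : 0 < s)
    (hy : s ≤ ‖y‖) (hxy : ‖x - y‖ < s * r) :
    ‖x / y - 1‖ < r := by
  have hy0 : y ≠ 0 := norm_pos_iff.mp (hs.trans_le hy)
  have hr : 0 < r := pos_of_mul_pos_right ((norm_nonneg _).trans_lt hxy) hs.le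
  rw [div_sub_one hy0, norm_div, div_lt_iff₀ (hs.trans_le hy)]
  calc ‖x - y‖ < s * r := hxy
    _ ≤ r * ‖y‖ := by rw [mul_comm]; gcongr

variable {F : Type*}

section Normed

variable [NormedField F] [IsUltrametricDist F]

theorem norm_le_one_of_norm_sub_one_le {x : F} (hx : ‖x - 1‖ ≤ 1) : ‖x‖ ≤ 1 := by
  have h := IsUltrametricDist.norm_add_le_max (x - 1) 1
  rw [sub_add_cancel, norm_one, max_eq_right hx] at h
  exact h

theorem norm_mul_sub_one_le {x y : F} {r : ℝ} (hx : ‖x - 1‖ ≤ r) (hy : ‖y - 1‖ ≤ r) (hr : r ≤ 1) :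
    ‖x * y - 1‖ ≤ r := by
  have h : x * y - 1 = (x - 1) * y + (y - 1) := by ring
  rw [h]
  refine (IsUltrametricDist.norm_add_le_max _ _).trans (max_le ?_ hy)
  rw [norm_mul]
  exact (mul_le_of_le_one_right (norm_nonneg _)
    (norm_le_one_of_norm_sub_one_le (hy.trans hr))).trans hx

theorem norm_pow_sub_one_le {x : F} {r : ℝ} (hx : ‖x - 1‖ ≤ r) (hr : r ≤ 1) (n : ℕ) :
    ‖x ^ n - 1‖ ≤ r := by
  induction n with
  | zero => simpa using (norm_nonneg _).trans hx
  | succ n ih => rw [pow_succ]; exact norm_mul_sub_one_le ih hx hr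

/-- If `x ≠ 1`, the sum `1 + x + ⋯ + x ^ (ℓ - 1)` vanishes; but it differs from `ℓ` by at most `‖x -
1‖ < ‖ℓ‖`. -/
theorem eq_one_of_pow_eq_one_of_norm_lt {ℓ : ℕ} {x : F} (h : x ^ ℓ = 1)
    (hx : ‖x - 1‖ < ‖(ℓ : F)‖) : x = 1 := by
  have hl : ‖(ℓ : F)‖ ≤ 1 := IsUltrametricDist.norm_natCast_le_one F ℓ
  have h1 := geom_sum_mul x ℓ
  rw [h, sub_self, mul_eq_zero, sub_eq_zero] at h1
  refine h1.resolve_left fun h0 ↦ ?_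
  have h2 : (ℓ : F) = -∑ i ∈ Finset.range ℓ, (x ^ i - 1) := by
    rw [Finset.sum_sub_distrib, h0]
    simp
  have h3 : ‖(ℓ : F)‖ ≤ ‖x - 1‖ := by
    conv_lhs => rw [h2, norm_neg]
    exact IsUltrametricDist.norm_sum_le_of_forall_le_of_nonneg (norm_nonneg _)
      fun i _ ↦ norm_pow_sub_one_le le_rfl (hx.le.trans hl) i
  exact absurd hx h3.not_gt

theorem eq_one_of_pow_pow_eq_one_of_norm_lt {ℓ : ℕ} {x : F} (k : ℕ) (h : x ^ ℓ ^ k = 1)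
    (hx : ‖x - 1‖ < ‖(ℓ : F)‖) : x = 1 := by
  have hl : ‖(ℓ : F)‖ ≤ 1 := IsUltrametricDist.norm_natCast_le_one F ℓ
  induction k with
  | zero => simpa using h
  | succ k ih =>
    refine ih (eq_one_of_pow_eq_one_of_norm_lt (ℓ := ℓ) (by rw [← pow_mul, ← pow_succ, h]) ?_)
    exact (norm_pow_sub_one_le le_rfl (hx.le.trans hl) _).trans_lt hx

/-- A subset of a finite union of small balls is finite if close elements are equal. -/
theorem finite_of_forall_dist_lt {α β : Type*} [PseudoMetricSpace α] {s : Set α}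
    (hs : TotallyBounded s) {r : ℝ} (hr : 0 < r) (g : β → α) (hg : ∀ b, g b ∈ s)
    (h : ∀ b c, dist (g b) (g c) < r → b = c) : Finite β := by
  obtain ⟨t, ht, hst⟩ := Metric.totallyBounded_iff.mp hs (r / 2) (half_pos hr)
  have h1 : ∀ b, ∃ y ∈ t, dist (g b) y < r / 2 := fun b ↦ by simpa using hst (hg b)
  choose y hyt hy using h1
  have := ht.to_subtype
  refine Finite.of_injective (fun b ↦ (⟨y b, hyt b⟩ : t)) fun b c hbc ↦ h b c ?_
  have hbc' : y b = y c := congrArg Subtype.val hbc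
  calc dist (g b) (g c) ≤ dist (g b) (y b) + dist (g c) (y b) := dist_triangle_right _ _ _
    _ < r / 2 + r / 2 := add_lt_add (hy b) (hbc' ▸ hy c)
    _ = r := add_halves r

/-- Elements sufficiently close to `1` are `ℓ`-th powers. -/
theorem exists_pow_eq_of_norm_sub_one_lt [CompleteSpace F] {ℓ : ℕ} (hl0 : (ℓ : F) ≠ 0) {x : F}
    (hx : ‖x - 1‖ < ‖(ℓ : F)‖ ^ 2) : ∃ y, y ^ ℓ = x ∧ ‖y - 1‖ < ‖(ℓ : F)‖ := by
  have hl : ‖(ℓ : F)‖ ≤ 1 := IsUltrametricDist.norm_natCast_le_one F ℓ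
  have hlpos : 0 < ‖(ℓ : F)‖ := norm_pos_iff.mpr hl0
  set t : F := (x - 1) / ℓ ^ 2 with ht
  have htr : ‖t‖ < 1 := by
    rw [ht, norm_div, norm_pow, div_lt_one (by positivity)]
    exact hx
  set r := ‖t‖ with hr
  have hr0 : 0 ≤ r := norm_nonneg _
  -- With `y = 1 + ℓ z` the equation `y ^ ℓ = x` becomes `P z = t`. Since `P` is close to the
  -- identity, `g` is a contraction of the ball of radius `r = ‖t‖`, and its fixed point is the
  -- solution.
  let P : F → F := fun z ↦ ((1 + ℓ * z) ^ ℓ - 1) / ℓ ^ 2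
  let g : F → F := fun z ↦ z - P z + t
  have hlz : ∀ z : F, ‖z‖ ≤ r → ‖(1 + ℓ * z) - 1‖ ≤ ‖(ℓ : F)‖ * r := fun z hz ↦ by
    rw [add_sub_cancel_left, norm_mul]
    gcongr
  have hlr : ‖(ℓ : F)‖ * r ≤ 1 := mul_le_one₀ hl hr0 htr.le
  have hP : ∀ z w : F, ‖z‖ ≤ r → ‖w‖ ≤ r → ‖(z - P z) - (w - P w)‖ ≤ r * ‖z - w‖ := by
    intro z w hz hw
    have h1 := (Commute.all (1 + ℓ * z) (1 + ℓ * w)).geom_sum₂_mul ℓ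
    set S := ∑ i ∈ Finset.range ℓ, (1 + ℓ * z) ^ i * (1 + ℓ * w) ^ (ℓ - 1 - i) with hS
    -- Each of the `ℓ` terms of `S` is within `‖ℓ‖ r` of `1`; dividing by `ℓ` gives the contraction
    -- constant `r`.
    have h2 : ‖S - ℓ‖ ≤ ‖(ℓ : F)‖ * r := by
      have : S - ℓ = ∑ i ∈ Finset.range ℓ, ((1 + ℓ * z) ^ i * (1 + ℓ * w) ^ (ℓ - 1 - i) - 1) := by
        rw [Finset.sum_sub_distrib, hS]
        simp
      rw [this]
      exact IsUltrametricDist.norm_sum_le_of_forall_le_of_nonneg (by positivity)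
        fun i _ ↦ norm_mul_sub_one_le (norm_pow_sub_one_le (hlz z hz) hlr _)
          (norm_pow_sub_one_le (hlz w hw) hlr _) hlr
    have h3 : (z - P z) - (w - P w) = -((S - ℓ) / ℓ * (z - w)) := by
      have : P z - P w = S * (ℓ * (z - w)) / ℓ ^ 2 := by
        have h4 : (1 + ℓ * z) - (1 + ℓ * w) = ℓ * (z - w) := by ring
        rw [h4] at h1
        rw [h1]
        simp only [P]
        ring
      rw [show (z - P z) - (w - P w) = (z - w) - (P z - P w) by ring, this]
      field_simp
      ring
    rw [h3, norm_neg, norm_mul, norm_div]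
    gcongr
    rw [div_le_iff₀ hlpos, mul_comm]
    exact h2
  have hP0 : P 0 = 0 := by simp [P]
  have hmaps : Set.MapsTo g (Metric.closedBall 0 r) (Metric.closedBall 0 r) := by
    intro z hz
    rw [mem_closedBall_zero_iff] at hz ⊢
    refine (IsUltrametricDist.norm_add_le_max _ _).trans (max_le ?_ le_rfl)
    have h1 := hP z 0 hz (by simpa using hr0)
    simp only [hP0, sub_zero] at h1
    exact h1.trans ((mul_le_of_le_one_right hr0 (hz.trans htr.le)))
  have hcontr : ContractingWith (⟨r, hr0⟩ : NNReal) (hmaps.restrict g _ _) := by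
    refine ⟨htr, LipschitzWith.of_dist_le_mul fun z w ↦ ?_⟩
    simp only [Subtype.dist_eq, Set.MapsTo.val_restrict_apply, dist_eq_norm]
    have h1 := hP z w (mem_closedBall_zero_iff.mp z.2) (mem_closedBall_zero_iff.mp w.2)
    have h2 : g z - g w = (z - P z) - (w - P w) := by simp only [g]; ring
    rw [h2]
    exact h1
  obtain ⟨z, hz, hfix, -⟩ := hcontr.exists_fixedPoint' (Metric.isClosed_closedBall.isComplete) hmaps
    (x := 0) (Metric.mem_closedBall_self hr0) (edist_ne_top _ _)
  rw [mem_closedBall_zero_iff] at hz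
  have hPz : P z = t := by
    have : z - P z + t = z := hfix
    linear_combination -this
  refine ⟨1 + ℓ * z, ?_, ?_⟩
  · have h2 : (ℓ : F) ^ 2 ≠ 0 := pow_ne_zero 2 hl0
    have h4 : (1 + ℓ * z) ^ ℓ - 1 = x - 1 := (div_left_inj' h2).mp hPz
    linear_combination h4
  · rw [add_sub_cancel_left, norm_mul]
    exact mul_lt_of_lt_one_right hlpos (hz.trans_lt htr)

/-- When `ℓ` is a unit, the root found by the contraction lies in the same open unit ball around
`1`, so extraction of roots can be iterated. Principal units are thus infinitely `ℓ`-divisible. -/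
theorem exists_pow_pow_eq_of_norm_sub_one_lt [CompleteSpace F] {ℓ : ℕ} (hl : ‖(ℓ : F)‖ = 1) (n : ℕ)
    {x : F} (hx : ‖x - 1‖ < 1) : ∃ y, y ^ ℓ ^ n = x ∧ ‖y - 1‖ < 1 := by
  induction n with
  | zero => exact ⟨x, by simp, hx⟩
  | succ n ih =>
    obtain ⟨y, rfl, hy⟩ := ih
    obtain ⟨z, rfl, hz⟩ := exists_pow_eq_of_norm_sub_one_lt (ℓ := ℓ) (x := y)
      (norm_ne_zero_iff.mp (by rw [hl]; exact one_ne_zero)) (by rw [hl, one_pow]; exact hy)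
    exact ⟨z, by rw [← pow_mul, pow_succ'], hl ▸ hz⟩

end Normed

variable [NontriviallyNormedField F] [IsUltrametricDist F] [ProperSpace F]

/-- A local field of characteristic zero contains finitely many roots of unity of `ℓ`-power
order. -/
theorem finite_primary_torsion {ℓ : ℕ} (hl0 : (ℓ : F) ≠ 0) :
    {u : Additive Fˣ | ∃ k, ℓ ^ k • u = 0}.Finite := by
  have hlpos : 0 < ‖(ℓ : F)‖ := norm_pos_iff.mpr hl0
  have hℓ : ℓ ≠ 0 := by rintro rfl; simp at hl0
  have hpow : ∀ u : {u : Additive Fˣ | ∃ k, ℓ ^ k • u = 0},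
      ∃ k, (u.1.toMul : F) ^ ℓ ^ k = 1 := fun u ↦ by
    obtain ⟨k, hk⟩ := u.2
    exact ⟨k, congrArg Units.val (congrArg Additive.toMul hk)⟩
  have hnorm : ∀ u : {u : Additive Fˣ | ∃ k, ℓ ^ k • u = 0}, ‖(u.1.toMul : F)‖ = 1 := fun u ↦ by
    obtain ⟨k, hk⟩ := hpow u
    have h := congrArg norm hk
    rw [norm_pow, norm_one] at h
    exact (pow_eq_one_iff_of_nonneg (norm_nonneg _) (pow_ne_zero k hℓ)).mp h
  refine Set.finite_coe_iff.mp (finite_of_forall_dist_lt (isCompact_closedBall (0 : F) 1).totallyBounded hlpos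
    (fun u ↦ (u.1.toMul : F)) (fun u ↦ by simp [hnorm u]) fun u w huw ↦ ?_)
  rw [dist_eq_norm] at huw
  have h1 : ‖(u.1.toMul : F) / (w.1.toMul : F) - 1‖ < ‖(ℓ : F)‖ :=
    norm_div_sub_one_lt one_pos (hnorm w).ge (by rwa [one_mul])
  obtain ⟨k, hk⟩ := hpow u
  obtain ⟨m, hm⟩ := hpow w
  have h2 : ((u.1.toMul : F) / (w.1.toMul : F)) ^ ℓ ^ (k + m) = 1 := by
    rw [div_pow, pow_add, pow_mul, hk, mul_comm, pow_mul, hm, one_pow, one_pow, div_one]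
  have h3 := eq_one_of_pow_pow_eq_one_of_norm_lt _ h2 h1
  rw [div_eq_one_iff_eq (Units.ne_zero _)] at h3
  exact Subtype.ext (Additive.toMul.injective (Units.ext h3))

/-- The group `F^× / F^{×ℓ}` is finite for a local field `F` of characteristic zero. -/
theorem finite_units_quotient {ℓ : ℕ} (hl0 : (ℓ : F) ≠ 0) :
    Finite (Additive Fˣ ⧸ (nsmulAddMonoidHom ℓ : Additive Fˣ →+ Additive Fˣ).range) := by
  have hlpos : 0 < ‖(ℓ : F)‖ := norm_pos_iff.mpr hl0
  have hℓ : ℓ ≠ 0 := by rintro rfl; simp at hl0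
  obtain ⟨c, hc⟩ := NormedField.exists_one_lt_norm F
  have hc0 : c ≠ 0 := norm_pos_iff.mp (one_pos.trans hc)
  have hcl : 1 < ‖c ^ ℓ‖ := by rw [norm_pow]; exact one_lt_pow₀ hc hℓ
  -- Scaling by powers of `c ^ ℓ` does not change the class and brings a representative into a
  -- compact shell. The lower bound on norms there turns closeness into a quotient close to `1`,
  -- hence an `ℓ`-th power.
  have hrep : ∀ q : Additive Fˣ ⧸ (nsmulAddMonoidHom ℓ : Additive Fˣ →+ Additive Fˣ).range,
      ∃ u : Additive Fˣ, QuotientAddGroup.mk u = q ∧ ‖c ^ ℓ‖⁻¹ ≤ ‖(u.toMul : F)‖ ∧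
        ‖(u.toMul : F)‖ ≤ 1 := by
    intro q
    obtain ⟨u, rfl⟩ := QuotientAddGroup.mk_surjective q
    obtain ⟨n, hn1, hn2⟩ := rescale_to_shell_zpow hcl one_pos (x := (u.toMul : F)) (Units.ne_zero _)
    refine ⟨u + ℓ • (n • Additive.ofMul (Units.mk0 c hc0)), ?_, ?_, ?_⟩
    · rw [← sub_eq_zero, ← QuotientAddGroup.mk_sub, add_sub_cancel_left,
        QuotientAddGroup.eq_zero_iff]
      exact ⟨_, rfl⟩
    all_goals
      have h : ((u + ℓ • (n • Additive.ofMul (Units.mk0 c hc0))).toMul : F) =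
          (c ^ ℓ) ^ n • (u.toMul : F) := by
        simp only [toMul_add, toMul_nsmul, toMul_zsmul, toMul_ofMul, Units.val_mul, Units.val_pow_eq_pow_val,
          Units.val_zpow_eq_zpow_val, Units.val_mk0, smul_eq_mul]
        rw [mul_comm, ← zpow_natCast, ← zpow_natCast, zpow_comm]
      rw [h]
    · simpa using hn2.2.1
    · exact hn2.1.le
  choose u hu hu1 hu2 using hrep
  have hcpos : 0 < ‖c ^ ℓ‖⁻¹ := inv_pos.mpr (one_pos.trans hcl)
  refine finite_of_forall_dist_lt (isCompact_closedBall (0 : F) 1).totallyBounded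
    (r := ‖c ^ ℓ‖⁻¹ * ‖(ℓ : F)‖ ^ 2) (by positivity)
    (fun q ↦ ((u q).toMul : F)) (fun q ↦ by simpa using hu2 q) fun q p hqp ↦ ?_
  rw [dist_eq_norm] at hqp
  obtain ⟨y, hy, -⟩ := exists_pow_eq_of_norm_sub_one_lt hl0
    (norm_div_sub_one_lt hcpos (hu1 p) hqp)
  have hy0 : y ≠ 0 := by
    rintro rfl
    rw [zero_pow hℓ, eq_comm, div_eq_zero_iff] at hy
    exact hy.elim (Units.ne_zero _) (Units.ne_zero _)
  rw [← hu q, ← hu p, ← sub_eq_zero, ← QuotientAddGroup.mk_sub, QuotientAddGroup.eq_zero_iff]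
  refine ⟨Additive.ofMul (Units.mk0 y hy0), Additive.toMul.injective (Units.ext ?_)⟩
  simpa using hy

/-- In residue characteristic different from `ℓ`, a unit is locally a root of unity. -/
theorem toCompleted_mem_completedRoots {ℓ : ℕ} [Fact ℓ.Prime] (hl : ‖(ℓ : F)‖ = 1) (u : Fˣ)
    (hu : ‖(u : F)‖ = 1) :
    toCompleted ℓ (Additive Fˣ) (1 ⊗ₜ Additive.ofMul u) ∈ completedRoots ℓ F := by
  -- Otherwise the powers of `u` would be infinitely many points of the compact unit ball at mutual
  -- distance at least `1`.
  obtain ⟨N, hN0, hN⟩ : ∃ N, N ≠ 0 ∧ ‖(u : F) ^ N - 1‖ < 1 := by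
    by_contra! hcon
    refine not_finite_iff_infinite.mpr (inferInstance : Infinite ℕ)
      (finite_of_forall_dist_lt (isCompact_closedBall (0 : F) 1).totallyBounded one_pos
      (fun n : ℕ ↦ (u : F) ^ n) (fun n ↦ by simp [hu]) ?_)
    intro a b hab
    wlog hle : a ≤ b generalizing a b
    · exact (this b a (by rwa [dist_comm]) (le_of_not_ge hle)).symm
    obtain ⟨d, rfl⟩ := Nat.exists_eq_add_of_le hle
    by_contra hne
    refine (hcon d (by omega)).not_gt ?_
    rw [dist_comm, dist_eq_norm, pow_add, ← mul_sub_one, norm_mul, norm_pow, hu, one_pow, one_mul]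
      at hab
    exact hab
  obtain ⟨s, m, hm, rfl⟩ := Nat.exists_eq_pow_mul_and_not_dvd hN0 ℓ (Fact.out : ℓ.Prime).ne_one
  obtain ⟨y, hy, hy1⟩ := exists_pow_pow_eq_of_norm_sub_one_lt hl s hN
  have hy0 : y ≠ 0 := by
    rintro rfl
    rw [zero_pow (pow_ne_zero s (Fact.out : ℓ.Prime).ne_zero)] at hy
    exact pow_ne_zero _ (Units.ne_zero u) hy.symm
  have hζ : (u ^ m / Units.mk0 y hy0) ^ ℓ ^ s = 1 := by
    rw [div_pow, div_eq_one]
    exact Units.ext (by simp [hy, ← pow_mul, mul_comm])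
  -- The principal unit `y` is infinitely `ℓ`-divisible, so it dies in the completion and leaves
  -- only a root of unity. The factor `m`, prime to `ℓ`, is then inverted in `ℤ_ℓ`.
  have key : m • toCompleted ℓ (Additive Fˣ) (1 ⊗ₜ Additive.ofMul u) =
      toCompleted ℓ (Additive Fˣ) (1 ⊗ₜ Additive.ofMul (u ^ m / Units.mk0 y hy0)) := by
    rw [← map_nsmul, ← sub_eq_zero, ← map_sub, toCompleted_eq_zero_iff]
    intro n
    obtain ⟨z, hz, -⟩ := exists_pow_pow_eq_of_norm_sub_one_lt hl n hy1
    have hz0 : z ≠ 0 := by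
      rintro rfl
      rw [zero_pow (pow_ne_zero n (Fact.out : ℓ.Prime).ne_zero)] at hz
      exact hy0 hz.symm
    refine ⟨1 ⊗ₜ Additive.ofMul (Units.mk0 z hz0), ?_⟩
    rw [← TensorProduct.tmul_smul, ← TensorProduct.tmul_smul, ← TensorProduct.tmul_sub]
    congr 1
    refine Additive.toMul.injective (Units.ext ?_)
    simp [hz]
  have hu : IsUnit (m : ℤ_[ℓ]) := by
    rw [PadicInt.isUnit_iff, PadicInt.norm_natCast_eq_one_iff]
    exact (Nat.Prime.coprime_iff_not_dvd Fact.out).mpr hm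
  obtain ⟨c, hc⟩ := hu
  have h2 := (completedRoots ℓ F).smul_mem (↑c⁻¹ : ℤ_[ℓ])
    (Submodule.subset_span ⟨⟨_, s, hζ⟩, key.symm⟩)
  rwa [← Nat.cast_smul_eq_nsmul ℤ_[ℓ], ← hc, smul_smul, Units.inv_mul, one_smul] at h2

end LocalField

/-! ### Completions of number fields -/

section Completion

variable (K : Type*) [Field K] [NumberField K] (v : HeightOneSpectrum (𝓞 K))

instance : NontriviallyNormedField (v.adicCompletion K) :=
  Valued.toNontriviallyNormedField (v.adicCompletion K) (WithZero (Multiplicative ℤ))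

instance : CharZero (v.adicCompletion K) :=
  charZero_of_injective_algebraMap (algebraMap K (v.adicCompletion K)).injective

variable {K v}

theorem norm_le_one_iff {x : v.adicCompletion K} : ‖x‖ ≤ 1 ↔ Valued.v x ≤ 1 :=
  Valued.toNormedField.norm_le_one_iff

theorem norm_lt_one_iff {x : v.adicCompletion K} : ‖x‖ < 1 ↔ Valued.v x < 1 :=
  Valued.toNormedField.norm_lt_one_iff

theorem valued_algebraMap (x : K) :
    Valued.v (algebraMap K (v.adicCompletion K) x) = v.valuation K x :=
  v.valuedAdicCompletion_eq_valuation' x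

theorem exists_norm_sub_lt (b : v.adicCompletion K) {ε : ℝ} (hε : 0 < ε) :
    ∃ x : K, ‖algebraMap K (v.adicCompletion K) x - b‖ < ε := by
  obtain ⟨x, hx⟩ := (HeightOneSpectrum.denseRange_algebraMap K v).exists_mem_open
    Metric.isOpen_ball ⟨b, Metric.mem_ball_self hε⟩
  exact ⟨x, by rwa [mem_ball_iff_norm] at hx⟩

theorem norm_sub_lt_one_of_le {b : v.adicCompletion K} (hb : ‖b‖ ≤ 1) :
    ∃ a : 𝓞 K, ‖algebraMap K (v.adicCompletion K) a - b‖ < 1 := by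
  obtain ⟨x, hx⟩ := exists_norm_sub_lt b one_pos
  have hx1 : ‖algebraMap K (v.adicCompletion K) x‖ ≤ 1 := by
    rw [← sub_add_cancel (algebraMap K (v.adicCompletion K) x) b]
    exact (IsUltrametricDist.norm_add_le_max _ _).trans (max_le hx.le hb)
  rw [norm_le_one_iff, valued_algebraMap] at hx1
  obtain ⟨a, ha⟩ := v.exists_valuation_sub_lt_of_integer hx1 1
  refine ⟨a, ?_⟩
  rw [Units.val_one, ← valued_algebraMap, ← norm_lt_one_iff, map_sub] at ha
  rw [← sub_add_sub_cancel _ (algebraMap K (v.adicCompletion K) x)]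
  exact (IsUltrametricDist.norm_add_le_max _ _).trans_lt (max_lt ha hx)

/-- Local compactness follows from completeness, discreteness of the valuation and finiteness of the
residue field, onto which `𝓞 K ⧸ v` surjects by density. -/
instance : ProperSpace (v.adicCompletion K) := by
  refine Valued.integer.properSpace_iff_completeSpace_and_isDiscreteValuationRing_integer_and_finite_residueField.mpr
    ⟨inferInstance, inferInstanceAs (IsDiscreteValuationRing (v.adicCompletionIntegers K)), ?_⟩
  change Finite (IsLocalRing.ResidueField (v.adicCompletionIntegers K))
  have hfin : Finite (𝓞 K ⧸ v.asIdeal) := v.asIdeal.finiteQuotientOfFreeOfNeBot v.ne_bot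
  have hker : ∀ a ∈ v.asIdeal, (IsLocalRing.residue (v.adicCompletionIntegers K)).comp
      (algebraMap (𝓞 K) (v.adicCompletionIntegers K)) a = 0 := by
    intro a ha
    rw [RingHom.comp_apply, IsLocalRing.residue_eq_zero_iff, IsLocalRing.mem_maximalIdeal,
      mem_nonunits_iff, HeightOneSpectrum.adicCompletionIntegers.isUnit_iff_valued_eq_one]
    refine ne_of_lt ?_
    change Valued.v (algebraMap K (v.adicCompletion K) a) < 1
    rw [valued_algebraMap]
    exact (v.valuation_lt_one_iff_mem a).mpr ha
  refine Finite.of_surjective (Ideal.Quotient.lift v.asIdeal _ hker) fun q ↦ ?_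
  obtain ⟨b, rfl⟩ := IsLocalRing.residue_surjective q
  obtain ⟨a, ha⟩ := norm_sub_lt_one_of_le (v := v) (b := b) (norm_le_one_iff.mpr b.2)
  refine ⟨Ideal.Quotient.mk _ a, ?_⟩
  rw [Ideal.Quotient.lift_mk, RingHom.comp_apply, ← sub_eq_zero, ← map_sub,
    IsLocalRing.residue_eq_zero_iff, IsLocalRing.mem_maximalIdeal, mem_nonunits_iff,
    HeightOneSpectrum.adicCompletionIntegers.isUnit_iff_valued_eq_one]
  exact ne_of_lt (norm_lt_one_iff.mp ha)

/-- The normalised valuation on the multiplicative group of a completion. -/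
def localOrd (v : HeightOneSpectrum (𝓞 K)) : Additive (v.adicCompletion K)ˣ →+ ℤ where
  toFun u := -(Valued.v (u.toMul : v.adicCompletion K)).log
  map_zero' := by simp
  map_add' u w := by
    rw [toMul_add, Units.val_mul, map_mul, WithZero.log_mul (by simp) (by simp)]
    ring

theorem localOrd_eq_zero_iff (u : (v.adicCompletion K)ˣ) :
    localOrd v (Additive.ofMul u) = 0 ↔ ‖(u : v.adicCompletion K)‖ = 1 := by
  have h0 : (Valued.v (u : v.adicCompletion K)) ≠ 0 := by simp
  have h1 : ‖(u : v.adicCompletion K)‖ = 1 ↔ Valued.v (u : v.adicCompletion K) = 1 := by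
    rw [le_antisymm_iff, le_antisymm_iff, norm_le_one_iff, Valued.toNormedField.one_le_norm_iff]
  rw [h1]
  refine ⟨fun h ↦ ?_, fun h ↦ by simp [localOrd, h]⟩
  have h2 : (Valued.v (u : v.adicCompletion K)).log = 0 := neg_eq_zero.mp h
  rw [← WithZero.exp_log h0, h2, WithZero.exp_zero]

theorem localOrd_map (x : Kˣ) :
    localOrd v (Additive.ofMul (Units.map (algebraMap K (v.adicCompletion K) : K →* _) x)) =
      ord v x := by
  change -(Valued.v (algebraMap K (v.adicCompletion K) (x : K))).log = _
  rw [valued_algebraMap]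
  rfl

/-- The valuation as a homomorphism from the additive version of `K^×`. -/
def ordHom (v : HeightOneSpectrum (𝓞 K)) : Additive Kˣ →+ ℤ where
  toFun x := ord v x.toMul
  map_zero' := ord_one v
  map_add' _ _ := ord_mul v _ _

variable (v) in
theorem exists_ord_eq_one : ∃ π : Kˣ, ord v π = 1 := by
  obtain ⟨π, hπ⟩ := v.valuation_exists_uniformizer K
  have h0 : π ≠ 0 := fun h ↦ WithZero.exp_ne_zero (hπ.symm.trans (by rw [h, map_zero]))
  exact ⟨Units.mk0 π h0, by simp [ord, hπ]⟩

theorem norm_natCast_eq_one {ℓ : ℕ} (h : (ℓ : 𝓞 K) ∉ v.asIdeal) :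
    ‖(ℓ : v.adicCompletion K)‖ = 1 := by
  refine le_antisymm (IsUltrametricDist.norm_natCast_le_one _ _) (le_of_not_gt fun hlt ↦ h ?_)
  rw [norm_lt_one_iff] at hlt
  rw [← v.valuation_lt_one_iff_mem (K := K), ← valued_algebraMap]
  simpa using hlt

theorem norm_algebraMap_le_pow (e : ℕ) (a : 𝓞 K) (ha : a ∈ v.asIdeal ^ e) :
    ‖algebraMap K (v.adicCompletion K) a‖ ≤ ((Ideal.absNorm v.asIdeal : ℝ)⁻¹) ^ e := by
  have h1 : ‖algebraMap K (v.adicCompletion K) a‖ =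
      WithZeroMulInt.toNNReal (HeightOneSpectrum.absNorm_ne_zero v) (v.intValuation a) :=
    FinitePlace.norm_embedding_int K v a
  have h2 := (v.intValuation_le_pow_iff_mem a e).mpr ha
  have h3 := (WithZeroMulInt.toNNReal_strictMono
    (HeightOneSpectrum.one_lt_absNorm_nnreal v)).monotone h2
  rw [h1]
  refine (NNReal.coe_le_coe.mpr h3).trans (le_of_eq ?_)
  rw [WithZeroMulInt.toNNReal_neg_apply _ (by simp)]
  simp only [WithZero.exp, WithZero.unzero_coe, toAdd_ofAdd]
  simp

/-- Weak approximation: approximate at each place separately, clear a common denominator `D`, and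
apply the Chinese remainder theorem to the numerators. The exponents `e v` are large enough to
absorb the division by `D`. -/
theorem exists_simultaneous_approx (S : Finset (HeightOneSpectrum (𝓞 K)))
    (b : ∀ v : HeightOneSpectrum (𝓞 K), v.adicCompletion K)
    {ε : HeightOneSpectrum (𝓞 K) → ℝ} (hε : ∀ v, 0 < ε v) :
    ∃ x : K, ∀ v ∈ S, ‖algebraMap K (v.adicCompletion K) x - b v‖ < ε v := by
  classical
  choose x hx using fun v ↦ exists_norm_sub_lt (b v) (hε v)
  obtain ⟨⟨D, hD⟩, hDx⟩ := IsLocalization.exist_integer_multiples (nonZeroDivisors (𝓞 K)) S x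
  have hD0 : (D : K) ≠ 0 := by simpa using nonZeroDivisors.ne_zero hD
  have hDv : ∀ v : HeightOneSpectrum (𝓞 K), 0 < ‖algebraMap K (v.adicCompletion K) (D : K)‖ :=
    fun v ↦ norm_pos_iff.mpr (by simpa using hD0)
  choose! n hn using hDx
  have hlt : ∀ v : HeightOneSpectrum (𝓞 K), ((Ideal.absNorm v.asIdeal : ℝ)⁻¹) < 1 := fun v ↦
    inv_lt_one_of_one_lt₀ (by exact_mod_cast HeightOneSpectrum.one_lt_absNorm v)
  choose e he using fun v ↦ exists_pow_lt_of_lt_one (mul_pos (hDv v) (hε v)) (hlt v)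
  obtain ⟨y, hy⟩ := exists_forall_sub_mem_ideal (s := S) (fun v ↦ v.asIdeal) e
    (fun v _ ↦ v.prime) (fun v _ w _ hvw h ↦ hvw (HeightOneSpectrum.ext h)) (fun v ↦ n v)
  refine ⟨y / D, fun v hv ↦ ?_⟩
  have h1 := (norm_algebraMap_le_pow (e v) _ (hy v hv)).trans_lt (he v)
  have h2 : (n v : K) = D * x v := by
    have := hn v hv
    rwa [Algebra.smul_def] at this
  have h3 : ‖algebraMap K (v.adicCompletion K) (y / D) - algebraMap K (v.adicCompletion K) (x v)‖ <
      ε v := by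
    have h4 : ((y : K) / D - x v) = ((y - n v : 𝓞 K) : K) / D := by
      have h5 : ((y - n v : 𝓞 K) : K) = y - n v := map_sub (algebraMap (𝓞 K) K) _ _
      rw [h5, h2, sub_div, mul_div_cancel_left₀ _ hD0]
    rw [← map_sub, h4, map_div₀, norm_div, div_lt_iff₀ (hDv v), mul_comm]
    exact h1
  rw [← sub_add_sub_cancel _ (algebraMap K (v.adicCompletion K) (x v))]
  exact (IsUltrametricDist.norm_add_le_max _ _).trans_lt (max_lt h3 (hx v))

theorem finite_places_over {ℓ : ℕ} (hℓ : ℓ ≠ 0) :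
    {v : HeightOneSpectrum (𝓞 K) | (ℓ : 𝓞 K) ∈ v.asIdeal}.Finite := by
  have h0 : Ideal.span {(ℓ : 𝓞 K)} ≠ 0 := by simpa using hℓ
  refine (Ideal.finite_factors h0).subset fun v hv ↦ ?_
  exact Ideal.dvd_span_singleton.mpr hv

/-- Every family of local elements at the places above `ℓ` is congruent to a global element modulo
`ℓ`-th powers. -/
theorem exists_unit_eq_mul_pow {ℓ : ℕ} (hℓ : ℓ ≠ 0)
    (b : ∀ v : {v : HeightOneSpectrum (𝓞 K) // (ℓ : 𝓞 K) ∈ v.asIdeal},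
      (v.1.adicCompletion K)ˣ) :
    ∃ x : Kˣ, ∀ v, ∃ y : (v.1.adicCompletion K)ˣ,
      b v = Units.map (algebraMap K (v.1.adicCompletion K) : K →* _) x * y ^ ℓ := by
  classical
  have hfinS := finite_places_over (K := K) hℓ
  have hl0 : ∀ v : HeightOneSpectrum (𝓞 K), (ℓ : v.adicCompletion K) ≠ 0 := fun v ↦ by
    simpa using hℓ
  have hpos : ∀ v : HeightOneSpectrum (𝓞 K), 0 < ‖(ℓ : v.adicCompletion K)‖ ^ 2 := fun v ↦
    pow_pos (norm_pos_iff.mpr (hl0 v)) 2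
  let b' : ∀ v : HeightOneSpectrum (𝓞 K), (v.adicCompletion K)ˣ := fun v ↦
    if h : (ℓ : 𝓞 K) ∈ v.asIdeal then b ⟨v, h⟩ else 1
  have hb'pos : ∀ v, 0 < ‖((b' v : (v.adicCompletion K)ˣ) : v.adicCompletion K)‖ := fun v ↦
    norm_pos_iff.mpr (Units.ne_zero _)
  obtain ⟨x, hx⟩ := exists_simultaneous_approx hfinS.toFinset
    (fun v ↦ ((b' v : (v.adicCompletion K)ˣ) : v.adicCompletion K))
    (ε := fun v ↦ ‖((b' v : (v.adicCompletion K)ˣ) : v.adicCompletion K)‖ *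
      min 1 (‖(ℓ : v.adicCompletion K)‖ ^ 2))
    (fun v ↦ mul_pos (hb'pos v) (lt_min one_pos (hpos v)))
  have hx' : ∀ v : {v : HeightOneSpectrum (𝓞 K) // (ℓ : 𝓞 K) ∈ v.asIdeal},
      ‖algebraMap K (v.1.adicCompletion K) x / (b v : v.1.adicCompletion K) - 1‖ <
        min 1 (‖(ℓ : v.1.adicCompletion K)‖ ^ 2) := by
    intro v
    have h1 := hx v.1 (hfinS.mem_toFinset.mpr v.2)
    have h2 : b' v.1 = b v := dif_pos v.2
    rw [h2] at h1
    exact norm_div_sub_one_lt (norm_pos_iff.mpr (Units.ne_zero _)) le_rfl h1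
  -- The bound `min 1 _` excludes `x = 0` as soon as there is a place `v` to test, since `0 / b v -
  -- 1` has norm `1`; without such a place any unit would do.
  by_cases hx0 : x = 0
  · exact ⟨1, fun v ↦ absurd ((hx' v).trans_le (min_le_left _ _)) (by simp [hx0])⟩
  · refine ⟨Units.mk0 x hx0, fun v ↦ ?_⟩
    obtain ⟨y, hy, -⟩ :=
      exists_pow_eq_of_norm_sub_one_lt (hl0 v.1) ((hx' v).trans_le (min_le_right _ _))
    have hy0 : y ≠ 0 := fun h ↦ by
      rw [h, zero_pow hℓ, eq_comm, div_eq_zero_iff] at hy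
      exact hy.elim (by simpa using hx0) (Units.ne_zero _)
    refine ⟨(Units.mk0 y hy0)⁻¹, ?_⟩
    rw [inv_pow, eq_mul_inv_iff_mul_eq]
    refine Units.ext ?_
    rw [eq_div_iff (Units.ne_zero _), mul_comm] at hy
    exact hy

theorem finite_pi_quotient {ι : Type*} [Finite ι] {B : ι → Type*} [∀ i, AddCommGroup (B i)] (n : ℕ)
    (h : ∀ i, Finite (B i ⧸ (nsmulAddMonoidHom n : B i →+ B i).range)) :
    Finite ((∀ i, B i) ⧸ (nsmulAddMonoidHom n : (∀ i, B i) →+ ∀ i, B i).range) := by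
  refine Finite.of_injective (β := ∀ i, B i ⧸ (nsmulAddMonoidHom n : B i →+ B i).range)
    (fun q i ↦ QuotientAddGroup.mk (q.out i)) fun q p hqp ↦ ?_
  rw [← q.out_eq', ← p.out_eq']
  have h1 := fun i ↦ congrFun hqp i
  simp only [QuotientAddGroup.eq] at h1
  choose z hz using h1
  exact QuotientAddGroup.eq.mpr ⟨z, funext hz⟩

variable (K) in
/-- The semi-localisation map at the places above `ℓ` on the multiplicative group. -/
def semilocal (ℓ : ℕ) : Additive Kˣ →+
    (∀ v : {v : HeightOneSpectrum (𝓞 K) // (ℓ : 𝓞 K) ∈ v.asIdeal},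
      Additive (v.1.adicCompletion K)ˣ) :=
  AddMonoidHom.pi fun v ↦
    MonoidHom.toAdditive (Units.map (algebraMap K (v.1.adicCompletion K) : K →* _))

/-- The map `ℛ_K → ∏_{v ∣ ℓ} ℛ_{K_v}` is onto. -/
theorem exists_localization_eq (ℓ : ℕ) [Fact ℓ.Prime]
    (b : ∀ v : {v : HeightOneSpectrum (𝓞 K) // (ℓ : 𝓞 K) ∈ v.asIdeal},
      (v.1.adicCompletion K)ˣ) :
    ∃ β : AdicUnits ℓ K, ∀ v, localization ℓ K v.1 β =
      toCompleted ℓ (Additive (v.1.adicCompletion K)ˣ) (1 ⊗ₜ Additive.ofMul (b v)) := by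
  have hℓ : ℓ ≠ 0 := (Fact.out : ℓ.Prime).ne_zero
  have : Finite {v : HeightOneSpectrum (𝓞 K) // (ℓ : 𝓞 K) ∈ v.asIdeal} :=
    (finite_places_over (K := K) hℓ).to_subtype
  obtain ⟨β, hβ⟩ := exists_adify_eq (semilocal K ℓ)
    (finite_pi_quotient ℓ fun v ↦ finite_units_quotient (by simpa using hℓ))
    (fun b ↦ by
      obtain ⟨x, hx⟩ := exists_unit_eq_mul_pow hℓ fun v ↦ (b v).toMul
      choose y hy using hx
      exact ⟨Additive.ofMul x, fun v ↦ Additive.ofMul (y v), funext fun v ↦ hy v⟩)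
    (fun v ↦ Additive.ofMul (b v))
  refine ⟨β, fun v ↦ ?_⟩
  have h1 := congrArg (completedMap ℓ (Pi.evalAddMonoidHom
    (fun v : {v : HeightOneSpectrum (𝓞 K) // (ℓ : 𝓞 K) ∈ v.asIdeal} ↦
      Additive (v.1.adicCompletion K)ˣ) v)) hβ
  rw [completedMap_toCompleted, completedMap_toCompleted, adify_comp] at h1
  exact h1

end Completion

/-! ### Extensions of completions -/

section LocalExtension

variable {K L : Type*} [Field K] [NumberField K] [Field L] [NumberField L] [Algebra K L]

theorem continuous_localExtension (w : HeightOneSpectrum (𝓞 L)) :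
    Continuous (localExtension K w) := by
  have h1 : Continuous (UniformSpace.Completion.mapRingHom
      (algebraMap (WithVal ((w.under (𝓞 K)).valuation K)) (WithVal (w.valuation L)))
      (HeightOneSpectrum.uniformContinuous_algebraMap_liesOver K L (w.under (𝓞 K)) w).continuous) :=
    UniformSpace.Completion.continuous_map
  exact (HeightOneSpectrum.adicCompletion.continuous_ofCompletion _ _).comp
    (h1.comp (HeightOneSpectrum.adicCompletion.continuous_toCompletion _ _))

variable {v : HeightOneSpectrum (𝓞 K)} {w : HeightOneSpectrum (𝓞 L)}

/-- A continuous extension of `K → L` to completions. -/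
structure IsLocalExtension (f : v.adicCompletion K →+* w.adicCompletion L) : Prop where
  continuous : Continuous f
  map_algebraMap : ∀ x : K, f (algebraMap K _ x) = algebraMap L _ (algebraMap K L x)

theorem isLocalExtension_localExtension (w : HeightOneSpectrum (𝓞 L)) :
    IsLocalExtension (localExtension K w) :=
  ⟨continuous_localExtension w, localExtension_algebraMap K w⟩

/-- `K` is dense in `K_v`. In a tower of fields the places below are only propositionally equal;
uniqueness identifies a composite of local extensions with the canonical one. -/
theorem IsLocalExtension.unique {f g : v.adicCompletion K →+* w.adicCompletion L}
    (hf : IsLocalExtension f) (hg : IsLocalExtension g) : f = g := by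
  refine DFunLike.coe_injective ((HeightOneSpectrum.denseRange_algebraMap K v).equalizer hf.continuous
    hg.continuous (funext fun x ↦ ?_))
  simp [hf.map_algebraMap, hg.map_algebraMap]

/-- The `K_v`-span of a `K`-basis of `L` is finite-dimensional over a complete field, hence closed
in `L_w`, and it contains the dense subfield `L`. -/
theorem exists_finite_span {f : v.adicCompletion K →+* w.adicCompletion L}
    (hf : IsLocalExtension f) [Algebra (v.adicCompletion K) (w.adicCompletion L)]
    (h : algebraMap (v.adicCompletion K) (w.adicCompletion L) = f) :
    ∃ S : Submodule (v.adicCompletion K) (w.adicCompletion L), S.FG ∧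
      S ≤ Submodule.span _ (Set.range (algebraMap L (w.adicCompletion L))) ∧ S = ⊤ := by
  have : FiniteDimensional K L := Module.Finite.of_restrictScalars_finite ℚ K L
  have hsmul : ∀ (a : v.adicCompletion K) (x : w.adicCompletion L), a • x = f a * x := fun a x ↦ by
    rw [Algebra.smul_def, h]
  have : ContinuousSMul (v.adicCompletion K) (w.adicCompletion L) := by
    refine ⟨?_⟩
    simp only [hsmul]
    exact (hf.continuous.comp continuous_fst).mul continuous_snd
  let b := Module.finBasis K L
  let S : Submodule (v.adicCompletion K) (w.adicCompletion L) :=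
    Submodule.span _ (Set.range fun i ↦ algebraMap L (w.adicCompletion L) (b i))
  have hfg : S.FG := Submodule.fg_span (Set.finite_range _)
  have : FiniteDimensional (v.adicCompletion K) S := Module.Finite.iff_fg.mpr hfg
  have hclosed : IsClosed (S : Set (w.adicCompletion L)) := S.closed_of_finiteDimensional
  have hmem : ∀ x : L, algebraMap L (w.adicCompletion L) x ∈ S := by
    intro x
    rw [← b.sum_repr x, map_sum]
    refine S.sum_mem fun i _ ↦ ?_
    rw [Algebra.smul_def, map_mul, ← hf.map_algebraMap, ← hsmul]
    exact S.smul_mem _ (Submodule.subset_span ⟨i, rfl⟩)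
  refine ⟨S, hfg, Submodule.span_mono ?_, ?_⟩
  · rintro _ ⟨i, rfl⟩
    exact ⟨b i, rfl⟩
  · refine SetLike.coe_injective (hclosed.closure_eq.symm.trans ?_)
    exact ((HeightOneSpectrum.denseRange_algebraMap L w).mono
      (Set.range_subset_iff.mpr hmem)).closure_eq

theorem span_range_eq_top {f : v.adicCompletion K →+* w.adicCompletion L}
    (hf : IsLocalExtension f) [Algebra (v.adicCompletion K) (w.adicCompletion L)]
    (h : algebraMap (v.adicCompletion K) (w.adicCompletion L) = f) :
    Submodule.span (v.adicCompletion K) (Set.range (algebraMap L (w.adicCompletion L))) = ⊤ := by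
  obtain ⟨S, -, hS, rfl⟩ := exists_finite_span hf h
  exact top_le_iff.mp hS

theorem finiteDimensional_completion {f : v.adicCompletion K →+* w.adicCompletion L}
    (hf : IsLocalExtension f) [Algebra (v.adicCompletion K) (w.adicCompletion L)]
    (h : algebraMap (v.adicCompletion K) (w.adicCompletion L) = f) :
    FiniteDimensional (v.adicCompletion K) (w.adicCompletion L) := by
  obtain ⟨S, hS, -, rfl⟩ := exists_finite_span hf h
  exact Module.finite_def.mpr hS

end LocalExtension

/-! ### Galois theory of a local extension -/

section LocalGalois

variable {K L k l : Type*} [Field K] [Field L] [Field k] [Field l] [Algebra K L] [Algebra K k]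
  [Algebra K l] [Algebra k l] [Algebra L l] [IsScalarTower K k l] [IsScalarTower K L l]
  [IsGalois K L]

theorem mem_of_span_eq_top (hspan : Submodule.span k (Set.range (algebraMap L l)) = ⊤)
    (E : IntermediateField k l) (hE : ∀ x : L, algebraMap L l x ∈ E) (y : l) : y ∈ E := by
  have h1 : Submodule.span k (Set.range (algebraMap L l)) ≤ Subalgebra.toSubmodule E.toSubalgebra :=
    Submodule.span_le.mpr (by rintro _ ⟨x, rfl⟩; exact hE x)
  exact h1 (hspan ▸ Submodule.mem_top)

variable (K) in
-- A separable polynomial over `K` with splitting field `L` has splitting field `l` over `k`, since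
-- `L` spans `l`.
theorem isGalois_of_span_eq_top [FiniteDimensional K L]
    (hspan : Submodule.span k (Set.range (algebraMap L l)) = ⊤) :
    IsGalois k l := by
  obtain ⟨p, hp, hpL⟩ := IsGalois.is_separable_splitting_field K L
  have hsp : (p.map (algebraMap K k)).IsSplittingField k l := by
    refine ⟨?_, ?_⟩
    · rw [Polynomial.map_map, ← IsScalarTower.algebraMap_eq, IsScalarTower.algebraMap_eq K L l,
        ← Polynomial.map_map]
      exact hpL.splits'.map _
    · rw [← top_le_iff]
      intro y _
      have h1 : ∀ x : L, algebraMap L l x ∈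
          Algebra.adjoin k ((p.map (algebraMap K k)).rootSet l) := by
        intro x
        have hx : x ∈ Algebra.adjoin K (p.rootSet L) := by rw [hpL.adjoin_rootSet']; trivial
        induction hx using Algebra.adjoin_induction with
        | mem x hx =>
          refine Algebra.subset_adjoin ?_
          rw [Polynomial.mem_rootSet] at hx ⊢
          refine ⟨(Polynomial.map_ne_zero_iff (algebraMap K k).injective).mpr hx.1, ?_⟩
          rw [Polynomial.aeval_map_algebraMap, Polynomial.aeval_algebraMap_apply, hx.2, map_zero]
        | algebraMap a =>
          rw [← IsScalarTower.algebraMap_apply, IsScalarTower.algebraMap_apply K k l]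
          exact Subalgebra.algebraMap_mem _ _
        | add x y _ _ hx hy => rw [map_add]; exact add_mem hx hy
        | mul x y _ _ hx hy => rw [map_mul]; exact mul_mem hx hy
      have h2 : Submodule.span k (Set.range (algebraMap L l)) ≤ Subalgebra.toSubmodule
          (Algebra.adjoin k ((p.map (algebraMap K k)).rootSet l)) :=
        Submodule.span_le.mpr (by rintro _ ⟨x, rfl⟩; exact h1 x)
      exact h2 (hspan ▸ Submodule.mem_top)
  exact IsGalois.of_separable_splitting_field (p := p.map (algebraMap K k)) hp.map

variable (K L k l) in
/-- Restriction of automorphisms from `l/k` to `L/K`. -/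
def restrictGal : Gal(l/k) →* Gal(L/K) :=
  (AlgEquiv.restrictNormalHom L).comp
    { toFun := fun σ ↦ AlgEquiv.restrictScalars K σ
      map_one' := rfl
      map_mul' := fun _ _ ↦ rfl }

theorem algebraMap_restrictGal (σ : Gal(l/k)) (x : L) :
    algebraMap L l (restrictGal K L k l σ x) = σ (algebraMap L l x) :=
  AlgEquiv.restrictNormal_commutes (AlgEquiv.restrictScalars K σ) L x

theorem restrictGal_injective (hspan : Submodule.span k (Set.range (algebraMap L l)) = ⊤) :
    Function.Injective (restrictGal K L k l) := by
  rw [injective_iff_map_eq_one]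
  intro σ hσ
  refine AlgEquiv.ext fun y ↦ ?_
  have h1 := mem_of_span_eq_top hspan (IntermediateField.fixedField (Subgroup.zpowers σ))
    (fun x ↦ by
      rintro ⟨τ, hτ⟩
      obtain ⟨n, rfl⟩ := Subgroup.mem_zpowers_iff.mp hτ
      change (σ ^ n) (algebraMap L l x) = _
      rw [← algebraMap_restrictGal (K := K), map_zpow, hσ, one_zpow, AlgEquiv.one_apply]) y
  exact h1 ⟨σ, Subgroup.mem_zpowers σ⟩

/-- An automorphism of `L` fixing `L ∩ E` extends to an automorphism of `l` fixing `E`. -/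
theorem exists_restrictGal_eq [FiniteDimensional K L] [FiniteDimensional k l] [IsGalois k l]
    (E : IntermediateField k l)
    (τ : Gal(L/K)) (hτ : ∀ x : L, algebraMap L l x ∈ E → τ x = x) :
    ∃ σ : Gal(l/k), (∀ y ∈ E, σ y = y) ∧ restrictGal K L k l σ = τ := by
  -- An element of `L` fixed by `H` lies in `E`, hence is fixed by `τ`. The Galois correspondence
  -- for `L/K` then puts `τ` in `H` itself.
  let H : Subgroup Gal(L/K) := E.fixingSubgroup.map (restrictGal K L k l)
  have h1 : τ ∈ (IntermediateField.fixedField H).fixingSubgroup := by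
    rw [IntermediateField.mem_fixingSubgroup_iff]
    intro x hx
    refine hτ x ?_
    rw [← IsGalois.fixedField_fixingSubgroup E]
    rintro ⟨σ, hσ⟩
    change σ (algebraMap L l x) = _
    rw [← algebraMap_restrictGal (K := K)]
    exact congrArg _ (hx ⟨_, σ, hσ, rfl⟩)
  rw [IntermediateField.fixingSubgroup_fixedField] at h1
  obtain ⟨σ, hσ, rfl⟩ := h1
  exact ⟨σ, (IntermediateField.mem_fixingSubgroup_iff _ _).mp hσ, rfl⟩

theorem isPGroup_local {ℓ : ℕ} (hG : IsPGroup ℓ Gal(L/K))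
    (hspan : Submodule.span k (Set.range (algebraMap L l)) = ⊤) : IsPGroup ℓ Gal(l/k) :=
  hG.of_injective _ (restrictGal_injective hspan)

end LocalGalois

/-! ### The cyclotomic `ℤ_ℓ`-extension of a field and its independence of embeddings -/

section Cyclotomic

variable (ℓ : ℕ) (k : Type*) [Field k]

theorem cyclotomicZlExtension_le : cyclotomicZlExtension ℓ k ≤ cyclotomicTower ℓ k :=
  sSup_le fun _ hE ↦ hE.1

instance normal_cyclotomicZlExtension : Normal k (cyclotomicZlExtension ℓ k) := by
  rw [cyclotomicZlExtension, sSup_eq_iSup']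
  have : ∀ E : {E : IntermediateField k (AlgebraicClosure k) | E ≤ cyclotomicTower ℓ k ∧
      FiniteDimensional k E ∧ IsGalois k E ∧ ∃ n : ℕ, Module.finrank k E = ℓ ^ n},
      Normal k E.1 := fun E ↦ E.2.2.2.1.to_normal
  exact IntermediateField.normal_iSup k _ _

variable {ℓ k}

/-- `φ x` and `ψ x` are conjugate over `k` and the cyclotomic `ℤ_ℓ`-extension is normal. Membership
can therefore be tested on a single embedding. -/
theorem mem_cyclotomicZlExtension_iff {l : Type*} [Field l] [Algebra k l] [Algebra.IsAlgebraic k l]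
    (φ ψ : l →ₐ[k] AlgebraicClosure k) (x : l) :
    φ x ∈ cyclotomicZlExtension ℓ k ↔ ψ x ∈ cyclotomicZlExtension ℓ k := by
  have key : ∀ φ ψ : l →ₐ[k] AlgebraicClosure k, φ x ∈ cyclotomicZlExtension ℓ k →
      ψ x ∈ cyclotomicZlExtension ℓ k := by
    intro φ ψ h
    have hx : IsIntegral k x := Algebra.IsIntegral.isIntegral x
    have h1 := (normal_cyclotomicZlExtension ℓ k).splits ⟨φ x, h⟩
    have h2 : minpoly k (⟨φ x, h⟩ : cyclotomicZlExtension ℓ k) = minpoly k x := by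
      rw [← minpoly.algHom_eq (cyclotomicZlExtension ℓ k).val Subtype.val_injective]
      exact minpoly.algHom_eq φ φ.injective x
    rw [h2] at h1
    refine (IntermediateField.splits_iff_mem (IsAlgClosed.splits _)).mp h1 (ψ x) ?_
    rw [Polynomial.mem_rootSet]
    exact ⟨minpoly.ne_zero hx, by rw [Polynomial.aeval_algHom_apply, minpoly.aeval, map_zero]⟩
  exact ⟨key φ ψ, key ψ φ⟩

/-- Roots of unity in an extension of degree a power of `ℓ` lie in the cyclotomic
`ℤ_ℓ`-extension. -/
theorem root_mem_cyclotomicZlExtension [CharZero k] {l : Type*} [Field l] [Algebra k l]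
    [FiniteDimensional k l] [Fact ℓ.Prime]
    {n : ℕ} (hn : Module.finrank k l = ℓ ^ n) (φ : l →ₐ[k] AlgebraicClosure k) {ζ : l} {m : ℕ}
    (hζ : ζ ^ ℓ ^ m = 1) : φ ζ ∈ cyclotomicZlExtension ℓ k := by
  have hℓ : ℓ.Prime := Fact.out
  have hφζ : φ ζ ^ ℓ ^ m = 1 := by rw [← map_pow, hζ, map_one]
  let E : IntermediateField k (AlgebraicClosure k) := IntermediateField.adjoin k {φ ζ}
  have hint : IsIntegral k (φ ζ) := Algebra.IsIntegral.isIntegral _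
  have hmem : φ ζ ∈ E := IntermediateField.mem_adjoin_simple_self k _
  suffices h : E ∈ {E | E ≤ cyclotomicTower ℓ k ∧ FiniteDimensional k E ∧ IsGalois k E ∧
      ∃ n : ℕ, Module.finrank k E = ℓ ^ n} from le_sSup h hmem
  refine ⟨?_, IntermediateField.adjoin.finiteDimensional hint, ?_, ?_⟩
  · rw [IntermediateField.adjoin_simple_le_iff]
    exact IntermediateField.subset_adjoin k _ ⟨m, hφζ⟩
  · have hpos : 0 < orderOf (φ ζ) := (isOfFinOrder_iff_pow_eq_one.mpr
      ⟨ℓ ^ m, pow_pos hℓ.pos m, hφζ⟩).orderOf_pos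
    have : NeZero (orderOf (φ ζ)) := ⟨hpos.ne'⟩
    have := (IsPrimitiveRoot.orderOf (φ ζ)).intermediateField_adjoin_isCyclotomicExtension k
    exact IsCyclotomicExtension.isGalois {orderOf (φ ζ)} k E
  -- The degree of `k(ζ)` divides `[l : k] = ℓ ^ n`. This places `ζ` in the `ℤ_ℓ`-part of the tower
  -- and not merely in `k(μ_{ℓ^∞})`.
  · have h1 : Module.finrank k E = (minpoly k ζ).natDegree := by
      rw [IntermediateField.adjoin.finrank hint, minpoly.algHom_eq φ φ.injective]
    have h2 : (minpoly k ζ).natDegree ∣ ℓ ^ n := hn ▸ minpoly.degree_dvd (Algebra.IsIntegral.isIntegral ζ)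
    rw [h1]
    obtain ⟨j, -, hj⟩ := (Nat.dvd_prime_pow hℓ).mp h2
    exact ⟨j, hj⟩

end Cyclotomic

/-! ### The largest locally cyclotomic subextension -/

section LocallyCyclotomic

theorem under_under {K F L : Type*} [Field K] [NumberField K] [Field F] [NumberField F] [Field L]
    [NumberField L] [Algebra K F] [Algebra F L] [Algebra K L] [IsScalarTower K F L]
    (w : HeightOneSpectrum (𝓞 L)) : (w.under (𝓞 F)).under (𝓞 K) = w.under (𝓞 K) := by
  refine HeightOneSpectrum.ext (Ideal.ext fun x ↦ ?_)
  simp only [HeightOneSpectrum.under, Ideal.under_def, Ideal.mem_comap]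
  rw [← IsScalarTower.algebraMap_apply]

theorem exists_under_eq {K L : Type*} [Field K] [NumberField K] [Field L] [NumberField L]
    [Algebra K L] (v : HeightOneSpectrum (𝓞 K)) :
    ∃ w : HeightOneSpectrum (𝓞 L), w.under (𝓞 K) = v := by
  have : v.asIdeal.IsMaximal := v.isMaximal
  obtain ⟨Q, hQ, hQv⟩ := Ideal.exists_maximal_ideal_liesOver_of_isIntegral (S := 𝓞 L) v.asIdeal
  exact ⟨⟨Q, hQ.isPrime, Ideal.ne_bot_of_liesOver_of_ne_bot v.ne_bot Q⟩,
    HeightOneSpectrum.ext hQv.over.symm⟩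

variable {K L : Type*} [Field K] [NumberField K] [Field L] [NumberField L] [Algebra K L]

theorem isScalarTower_local {v : HeightOneSpectrum (𝓞 K)} {w : HeightOneSpectrum (𝓞 L)}
    {f : v.adicCompletion K →+* w.adicCompletion L} (hf : IsLocalExtension f)
    [Algebra (v.adicCompletion K) (w.adicCompletion L)]
    (h : algebraMap (v.adicCompletion K) (w.adicCompletion L) = f) :
    IsScalarTower K (v.adicCompletion K) (w.adicCompletion L) :=
  .of_algebraMap_eq fun x ↦ by
    rw [h, hf.map_algebraMap, ← IsScalarTower.algebraMap_apply]

theorem exists_local_embedding {v : HeightOneSpectrum (𝓞 K)} {w : HeightOneSpectrum (𝓞 L)}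
    {f : v.adicCompletion K →+* w.adicCompletion L} (hf : IsLocalExtension f) :
    ∃ φ : w.adicCompletion L →+* AlgebraicClosure (v.adicCompletion K),
      φ.comp f = algebraMap _ _ := by
  let _ := f.toAlgebra
  have := finiteDimensional_completion hf rfl
  let φ : w.adicCompletion L →ₐ[v.adicCompletion K] AlgebraicClosure (v.adicCompletion K) :=
    IsAlgClosed.lift
  exact ⟨φ, φ.comp_algebraMap⟩

theorem local_mem_cyclotomicZlExtension_iff {ℓ : ℕ} {v : HeightOneSpectrum (𝓞 K)}
    {w : HeightOneSpectrum (𝓞 L)}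
    {f : v.adicCompletion K →+* w.adicCompletion L} (hf : IsLocalExtension f)
    {φ ψ : w.adicCompletion L →+* AlgebraicClosure (v.adicCompletion K)}
    (hφ : φ.comp f = algebraMap _ _) (hψ : ψ.comp f = algebraMap _ _) (x : w.adicCompletion L) :
    φ x ∈ cyclotomicZlExtension ℓ (v.adicCompletion K) ↔
      ψ x ∈ cyclotomicZlExtension ℓ (v.adicCompletion K) := by
  let _ := f.toAlgebra
  have := finiteDimensional_completion hf rfl
  exact mem_cyclotomicZlExtension_iff
    (⟨φ, fun x ↦ RingHom.congr_fun hφ x⟩ : w.adicCompletion L →ₐ[v.adicCompletion K] _)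
    (⟨ψ, fun x ↦ RingHom.congr_fun hψ x⟩ : w.adicCompletion L →ₐ[v.adicCompletion K] _) x

variable (K) in
/-- The elements of `L` that lie in the cyclotomic `ℤ_ℓ`-extension of `K_v` inside `L_w`. -/
def localCyclotomic (ℓ : ℕ) (w : HeightOneSpectrum (𝓞 L)) : IntermediateField K L where
  carrier := {x | ∀ φ : w.adicCompletion L →+* AlgebraicClosure ((w.under (𝓞 K)).adicCompletion K),
    φ.comp (localExtension K w) = algebraMap _ _ →
      φ (algebraMap L _ x) ∈ cyclotomicZlExtension ℓ ((w.under (𝓞 K)).adicCompletion K)}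
  mul_mem' hx hy φ hφ := by rw [map_mul, map_mul]; exact mul_mem (hx φ hφ) (hy φ hφ)
  add_mem' hx hy φ hφ := by rw [map_add, map_add]; exact add_mem (hx φ hφ) (hy φ hφ)
  algebraMap_mem' x φ hφ := by
    rw [← localExtension_algebraMap, ← RingHom.comp_apply, hφ]
    exact IntermediateField.algebraMap_mem _ _
  inv_mem' x hx φ hφ := by rw [map_inv₀, map_inv₀]; exact inv_mem (hx φ hφ)

theorem mem_localCyclotomic_iff {ℓ : ℕ} {v : HeightOneSpectrum (𝓞 K)} {w : HeightOneSpectrum (𝓞 L)}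
    (hv : v = w.under (𝓞 K)) {f : v.adicCompletion K →+* w.adicCompletion L}
    (hf : IsLocalExtension f) {φ : w.adicCompletion L →+* AlgebraicClosure (v.adicCompletion K)}
    (hφ : φ.comp f = algebraMap _ _) (x : L) :
    x ∈ localCyclotomic K ℓ w ↔
      φ (algebraMap L _ x) ∈ cyclotomicZlExtension ℓ (v.adicCompletion K) := by
  subst hv
  obtain rfl := hf.unique (isLocalExtension_localExtension w)
  refine ⟨fun h ↦ h φ hφ, fun h ψ hψ ↦ ?_⟩
  exact (local_mem_cyclotomicZlExtension_iff hf hφ hψ _).mp h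

section Tower

variable {F : Type*} [Field F] [NumberField F] [Algebra K F] [Algebra F L] [IsScalarTower K F L]

theorem IsLocalExtension.comp {v : HeightOneSpectrum (𝓞 K)} {u : HeightOneSpectrum (𝓞 F)}
    {w : HeightOneSpectrum (𝓞 L)} {g : u.adicCompletion F →+* w.adicCompletion L}
    {f : v.adicCompletion K →+* u.adicCompletion F} (hg : IsLocalExtension g)
    (hf : IsLocalExtension f) : IsLocalExtension (g.comp f) :=
  ⟨hg.continuous.comp hf.continuous, fun x ↦ by
    rw [RingHom.comp_apply, hf.map_algebraMap, hg.map_algebraMap,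
      ← IsScalarTower.algebraMap_apply K F L]⟩

theorem algebraMap_mem_localCyclotomic {ℓ : ℕ} (hF : IsLocallyCyclotomic ℓ K F)
    (w : HeightOneSpectrum (𝓞 L)) (x : F) : algebraMap F L x ∈ localCyclotomic K ℓ w := by
  obtain ⟨φ', h1, h2⟩ := hF.finite (w.under (𝓞 F))
  have hf := isLocalExtension_localExtension (K := K) (w.under (𝓞 F))
  have hg := isLocalExtension_localExtension (K := F) w
  obtain ⟨φ, hφ⟩ := exists_local_embedding (hg.comp hf)
  rw [mem_localCyclotomic_iff (under_under w) (hg.comp hf) hφ, ← localExtension_algebraMap]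
  exact (local_mem_cyclotomicZlExtension_iff hf (φ := φ.comp (localExtension F w))
    (by rw [RingHom.comp_assoc, hφ]) h1 _).mpr (h2 _)

/-- Every place of `F` lies under a place of `L`, and the completion of `F` is spanned by `F` over
`K_v`, so the condition on elements of `F` propagates to the whole completion. -/
theorem isLocallyCyclotomic_of_forall {ℓ : ℕ} (hinf : IsUnramifiedAtInfinitePlaces K L)
    (hF : ∀ (w : HeightOneSpectrum (𝓞 L)) (x : F), algebraMap F L x ∈ localCyclotomic K ℓ w) :
    IsLocallyCyclotomic ℓ K F := by
  have : FiniteDimensional F L := Module.Finite.of_restrictScalars_finite ℚ F L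
  refine ⟨IsUnramifiedAtInfinitePlaces.bot K F L, fun u ↦ ?_⟩
  obtain ⟨w, rfl⟩ := exists_under_eq (L := L) u
  have hf := isLocalExtension_localExtension (K := K) (w.under (𝓞 F))
  have hg := isLocalExtension_localExtension (K := F) w
  obtain ⟨φ, hφ⟩ := exists_local_embedding (hg.comp hf)
  refine ⟨φ.comp (localExtension F w), by rw [RingHom.comp_assoc, hφ], fun y ↦ ?_⟩
  let _ := (localExtension K (w.under (𝓞 F))).toAlgebra
  have hspan := span_range_eq_top hf rfl
  let ψ : (w.under (𝓞 F)).adicCompletion F →ₐ[((w.under (𝓞 F)).under (𝓞 K)).adicCompletion K]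
      AlgebraicClosure (((w.under (𝓞 F)).under (𝓞 K)).adicCompletion K) :=
    ⟨φ.comp (localExtension F w), fun x ↦ RingHom.congr_fun hφ x⟩
  refine mem_of_span_eq_top hspan ((cyclotomicZlExtension ℓ _).comap ψ) (fun x ↦ ?_) y
  change φ (localExtension F w (algebraMap F _ x)) ∈ cyclotomicZlExtension ℓ _
  rw [localExtension_algebraMap, ← mem_localCyclotomic_iff (under_under w) (hg.comp hf) hφ]
  exact hF w x

end Tower

variable [IsGalois K L] {ℓ : ℕ} [Fact ℓ.Prime]

theorem isUnramifiedAtInfinitePlaces_of_isPGroup (hℓ : ℓ ≠ 2) (hG : IsPGroup ℓ Gal(L/K)) :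
    IsUnramifiedAtInfinitePlaces K L := by
  have : FiniteDimensional K L := Module.Finite.of_restrictScalars_finite ℚ K L
  obtain ⟨n, hn⟩ := IsPGroup.iff_card.mp hG
  refine IsUnramifiedAtInfinitePlaces_of_odd_card_aut ?_
  rw [hn]
  exact ((Fact.out : ℓ.Prime).odd_of_ne_two hℓ).pow

theorem isLocallyCyclotomic_iff (hℓ : ℓ ≠ 2) (hG : IsPGroup ℓ Gal(L/K))
    (F : IntermediateField K L) :
    IsLocallyCyclotomic ℓ K F ↔ ∀ w : HeightOneSpectrum (𝓞 L), F ≤ localCyclotomic K ℓ w :=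
  ⟨fun h w x hx ↦ algebraMap_mem_localCyclotomic h w ⟨x, hx⟩, fun h ↦
    isLocallyCyclotomic_of_forall (isUnramifiedAtInfinitePlaces_of_isPGroup hℓ hG)
      fun w x ↦ h w x.2⟩

/-- Being locally cyclotomic means lying in each of the local parts, so their intersection is itself
locally cyclotomic and is the largest such field. -/
theorem maxLocallyCyclotomic_eq (hℓ : ℓ ≠ 2) (hG : IsPGroup ℓ Gal(L/K)) :
    maxLocallyCyclotomic ℓ K L = ⨅ w : HeightOneSpectrum (𝓞 L), localCyclotomic K ℓ w := by
  refine le_antisymm (sSup_le fun F hF ↦ le_iInf ((isLocallyCyclotomic_iff hℓ hG F).mp hF))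
    (le_sSup ((isLocallyCyclotomic_iff hℓ hG _).mpr fun w ↦ iInf_le _ w))

theorem mem_maxLocallyCyclotomic_iff (hℓ : ℓ ≠ 2) (hG : IsPGroup ℓ Gal(L/K)) (x : L) :
    x ∈ maxLocallyCyclotomic ℓ K L ↔
      ∀ w : HeightOneSpectrum (𝓞 L), x ∈ localCyclotomic K ℓ w := by
  rw [maxLocallyCyclotomic_eq hℓ hG, ← SetLike.mem_coe, IntermediateField.coe_iInf, Set.mem_iInter]
  rfl

theorem isLocallyCyclotomic_max (hℓ : ℓ ≠ 2) (hG : IsPGroup ℓ Gal(L/K)) :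
    IsLocallyCyclotomic ℓ K (maxLocallyCyclotomic ℓ K L) :=
  (isLocallyCyclotomic_iff hℓ hG _).mpr fun w _ hx ↦
    (mem_maxLocallyCyclotomic_iff hℓ hG _).mp hx w

theorem isGreatest_maxLocallyCyclotomic (hℓ : ℓ ≠ 2) (hG : IsPGroup ℓ Gal(L/K)) :
    IsGreatest {F : IntermediateField K L | IsLocallyCyclotomic ℓ K F}
      (maxLocallyCyclotomic ℓ K L) :=
  ⟨isLocallyCyclotomic_max hℓ hG, fun _ hF ↦ le_sSup hF⟩

theorem isGalois_maxLocallyCyclotomic (hℓ : ℓ ≠ 2) (hG : IsPGroup ℓ Gal(L/K)) :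
    IsGalois K (maxLocallyCyclotomic ℓ K L) := by
  have h : Normal K (maxLocallyCyclotomic ℓ K L) := by
    rw [IntermediateField.normal_iff_forall_map_le']
    rintro σ _ ⟨x, hx, rfl⟩
    refine (mem_maxLocallyCyclotomic_iff hℓ hG _).mpr fun w ↦ ?_
    -- The inclusion twisted by `σ` is another `K`-embedding into `L`. Local cyclotomicity is
    -- intrinsic to the field, so the image satisfies the same local conditions.
    let j : maxLocallyCyclotomic ℓ K L →ₐ[K] L :=
      (σ : L →ₐ[K] L).comp (maxLocallyCyclotomic ℓ K L).val
    exact @algebraMap_mem_localCyclotomic K L _ _ _ _ _ (maxLocallyCyclotomic ℓ K L) _ _ _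
      j.toRingHom.toAlgebra (@IsScalarTower.of_algebraMap_eq K _ L _ _ _ _ j.toRingHom.toAlgebra _
        fun x ↦ (j.commutes x).symm) ℓ (isLocallyCyclotomic_max hℓ hG) w ⟨x, hx⟩
  exact ⟨⟩

theorem local_finrank_eq_pow {v : HeightOneSpectrum (𝓞 K)} {w : HeightOneSpectrum (𝓞 L)}
    {f : v.adicCompletion K →+* w.adicCompletion L} (hf : IsLocalExtension f)
    [Algebra (v.adicCompletion K) (w.adicCompletion L)]
    (h : algebraMap (v.adicCompletion K) (w.adicCompletion L) = f) (hG : IsPGroup ℓ Gal(L/K)) :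
    ∃ n, Module.finrank (v.adicCompletion K) (w.adicCompletion L) = ℓ ^ n := by
  have : FiniteDimensional K L := Module.Finite.of_restrictScalars_finite ℚ K L
  have := isScalarTower_local hf h
  have hspan := span_range_eq_top hf h
  have := finiteDimensional_completion hf h
  have := isGalois_of_span_eq_top K hspan
  have hp : IsPGroup ℓ Gal(w.adicCompletion L/v.adicCompletion K) := isPGroup_local hG hspan
  obtain ⟨n, hn⟩ := IsPGroup.iff_card.mp hp
  exact ⟨n, by rw [← IsGalois.card_aut_eq_finrank, hn]⟩

theorem local_root_mem {v : HeightOneSpectrum (𝓞 K)} {w : HeightOneSpectrum (𝓞 L)}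
    {f : v.adicCompletion K →+* w.adicCompletion L} (hf : IsLocalExtension f)
    (hG : IsPGroup ℓ Gal(L/K))
    {φ : w.adicCompletion L →+* AlgebraicClosure (v.adicCompletion K)}
    (hφ : φ.comp f = algebraMap _ _) {ζ : w.adicCompletion L} {m : ℕ} (hζ : ζ ^ ℓ ^ m = 1) :
    φ ζ ∈ cyclotomicZlExtension ℓ (v.adicCompletion K) := by
  let _ := f.toAlgebra
  have := finiteDimensional_completion hf rfl
  obtain ⟨n, hn⟩ := local_finrank_eq_pow hf rfl hG
  exact root_mem_cyclotomicZlExtension hn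
    (⟨φ, fun x ↦ RingHom.congr_fun hφ x⟩ : w.adicCompletion L →ₐ[v.adicCompletion K] _) hζ

theorem root_mem_maxLocallyCyclotomic (hℓ : ℓ ≠ 2) (hG : IsPGroup ℓ Gal(L/K)) {ζ : L} {m : ℕ}
    (hζ : ζ ^ ℓ ^ m = 1) : ζ ∈ maxLocallyCyclotomic ℓ K L := by
  rw [mem_maxLocallyCyclotomic_iff hℓ hG]
  intro w φ hφ
  exact local_root_mem (m := m) (isLocalExtension_localExtension w) hG hφ
    (by rw [← map_pow, hζ, map_one])

theorem map_rootsOfUnityPrimary_eq (hℓ : ℓ ≠ 2) (hG : IsPGroup ℓ Gal(L/K)) :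
    (rootsOfUnityPrimary ℓ (maxLocallyCyclotomic ℓ K L)).map
      (Units.map (algebraMap (maxLocallyCyclotomic ℓ K L) L :
        maxLocallyCyclotomic ℓ K L →* L)) = rootsOfUnityPrimary ℓ L := by
  refine le_antisymm ?_ ?_
  · rintro _ ⟨ζ, ⟨n, hn⟩, rfl⟩
    exact ⟨n, by rw [← map_pow, hn, map_one]⟩
  · rintro ζ ⟨n, hn⟩
    have hζ : (ζ : L) ^ ℓ ^ n = 1 := congrArg Units.val hn
    have hmem := root_mem_maxLocallyCyclotomic (K := K) hℓ hG hζ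
    have h0 : (⟨ζ, hmem⟩ : maxLocallyCyclotomic ℓ K L) ≠ 0 := fun h ↦
      ζ.ne_zero (congrArg Subtype.val h)
    exact ⟨Units.mk0 _ h0, ⟨n, Units.ext (Subtype.ext hζ)⟩, Units.ext rfl⟩

end LocallyCyclotomic

/-! ### Kummer theory over the cyclotomic tower -/

section Kummer

/-- The exponent is the norm element `1 + a + ⋯ + a ^ (j - 1)` of a cyclic group acting on roots of
unity through `a`. -/
theorem iterate_kummer {E : Type*} [Field E] (σ : E →+* E) {x η : E} {a : ℕ}
    (hx : σ x = η * x) (hη : σ η = η ^ a) (j : ℕ) :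
    σ^[j] x = η ^ (∑ i ∈ Finset.range j, a ^ i) * x := by
  induction j with
  | zero => simp
  | succ j ih =>
    rw [Function.iterate_succ_apply', ih, map_mul, map_pow, hη, hx, ← pow_mul, ← mul_assoc,
      ← pow_succ, Finset.sum_range_succ', pow_zero, Finset.mul_sum]
    simp only [pow_succ, mul_comm a]

/-- The vanishing of `H^1(Gal(k(ξ)/k), μ_{ℓ^N})` for `ℓ` odd and `μ_ℓ ⊆ k`, in terms of Kummer
radicals. -/
theorem exists_eq_mul_root {k E : Type*} [Field k] [Field E] [Algebra k E] [FiniteDimensional k E]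
    [IsGalois k E] {ℓ : ℕ} [Fact ℓ.Prime] (hℓ : ℓ ≠ 2) {N : ℕ} {ξ : E}
    (hξ : IsPrimitiveRoot ξ (ℓ ^ (N + 1))) (hgen : ∀ σ : Gal(E/k), σ ξ = ξ → σ = 1)
    (hk : ∀ σ : Gal(E/k), σ (ξ ^ ℓ ^ N) = ξ ^ ℓ ^ N) {x : E} (hx0 : x ≠ 0)
    (hx : ∀ σ : Gal(E/k), (σ x / x) ^ ℓ ^ (N + 1) = 1) :
    ∃ (b : k) (ζ : E), ζ ^ ℓ ^ (N + 1) = 1 ∧ x = algebraMap k E b * ζ := by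
  have hp : ℓ.Prime := Fact.out
  have hodd : Odd ℓ := hp.odd_of_ne_two hℓ
  have : NeZero (ℓ ^ (N + 1)) := ⟨pow_ne_zero _ hp.ne_zero⟩
  have hinj : Function.Injective (hξ.autToPow k) := by
    rw [injective_iff_map_eq_one]
    intro σ hσ
    refine hgen σ ?_
    have h1 := IsPrimitiveRoot.autToPow_spec k hξ σ
    rw [hσ, Units.val_one, ZMod.val_one_eq_one_mod, Nat.mod_eq_of_lt
      (Nat.one_lt_pow N.succ_ne_zero hp.one_lt), pow_one] at h1
    exact h1.symm
  -- Oddness of `ℓ` makes the Galois group cyclic, so the cohomology can be computed with one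
  -- generator.
  have := ZMod.isCyclic_units_of_prime_pow ℓ hp hℓ (N + 1)
  have hcyc : IsCyclic Gal(E/k) := isCyclic_of_injective _ hinj
  obtain ⟨σ, hσ⟩ := hcyc.exists_generator
  obtain ⟨a, ha1, ha⟩ : ∃ a : ℕ, 1 < a ∧ σ ξ = ξ ^ a := by
    -- Adding `ℓ ^ (N + 1)` to the exponent keeps `a - 1` nonzero, so that its valuation is
    -- meaningful even for `σ = 1`.
    refine ⟨((hξ.autToPow k σ : (ZMod (ℓ ^ (N + 1)))ˣ) : ZMod (ℓ ^ (N + 1))).val + ℓ ^ (N + 1), ?_, ?_⟩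
    · exact (Nat.one_lt_pow N.succ_ne_zero hp.one_lt).trans_le (Nat.le_add_left _ _)
    · rw [pow_add, IsPrimitiveRoot.autToPow_spec k hξ, hξ.pow_eq_one, mul_one]
  have hroot : ∀ η : E, η ^ ℓ ^ (N + 1) = 1 → σ η = η ^ a := by
    intro η hη
    obtain ⟨t, -, rfl⟩ := hξ.eq_pow_of_pow_eq_one hη
    rw [map_pow, ha, ← pow_mul, ← pow_mul, mul_comm]
  have hξ0 : ξ ≠ 0 := hξ.ne_zero (pow_ne_zero _ hp.ne_zero)
  have hfix : ∀ y : E, σ y = y → ∃ b, algebraMap k E b = y := by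
    intro y hy
    refine (IsGalois.mem_range_algebraMap_iff_fixed y).mpr fun τ ↦ ?_
    have h1 : Subgroup.zpowers σ ≤ MulAction.stabilizer Gal(E/k) y :=
      Subgroup.zpowers_le.mpr hy
    exact h1 (hσ τ)
  have hdvd : ℓ ∣ a - 1 := by
    have h1 := hk σ
    have h2 : IsPrimitiveRoot (ξ ^ ℓ ^ N) ℓ :=
      hξ.pow (pow_pos hp.pos _) (pow_succ ℓ N)
    rw [map_pow, ha, ← pow_mul, mul_comm, pow_mul] at h1
    refine h2.dvd_of_pow_eq_one _ ?_
    refine mul_right_cancel₀ (pow_ne_zero (ℓ ^ N) hξ0) ?_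
    rw [← pow_succ, Nat.sub_add_cancel ha1.le, h1, one_mul]
  have hna : ¬ ℓ ∣ a := fun h ↦ hp.one_lt.ne' (Nat.dvd_one.mp (by
    have := (Nat.dvd_sub_iff_right ha1.le h).mp hdvd
    exact this))
  obtain ⟨r, u, hu, hru⟩ := Nat.exists_eq_pow_mul_and_not_dvd (Nat.sub_ne_zero_of_lt ha1) ℓ hp.ne_one
  have hval : padicValNat ℓ (a - 1) = r := by
    rw [hru, padicValNat.mul (pow_ne_zero _ hp.ne_zero) (by rintro rfl; simp at hu),
      padicValNat.prime_pow, padicValNat.eq_zero_of_not_dvd hu, add_zero]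
  have hLTE : ∀ j, padicValNat ℓ (a ^ ℓ ^ j - 1) = r + j := by
    intro j
    have h1 := padicValNat.pow_sub_pow hodd (y := 1) ha1 hdvd hna
      (n := ℓ ^ j) (pow_ne_zero _ hp.ne_zero)
    rw [one_pow, hval, padicValNat.prime_pow] at h1
    exact h1
  have hiter : ∀ j, (σ ^ j) ξ = ξ ^ a ^ j := by
    intro j
    induction j with
    | zero => simp
    | succ j ih =>
      rw [pow_succ', AlgEquiv.mul_apply, ih, map_pow, ha, ← pow_mul, pow_succ']
  have hiter1 : ∀ j, N + 1 ≤ padicValNat ℓ (a ^ j - 1) → σ ^ j = 1 := by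
    intro j hj
    refine hgen _ ?_
    have h1 : ℓ ^ (N + 1) ∣ a ^ j - 1 := (pow_dvd_pow ℓ hj).trans pow_padicValNat_dvd
    have h2 := (hξ.pow_eq_one_iff_dvd _).mpr h1
    rw [hiter, ← Nat.sub_add_cancel (Nat.one_le_pow j a (by omega)), pow_succ, h2, one_mul]
  by_cases hrN : N + 1 ≤ r
  · have h1 : σ = 1 := by simpa using hiter1 1 (by simpa [hval] using hrN)
    obtain ⟨b, hb⟩ := hfix x (by rw [h1]; rfl)
    exact ⟨b, 1, one_pow _, by rw [hb, mul_one]⟩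
  -- With `m = N + 1 - r`, lifting the exponent shows that `σ ^ ℓ ^ m = 1`.
  obtain ⟨m, hm⟩ := Nat.exists_eq_add_of_le (not_le.mp hrN).le
  have hσm : σ ^ ℓ ^ m = 1 := hiter1 _ (by rw [hLTE, hm])
  set η := σ x / x with hη
  have hσx : σ x = η * x := by rw [hη, div_mul_cancel₀ _ hx0]
  have hηs : η ^ (∑ i ∈ Finset.range (ℓ ^ m), a ^ i) = 1 := by
    have h1 := iterate_kummer (σ : E →+* E) hσx (hroot η (hx σ)) (ℓ ^ m)
    have h2 : (σ : E →+* E)^[ℓ ^ m] x = (σ ^ ℓ ^ m) x := by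
      generalize ℓ ^ m = j
      induction j with
      | zero => rfl
      | succ j ih => rw [Function.iterate_succ_apply', ih, pow_succ']; rfl
    rw [h2, hσm, AlgEquiv.one_apply] at h1
    exact (mul_eq_right₀ hx0).mp h1.symm
  -- The norm exponent `(a ^ ℓ ^ m - 1) / (a - 1)` has valuation exactly `m`, so a root of unity of
  -- norm `1` is killed by `ℓ ^ m`.
  have hs : ∃ s, ¬ ℓ ∣ s ∧ ∑ i ∈ Finset.range (ℓ ^ m), a ^ i = ℓ ^ m * s := by
    have h0 : ∑ i ∈ Finset.range (ℓ ^ m), a ^ i ≠ 0 := by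
      refine (Finset.sum_pos (fun i _ ↦ pow_pos (by omega) i) ?_).ne'
      simp [hp.ne_zero]
    have h2 : (∑ i ∈ Finset.range (ℓ ^ m), a ^ i) * (a - 1) = a ^ ℓ ^ m - 1 := by
      exact geom_sum_mul_of_one_le ha1.le _
    have h3 := hLTE m
    rw [← h2, padicValNat.mul h0 (Nat.sub_ne_zero_of_lt ha1), hval] at h3
    obtain ⟨e, s, hs, hes⟩ := Nat.exists_eq_pow_mul_and_not_dvd h0 ℓ hp.ne_one
    rw [hes, padicValNat.mul (pow_ne_zero _ hp.ne_zero) (by rintro rfl; simp at hs),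
      padicValNat.prime_pow, padicValNat.eq_zero_of_not_dvd hs] at h3
    obtain rfl : e = m := by omega
    exact ⟨s, hs, hes⟩
  obtain ⟨s, hs, hsum⟩ := hs
  have hηm : η ^ ℓ ^ m = 1 := by
    rw [hsum] at hηs
    have h1 := pow_gcd_eq_one.mpr ⟨hηs, hx σ⟩
    rwa [hm, add_comm r m, pow_add, Nat.gcd_mul_left,
      (Nat.Coprime.pow_right r ((Nat.Prime.coprime_iff_not_dvd hp).mpr hs).symm), mul_one] at h1
  -- The coboundary `σ ξ / ξ = ξ ^ (a - 1)` generates the roots of unity of order dividing `ℓ ^ m`.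
  -- Hence `η = σ(ξ ^ j) / ξ ^ j` for some `j`, and `x / ξ ^ j` is fixed.
  have hρ : IsPrimitiveRoot (ξ ^ (a - 1)) (ℓ ^ m) := by
    rw [hru, pow_mul]
    refine IsPrimitiveRoot.pow_of_coprime (hξ.pow (pow_pos hp.pos _) (by rw [hm, pow_add])) u ?_
    exact Nat.Coprime.pow_right m ((Nat.Prime.coprime_iff_not_dvd hp).mpr hu).symm
  have : NeZero (ℓ ^ m) := ⟨pow_ne_zero _ hp.ne_zero⟩
  obtain ⟨j, -, hj⟩ := hρ.eq_pow_of_pow_eq_one hηm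
  obtain ⟨b, hb⟩ := hfix (x / ξ ^ j) (by
    have h1 : η * ξ ^ j = ξ ^ (a * j) := by
      rw [← hj, ← pow_mul, ← pow_add, ← Nat.succ_mul, Nat.succ_eq_add_one,
        Nat.sub_add_cancel ha1.le]
    have h2 : η ≠ 0 := fun h ↦ by
      rw [h, zero_pow (pow_ne_zero _ hp.ne_zero)] at hηm
      exact zero_ne_one hηm
    rw [map_div₀, map_pow, hσx, ha, ← pow_mul, ← h1, mul_div_mul_left _ _ h2])
  refine ⟨b, ξ ^ j, ?_, by rw [hb, div_mul_cancel₀ _ (pow_ne_zero j hξ0)]⟩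
  rw [← pow_mul, mul_comm, pow_mul, hξ.pow_eq_one, one_pow]

theorem exists_mem_adjoin_of_mem_cyclotomicTower {ℓ : ℕ} {k : Type*} [Field k]
    {x : AlgebraicClosure k} (hx : x ∈ cyclotomicTower ℓ k) :
    ∃ M, x ∈ IntermediateField.adjoin k {ζ : AlgebraicClosure k | ζ ^ ℓ ^ M = 1} := by
  have hmono : ∀ {m n : ℕ}, m ≤ n →
      IntermediateField.adjoin k {ζ : AlgebraicClosure k | ζ ^ ℓ ^ m = 1} ≤
        IntermediateField.adjoin k {ζ : AlgebraicClosure k | ζ ^ ℓ ^ n = 1} := by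
    intro m n hmn
    refine IntermediateField.adjoin.mono k _ _ fun ζ hζ ↦ ?_
    obtain ⟨d, rfl⟩ := Nat.exists_eq_add_of_le hmn
    change ζ ^ ℓ ^ (m + d) = 1
    rw [pow_add, pow_mul, hζ, one_pow]
  refine IntermediateField.adjoin_induction k (p := fun x _ ↦ ∃ M, x ∈ IntermediateField.adjoin k
    {ζ : AlgebraicClosure k | ζ ^ ℓ ^ M = 1}) ?_ ?_ ?_ ?_ ?_ hx
  · rintro ζ ⟨n, hn⟩
    exact ⟨n, IntermediateField.subset_adjoin k _ hn⟩
  · exact fun x ↦ ⟨0, IntermediateField.algebraMap_mem _ x⟩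
  · rintro x y _ _ ⟨m, hm⟩ ⟨n, hn⟩
    exact ⟨max m n, add_mem (hmono (le_max_left m n) hm) (hmono (le_max_right m n) hn)⟩
  · rintro x _ ⟨m, hm⟩
    exact ⟨m, inv_mem hm⟩
  · rintro x y _ _ ⟨m, hm⟩ ⟨n, hn⟩
    exact ⟨max m n, mul_mem (hmono (le_max_left m n) hm) (hmono (le_max_right m n) hn)⟩

/-- Reduction to a finite layer `k(ξ)`, taken large enough to contain `x` and the roots of unity `σ
x / x`. The hypothesis `μ_ℓ ⊆ k` is what makes the Galois group of the layer act trivially on `μ_ℓ`.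
-/
theorem exists_eq_mul_root_of_mem_cyclotomicTower {k : Type*} [Field k] [CharZero k] {ℓ : ℕ}
    [Fact ℓ.Prime] (hℓ : ℓ ≠ 2) {z : k} (hz : IsPrimitiveRoot z ℓ) {x : AlgebraicClosure k}
    (hx0 : x ≠ 0) (hxc : x ∈ cyclotomicTower ℓ k) {n : ℕ}
    (hx : ∀ σ : Gal(AlgebraicClosure k/k), (σ x / x) ^ ℓ ^ n = 1) :
    ∃ (b : k) (ζ : AlgebraicClosure k) (m : ℕ), ζ ^ ℓ ^ m = 1 ∧
      x = algebraMap k (AlgebraicClosure k) b * ζ := by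
  have hp : ℓ.Prime := Fact.out
  obtain ⟨M, hM⟩ := exists_mem_adjoin_of_mem_cyclotomicTower hxc
  set N := max M n with hN
  have hne : NeZero (ℓ ^ (N + 1)) := ⟨pow_ne_zero _ hp.ne_zero⟩
  obtain ⟨ξ, hξ⟩ := HasEnoughRootsOfUnity.exists_primitiveRoot (AlgebraicClosure k) (ℓ ^ (N + 1))
  let E : IntermediateField k (AlgebraicClosure k) := IntermediateField.adjoin k {ξ}
  have hξE : ξ ∈ E := IntermediateField.mem_adjoin_simple_self k _
  have hxE : x ∈ E := by
    refine (IntermediateField.adjoin_le_iff.mpr fun ζ hζ ↦ ?_ :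
      IntermediateField.adjoin k {ζ : AlgebraicClosure k | ζ ^ ℓ ^ M = 1} ≤ E) hM
    obtain ⟨t, -, rfl⟩ := hξ.eq_pow_of_pow_eq_one (ξ := ζ) (by
      obtain ⟨d, hd⟩ := Nat.exists_eq_add_of_le ((le_max_left M n).trans (Nat.le_succ _))
      rw [← hN] at hd
      rw [← Nat.succ_eq_add_one, hd, pow_add, pow_mul, hζ, one_pow])
    exact pow_mem hξE t
  have hcyc := hξ.intermediateField_adjoin_isCyclotomicExtension k
  have hgal : IsGalois k E := IsCyclotomicExtension.isGalois {ℓ ^ (N + 1)} k E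
  have hfd : FiniteDimensional k E :=
    IntermediateField.adjoin.finiteDimensional (Algebra.IsIntegral.isIntegral ξ)
  have hξ' : IsPrimitiveRoot (⟨ξ, hξE⟩ : E) (ℓ ^ (N + 1)) :=
    IsPrimitiveRoot.of_map_of_injective (f := E.val) (by exact hξ) E.val.injective
  have hx0' : (⟨x, hxE⟩ : E) ≠ 0 := fun h ↦ hx0 (congrArg Subtype.val h)
  obtain ⟨b, ζ, hζ, hxb⟩ := exists_eq_mul_root (k := k) hℓ hξ' (fun σ hσ ↦ by
      have h1 : (σ : E →ₐ[k] E) = AlgHom.id k E := by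
        refine IntermediateField.algHom_ext_of_eq_adjoin k (S := E) (s := {ξ}) rfl ?_
        rintro _ rfl
        exact hσ
      exact AlgEquiv.ext fun y ↦ DFunLike.congr_fun h1 y)
    (fun σ ↦ by
      have h2 : IsPrimitiveRoot ((⟨ξ, hξE⟩ : E) ^ ℓ ^ N) ℓ :=
        hξ'.pow (pow_pos hp.pos _) (pow_succ ℓ N)
      have h3 : IsPrimitiveRoot (algebraMap k E z) ℓ :=
        hz.map_of_injective (algebraMap k E).injective
      have : NeZero ℓ := ⟨hp.ne_zero⟩
      obtain ⟨t, -, ht⟩ := h3.eq_pow_of_pow_eq_one h2.pow_eq_one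
      rw [← ht, ← map_pow, AlgEquiv.commutes]) hx0' (fun σ ↦ by
      have h1 := hx (σ.liftNormal (AlgebraicClosure k))
      have h2 : σ.liftNormal (AlgebraicClosure k) x = (σ ⟨x, hxE⟩ : E) :=
        σ.liftNormal_commutes (AlgebraicClosure k) ⟨x, hxE⟩
      rw [h2] at h1
      obtain ⟨d, hd⟩ := Nat.exists_eq_add_of_le ((le_max_right M n).trans (Nat.le_succ _))
      rw [← hN] at hd
      refine Subtype.ext ?_
      rw [← Nat.succ_eq_add_one, hd, pow_add, pow_mul]
      have h4 : ((((σ ⟨x, hxE⟩ / ⟨x, hxE⟩ : E)) ^ ℓ ^ n : E) : AlgebraicClosure k) = 1 := h1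
      rw [show ((σ ⟨x, hxE⟩ / ⟨x, hxE⟩ : E)) ^ ℓ ^ n = 1 from Subtype.ext h4, one_pow])
  exact ⟨b, ζ, N + 1, congrArg Subtype.val hζ, congrArg Subtype.val hxb⟩

end Kummer

/-! ### Local triviality of Kummer radicals and of root of unity translations -/

section LocalCocycle

variable {K L : Type*} [Field K] [NumberField K] [Field L] [NumberField L] [Algebra K L]
  [IsGalois K L] {ℓ : ℕ} [Fact ℓ.Prime]

/-- A Kummer radical that is locally contained in the cyclotomic `ℤ_ℓ`-extension is the product of
an element of the base and of a root of unity. -/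
theorem exists_local_eq_mul_root (hℓ : ℓ ≠ 2) {z : K} (hz : IsPrimitiveRoot z ℓ)
    (w : HeightOneSpectrum (𝓞 L)) {α : L} (hα0 : α ≠ 0) (hα : α ∈ localCyclotomic K ℓ w) {n : ℕ}
    (hαn : ∀ σ : Gal(L/K), (σ α / α) ^ ℓ ^ n = 1) :
    ∃ (b : (w.under (𝓞 K)).adicCompletion K) (ζ : w.adicCompletion L) (m : ℕ), ζ ^ ℓ ^ m = 1 ∧
      algebraMap L _ α = localExtension K w b * ζ := by
  obtain ⟨φ, hφ⟩ := exists_local_embedding (isLocalExtension_localExtension (K := K) w)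
  let k := (w.under (𝓞 K)).adicCompletion K
  -- Through `φ`, automorphisms of the closure of `K_v` restrict to `L`, so the global Kummer
  -- condition gives the local one.
  let _ : Algebra L (AlgebraicClosure k) := (φ.comp (algebraMap L _)).toAlgebra
  have : IsScalarTower K L (AlgebraicClosure k) := .of_algebraMap_eq fun x ↦ by
    change _ = φ (algebraMap L _ (algebraMap K L x))
    rw [← localExtension_algebraMap, ← RingHom.comp_apply φ, hφ, ← IsScalarTower.algebraMap_apply]
  have hφα : φ (algebraMap L _ α) ≠ 0 := by simpa using hα0
  obtain ⟨b, ζ, m, hζ, hb⟩ := exists_eq_mul_root_of_mem_cyclotomicTower (k := k) hℓ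
    (hz.map_of_injective (algebraMap K k).injective) hφα
    (cyclotomicZlExtension_le ℓ k (hα φ hφ)) (n := n) (fun σ ↦ by
      have h1 : σ (φ (algebraMap L _ α)) =
          φ (algebraMap L _ (restrictGal K L k (AlgebraicClosure k) σ α)) :=
        (algebraMap_restrictGal (K := K) σ α).symm
      rw [h1, ← map_div₀, ← map_div₀, ← map_pow, ← map_pow, hαn, map_one, map_one])
  have hb0 : b ≠ 0 := by
    rintro rfl
    rw [map_zero, zero_mul] at hb
    exact hφα hb
  have hfb0 : localExtension K w b ≠ 0 := by simpa using hb0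
  have hζφ : φ (algebraMap L _ α / localExtension K w b) = ζ := by
    have h2 : φ (localExtension K w b) = algebraMap k _ b := RingHom.congr_fun hφ b
    rw [map_div₀, hb, h2, mul_div_cancel_left₀]
    simpa using hb0
  refine ⟨b, algebraMap L _ α / localExtension K w b, m, φ.injective ?_, ?_⟩
  · rw [map_pow, hζφ, hζ, map_one]
  · rw [mul_div_cancel₀ _ hfb0]

theorem completedMap_completedMap {A B C : Type*} [AddCommGroup A] [AddCommGroup B] [AddCommGroup C]
    (g : B →+ C) (f : A →+ B) (y : Completed ℓ A) :
    completedMap ℓ g (completedMap ℓ f y) = completedMap ℓ (g.comp f) y := by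
  have h : adify ℓ g ∘ₗ adify ℓ f = adify ℓ (g.comp f) := LinearMap.ext (adify_comp ℓ g f)
  unfold completedMap
  rw [← h]
  exact AdicCompletion.map_comp_apply _ _ _ _

theorem completedMap_nsmul_id {A : Type*} [AddCommGroup A] (d : ℕ) (y : Completed ℓ A) :
    completedMap ℓ (nsmulAddMonoidHom d : A →+ A) y = d • y := by
  refine AdicCompletion.ext fun n ↦ ?_
  rw [AdicCompletion.val_smul_apply]
  change (adify ℓ (nsmulAddMonoidHom d : A →+ A)).reduceModIdeal _ (y.val n) = _
  obtain ⟨x, hx⟩ := Submodule.Quotient.mk_surjective _ (y.val n)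
  rw [← hx]
  change Submodule.Quotient.mk (adify ℓ (nsmulAddMonoidHom d : A →+ A) x) = _
  rw [adify_nsmul_id]
  rfl

theorem localization_eq (w : HeightOneSpectrum (𝓞 L)) (α : AdicUnits ℓ L) :
    localization ℓ L w α = toCompleted ℓ (Additive (w.adicCompletion L)ˣ)
      (adify ℓ (MonoidHom.toAdditive (Units.map (algebraMap L (w.adicCompletion L) : L →* _))) α) :=
  rfl

theorem finite_completion_torsion (w : HeightOneSpectrum (𝓞 L)) :
    {u : Additive (w.adicCompletion L)ˣ | ∃ k, ℓ ^ k • u = 0}.Finite :=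
  finite_primary_torsion (by simpa using (Fact.out : ℓ.Prime).ne_zero)

theorem eq_one_of_localization_eq_zero (w : HeightOneSpectrum (𝓞 L)) {ζ : Lˣ} {n : ℕ}
    (hζ : ζ ^ ℓ ^ n = 1) (h : localization ℓ L w (1 ⊗ₜ Additive.ofMul ζ) = 0) : ζ = 1 := by
  rw [localization_eq, adify_tmul] at h
  have h1 := eq_zero_of_toCompleted_eq_zero (finite_completion_torsion w)
    ⟨n, by rw [← map_nsmul, ← ofMul_pow, hζ, ofMul_one, map_zero]⟩ h
  have h2 : algebraMap L (w.adicCompletion L) ζ = 1 := congrArg Units.val (congrArg Additive.toMul h1)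
  exact Units.ext ((algebraMap L (w.adicCompletion L)).injective (h2.trans (map_one _).symm))

/-- The key local step: an automorphism acting trivially on the locally cyclotomic part acts
trivially on the elements that are locally in the base up to roots of unity. -/
theorem eq_one_of_localization_mem (hG : IsPGroup ℓ Gal(L/K)) (w : HeightOneSpectrum (𝓞 L))
    {τ : Gal(L/K)} (hτ : ∀ x ∈ localCyclotomic K ℓ w, τ x = x) {α : AdicUnits ℓ L}
    (hα : localization ℓ L w α ∈
      LinearMap.range (CompletedUnits.map ℓ (localExtension K w)) ⊔
        completedRoots ℓ (w.adicCompletion L))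
    {ζ : Lˣ} {n : ℕ} (hζ : ζ ^ ℓ ^ n = 1)
    (h : AdicUnits.map ℓ (τ : L →+* L) α = α + 1 ⊗ₜ Additive.ofMul ζ) : ζ = 1 := by
  have hf := isLocalExtension_localExtension (K := K) w
  obtain ⟨φ, hφ⟩ := exists_local_embedding hf
  let _ := (localExtension K w).toAlgebra
  have : FiniteDimensional K L := Module.Finite.of_restrictScalars_finite ℚ K L
  have := isScalarTower_local hf rfl
  have hspan := span_range_eq_top hf rfl
  have := finiteDimensional_completion hf rfl
  have := isGalois_of_span_eq_top K hspan
  let ψ : w.adicCompletion L →ₐ[(w.under (𝓞 K)).adicCompletion K]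
      AlgebraicClosure ((w.under (𝓞 K)).adicCompletion K) :=
    ⟨φ, fun x ↦ RingHom.congr_fun hφ x⟩
  -- `σ` extends `τ` to `L_w` and fixes `L_w ∩ K_v^c`, which contains the `ℓ`-power roots of unity
  -- of `L_w`. So `σ` fixes the local image of `α`, and `ζ` must be locally trivial.
  obtain ⟨σ, hσ, rfl⟩ := exists_restrictGal_eq ((cyclotomicZlExtension ℓ _).comap ψ) τ
    (fun x hx ↦ hτ x ((mem_localCyclotomic_iff rfl hf hφ x).mpr hx))
  have hcomm : (σ : w.adicCompletion L →+* w.adicCompletion L).comp (algebraMap L _) =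
      (algebraMap L _).comp ((restrictGal K L _ _ σ : Gal(L/K)) : L →+* L) :=
    RingHom.ext fun x ↦ (algebraMap_restrictGal (K := K) σ x).symm
  have hloc : CompletedUnits.map ℓ (σ : w.adicCompletion L →+* w.adicCompletion L)
      (localization ℓ L w α) = localization ℓ L w
        (AdicUnits.map ℓ ((restrictGal K L _ _ σ : Gal(L/K)) : L →+* L) α) := by
    rw [localization_eq, localization_eq, completedUnitsMap_eq, completedMap_toCompleted,
      adicUnitsMap_eq_adify, adify_comp, adify_comp]
    congr 1
    refine congrArg (fun g ↦ adify ℓ g α) (AddMonoidHom.ext fun x ↦ ?_)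
    exact Additive.toMul.injective (Units.ext (RingHom.congr_fun hcomm (x.toMul : L)))
  have htriv : ∀ y ∈ LinearMap.range (CompletedUnits.map ℓ (localExtension K w)) ⊔
        completedRoots ℓ (w.adicCompletion L),
      CompletedUnits.map ℓ (σ : w.adicCompletion L →+* w.adicCompletion L) y = y := by
    suffices hle : LinearMap.range (CompletedUnits.map ℓ (localExtension K w)) ⊔
        completedRoots ℓ (w.adicCompletion L) ≤ LinearMap.eqLocus
          (CompletedUnits.map ℓ (σ : w.adicCompletion L →+* w.adicCompletion L)) LinearMap.id from
      fun y hy ↦ hle hy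
    refine sup_le ?_ (Submodule.span_le.mpr ?_)
    · rintro _ ⟨x, rfl⟩
      rw [LinearMap.mem_eqLocus, completedUnitsMap_eq, completedUnitsMap_eq,
        completedMap_completedMap]
      refine congrArg (fun g ↦ completedMap ℓ g x) (AddMonoidHom.ext fun x ↦ ?_)
      exact Additive.toMul.injective
        (Units.ext (σ.commutes (x.toMul : (w.under (𝓞 K)).adicCompletion K)))
    · rintro _ ⟨⟨ξ, m, hξ⟩, rfl⟩
      rw [SetLike.mem_coe, LinearMap.mem_eqLocus, completedUnitsMap_eq]
      refine (completedMap_toCompleted ℓ _ _).trans ?_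
      rw [adify_tmul]
      have h1 : (ξ : w.adicCompletion L) ^ ℓ ^ m = 1 := congrArg Units.val hξ
      have h2 : σ (ξ : w.adicCompletion L) = ξ := hσ _ (local_root_mem hf hG hφ h1)
      exact congrArg (fun u ↦ toCompleted ℓ (Additive (w.adicCompletion L)ˣ)
        (1 ⊗ₜ Additive.ofMul u)) (Units.ext h2)
  rw [htriv _ hα, h, map_add, left_eq_add] at hloc
  exact eq_one_of_localization_eq_zero w hζ hloc

end LocalCocycle

/-! ### Local images of pseudo-infinitesimal elements -/

section LocalImages

variable {K L : Type*} [Field K] [NumberField K] [Field L] [NumberField L] [Algebra K L]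
  {ℓ : ℕ} [Fact ℓ.Prime]

theorem divisor_apply (α : AdicUnits ℓ L) (w : TamePlace ℓ L) :
    divisor ℓ L α w = adifyInt ℓ (ordHom w.1) α := by
  induction α using TensorProduct.induction_on with
  | zero => simp
  | add x y hx hy => simp only [map_add, Finsupp.add_apply, hx, hy]
  | tmul c x => exact divisor_tmul ℓ L c x.toMul w

theorem adifyInt_adify {A B : Type*} [AddCommGroup A] [AddCommGroup B] (g : B →+ ℤ) (f : A →+ B)
    (x : ℤ_[ℓ] ⊗[ℤ] A) : adifyInt ℓ g (adify ℓ f x) = adifyInt ℓ (g.comp f) x := by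
  induction x using TensorProduct.induction_on with
  | zero => simp
  | add x y hx hy => simp only [map_add, hx, hy]
  | tmul c x => rfl

theorem tmul_sub_tmul {A : Type*} [AddCommGroup A] (c : ℤ_[ℓ]) (n : ℤ) (x p : A) :
    c ⊗ₜ[ℤ] x - (c * (n : ℤ_[ℓ])) ⊗ₜ[ℤ] p = c • ((1 : ℤ_[ℓ]) ⊗ₜ[ℤ] (x - n • p)) := by
  rw [TensorProduct.smul_tmul', smul_eq_mul, mul_one, TensorProduct.tmul_sub,
    TensorProduct.tmul_smul, TensorProduct.smul_tmul', zsmul_eq_mul, mul_comm c]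

/-- At a place not dividing `ℓ`, an element is determined by its valuation up to roots of unity. -/
theorem localization_sub_mem (w : TamePlace ℓ L) {π : Lˣ} (hπ : ord w.1 π = 1)
    (α : AdicUnits ℓ L) :
    localization ℓ L w.1 α - localization ℓ L w.1 (divisor ℓ L α w ⊗ₜ Additive.ofMul π) ∈
      completedRoots ℓ (w.1.adicCompletion L) := by
  induction α using TensorProduct.induction_on with
  | zero => simp
  | add x y hx hy =>
    simpa [map_add, TensorProduct.add_tmul, add_sub_add_comm] using add_mem hx hy
  | tmul c x =>
    have h0 : divisor ℓ L (c ⊗ₜ x) w = c * (ord w.1 x.toMul : ℤ_[ℓ]) := divisor_tmul ℓ L c x.toMul w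
    -- Removing the power of the uniformizer leaves a local unit, which away from `ℓ` is a root of
    -- unity in the completion.
    set u : Additive Lˣ := x - ord w.1 x.toMul • Additive.ofMul π with hu
    have hord : ordHom w.1 u = 0 := by
      rw [hu, map_sub, map_zsmul]
      change ord w.1 x.toMul - ord w.1 x.toMul • ord w.1 π = 0
      rw [hπ, smul_eq_mul, mul_one, sub_self]
    rw [h0, ← map_sub, tmul_sub_tmul, map_smul]
    refine Submodule.smul_mem _ _ ?_
    refine toCompleted_mem_completedRoots (norm_natCast_eq_one w.2)
      (Units.map (algebraMap L (w.1.adicCompletion L) : L →* _) u.toMul) ?_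
    rw [← localOrd_eq_zero_iff, localOrd_map]
    exact hord

theorem exists_pow_smul_eq_zero_of_mem_completedRoots {F : Type*} [Field F] {y : CompletedUnits ℓ F}
    (hy : y ∈ completedRoots ℓ F) : ∃ k, ℓ ^ k • y = 0 := by
  induction hy using Submodule.span_induction with
  | mem x hx =>
    obtain ⟨⟨ζ, n, hζ⟩, rfl⟩ := hx
    refine ⟨n, ?_⟩
    rw [← map_nsmul, ← TensorProduct.tmul_smul, ← ofMul_pow, hζ]
    simp
  | zero => exact ⟨0, smul_zero _⟩
  | add x y _ _ hx hy =>
    obtain ⟨m, hm⟩ := hx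
    obtain ⟨n, hn⟩ := hy
    refine ⟨m + n, ?_⟩
    rw [smul_add, pow_add, mul_smul, mul_smul, hn, smul_zero, add_zero, smul_comm, hm, smul_zero]
  | smul a x _ hx =>
    obtain ⟨m, hm⟩ := hx
    exact ⟨m, by rw [smul_comm, hm, smul_zero]⟩

/-- Finiteness of the primary torsion of `K_v^×` means completion creates no new torsion. Local
roots of unity can thus be recognised by being killed by a power of `ℓ`. -/
theorem mem_completedRoots_of_pow_smul_eq_zero (v : HeightOneSpectrum (𝓞 K)) {k : ℕ}
    {y : CompletedUnits ℓ (v.adicCompletion K)} (hy : ℓ ^ k • y = 0) :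
    y ∈ completedRoots ℓ (v.adicCompletion K) := by
  obtain ⟨a, ha, rfl⟩ := exists_torsion_of_completed k
    ((finite_completion_torsion v).subset fun a ha ↦ ⟨k, ha⟩) y hy
  exact Submodule.subset_span ⟨⟨a.toMul, k, ha⟩, rfl⟩

theorem mem_pseudoInfinitesimal_iff {α : AdicUnits ℓ K} :
    α ∈ pseudoInfinitesimal ℓ K ↔ ∀ v : HeightOneSpectrum (𝓞 K), (ℓ : 𝓞 K) ∈ v.asIdeal →
      localization ℓ K v α ∈ completedRoots ℓ (v.adicCompletion K) := by
  simp [pseudoInfinitesimal]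

theorem eq_zero_of_forall_exists_eq_pow_smul {x : ℤ_[ℓ]} (h : ∀ n, ∃ y, x = ℓ ^ n • y) :
    x = 0 := by
  by_contra hx
  obtain ⟨y, hy⟩ := h (x.valuation + 1)
  have h1 : x ∈ Ideal.span {(ℓ : ℤ_[ℓ]) ^ (x.valuation + 1)} := by
    rw [Ideal.mem_span_singleton]
    exact ⟨y, by rw [nsmul_eq_mul] at hy; exact_mod_cast hy⟩
  have h2 := (PadicInt.mem_span_pow_iff_le_valuation x hx _).mp h1
  omega

/-- The local image is torsion while `ℤ_ℓ` is torsion-free and separated. This controls the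
valuations above `ℓ`, which `divisor` does not see. -/
theorem adifyInt_ordHom_eq_zero (w : HeightOneSpectrum (𝓞 L)) {α : AdicUnits ℓ L}
    (h : localization ℓ L w α ∈ completedRoots ℓ (w.adicCompletion L)) :
    adifyInt ℓ (ordHom w) α = 0 := by
  obtain ⟨k, hk⟩ := exists_pow_smul_eq_zero_of_mem_completedRoots h
  rw [← map_nsmul, localization_eq, toCompleted_eq_zero_iff] at hk
  have h1 : ℓ ^ k • adifyInt ℓ (ordHom w) α = 0 := by
    refine eq_zero_of_forall_exists_eq_pow_smul fun n ↦ ?_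
    obtain ⟨y, hy⟩ := hk n
    refine ⟨adifyInt ℓ (localOrd w) y, ?_⟩
    rw [← map_nsmul, ← map_nsmul, ← hy, adifyInt_adify]
    refine congrArg (fun g ↦ adifyInt ℓ g (ℓ ^ k • α)) (AddMonoidHom.ext fun x ↦ ?_)
    exact (localOrd_map x.toMul).symm
  rw [nsmul_eq_mul] at h1
  exact (mul_eq_zero.mp h1).resolve_left (by
    exact_mod_cast pow_ne_zero k (Fact.out : ℓ.Prime).ne_zero)

/-- An element whose local valuation comes from the base comes locally from the base up to roots
of unity. -/
theorem localization_mem_of_divisor_eq (w : TamePlace ℓ L) {α : AdicUnits ℓ L} {a : Divisor ℓ K}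
    (h : divisor ℓ L α = extendDivisor ℓ K L a) :
    localization ℓ L w.1 α ∈ LinearMap.range (CompletedUnits.map ℓ (localExtension K w.1)) ⊔
      completedRoots ℓ (w.1.adicCompletion L) := by
  obtain ⟨ϖ, hϖ⟩ := exists_ord_eq_one w.1
  obtain ⟨π, hπ⟩ := exists_ord_eq_one (w.under K).1
  set γ : AdicUnits ℓ K := a (w.under K) ⊗ₜ Additive.ofMul π with hγ
  have h1 : divisor ℓ L (AdicUnits.map ℓ (algebraMap K L) γ) w = divisor ℓ L α w := by
    rw [h, ← extendDivisor_divisor, extendDivisor_apply, extendDivisor_apply, hγ, divisor_tmul, hπ,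
      Int.cast_one, mul_one]
  have h2 := localization_sub_mem w hϖ α
  have h3 := localization_sub_mem w hϖ (AdicUnits.map ℓ (algebraMap K L) γ)
  rw [h1] at h3
  have h4 := sub_mem h2 h3
  rw [sub_sub_sub_cancel_right] at h4
  rw [← sub_add_cancel (localization ℓ L w.1 α)
    (localization ℓ L w.1 (AdicUnits.map ℓ (algebraMap K L) γ)), add_comm]
  refine Submodule.add_mem_sup ?_ h4
  rw [localization_map]
  exact LinearMap.mem_range_self _ _

/-- An element of the base that becomes pseudo-infinitesimal is pseudo-infinitesimal. -/
theorem mem_pseudoInfinitesimal_of_map {κ : AdicUnits ℓ K}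
    (h : AdicUnits.map ℓ (algebraMap K L) κ ∈ pseudoInfinitesimal ℓ L) :
    κ ∈ pseudoInfinitesimal ℓ K := by
  rw [mem_pseudoInfinitesimal_iff] at h ⊢
  intro v hv
  obtain ⟨w, rfl⟩ := exists_under_eq (L := L) v
  obtain ⟨k, hk⟩ := exists_pow_smul_eq_zero_of_mem_completedRoots
    (h w ((natCast_mem_under ℓ w).mp hv))
  rw [localization_map] at hk
  set y := localization ℓ K (w.under (𝓞 K)) κ
  let _ := (localExtension K w).toAlgebra
  have := finiteDimensional_completion (isLocalExtension_localExtension (K := K) w) rfl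
  set d := Module.finrank ((w.under (𝓞 K)).adicCompletion K) (w.adicCompletion L) with hd
  have hd0 : d ≠ 0 := Module.finrank_pos.ne'
  -- The norm after extension is multiplication by the local degree `d`, so torsion in the
  -- completion of `L_w^×` forces torsion in that of `K_v^×`.
  have h1 : d • y = completedMap ℓ (MonoidHom.toAdditive (Units.map (Algebra.norm
      ((w.under (𝓞 K)).adicCompletion K) : w.adicCompletion L →* _)))
      (CompletedUnits.map ℓ (localExtension K w) y) := by
    rw [completedUnitsMap_eq, completedMap_completedMap, ← completedMap_nsmul_id]
    refine congrArg (fun g ↦ completedMap ℓ g y) (AddMonoidHom.ext fun x ↦ ?_)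
    exact Additive.toMul.injective (Units.ext (Algebra.norm_algebraMap _).symm)
  have h2 : (d * ℓ ^ k) • y = 0 := by
    rw [mul_comm, mul_smul, h1, ← map_nsmul, hk, map_zero]
  obtain ⟨k', hk'⟩ := exists_pow_nsmul_eq_zero (ℓ := ℓ)
    (mul_ne_zero hd0 (pow_ne_zero k (Fact.out : ℓ.Prime).ne_zero)) h2
  exact mem_completedRoots_of_pow_smul_eq_zero _ hk'

end LocalImages

/-! ### Pseudo-infinitesimal elements with trivial divisor -/

section Leopoldt

variable {L : Type*} [Field L] [NumberField L] {ℓ : ℕ} [Fact ℓ.Prime]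

variable (L) in
/-- All the valuations of an element of `L^×`. -/
def ordAll : Additive Lˣ →+ (HeightOneSpectrum (𝓞 L) →₀ ℤ) where
  toFun x := Finsupp.ofSupportFinite (fun w ↦ ord w x.toMul) (finite_ord_ne_zero x.toMul)
  map_zero' := Finsupp.ext fun w ↦ ord_one w
  map_add' x y := Finsupp.ext fun w ↦ ord_mul w x.toMul y.toMul

theorem exact_units_ordAll :
    Function.Exact (MonoidHom.toAdditive (Units.map (algebraMap (𝓞 L) L : 𝓞 L →* L)))
      (ordAll L) := by
  have hle : ∀ (w : HeightOneSpectrum (𝓞 L)) (x : Lˣ), ord w x = 0 →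
      w.valuation L (x : L) = 1 := by
    intro w x h
    rw [← WithZero.exp_log (show w.valuation L (x : L) ≠ 0 by simp), neg_eq_zero.mp h,
      WithZero.exp_zero]
  intro x
  refine ⟨fun hx ↦ ?_, ?_⟩
  · have h1 : ∀ w, ord w x.toMul = 0 := fun w ↦ DFunLike.congr_fun hx w
    obtain ⟨a, ha⟩ := HeightOneSpectrum.mem_integers_of_valuation_le_one L (x.toMul : L)
      fun w ↦ (hle w _ (h1 w)).le
    obtain ⟨b, hb⟩ := HeightOneSpectrum.mem_integers_of_valuation_le_one L ((x.toMul⁻¹ : Lˣ) : L)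
      fun w ↦ by rw [Units.val_inv_eq_inv_val, map_inv₀, hle w _ (h1 w), inv_one]
    have hab : a * b = 1 := FaithfulSMul.algebraMap_injective (𝓞 L) L (by
      rw [map_mul, ha, hb, map_one, Units.mul_inv])
    exact ⟨Additive.ofMul ⟨a, b, hab, by rw [mul_comm, hab]⟩, Additive.toMul.injective (Units.ext ha)⟩
  · rintro ⟨u, rfl⟩
    refine Finsupp.ext fun w ↦ ?_
    change ord w (Units.map (algebraMap (𝓞 L) L : 𝓞 L →* L) u.toMul) = 0
    have h1 : w.valuation L (algebraMap (𝓞 L) L (u.toMul : 𝓞 L)) = 1 := by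
      refine le_antisymm (w.valuation_le_one _) ?_
      have h2 := w.valuation_le_one (K := L) ((u.toMul⁻¹ : (𝓞 L)ˣ) : 𝓞 L)
      have h3 : w.valuation L (algebraMap (𝓞 L) L (u.toMul : 𝓞 L)) *
          w.valuation L (algebraMap (𝓞 L) L ((u.toMul⁻¹ : (𝓞 L)ˣ) : 𝓞 L)) = 1 := by
        rw [← map_mul, ← map_mul, Units.mul_inv, map_one, map_one]
      rw [← h3]
      exact mul_le_of_le_one_right' h2
    exact neg_eq_zero.mpr ((congrArg WithZero.log h1).trans WithZero.log_one)

theorem eq_zero_of_adifyInt_eq_zero {ι : Type*} (t : ℤ_[ℓ] ⊗[ℤ] (ι →₀ ℤ))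
    (h : ∀ i, adifyInt ℓ (Finsupp.applyAddHom i) t = 0) : t = 0 := by
  classical
  refine (TensorProduct.finsuppScalarRight ℤ ℤ ℤ_[ℓ] ι).injective (Finsupp.ext fun i ↦ ?_)
  rw [map_zero, Finsupp.zero_apply, ← h i]
  clear h
  induction t using TensorProduct.induction_on with
  | zero => simp
  | add x y hx hy => simp only [map_add, Finsupp.add_apply, hx, hy]
  | tmul c x =>
    rw [TensorProduct.finsuppScalarRight_apply_tmul_apply, adifyInt_tmul, zsmul_eq_mul, mul_comm]
    rfl

/-- Under the Leopoldt conjecture, the pseudo-infinitesimal elements with trivial divisor are the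
roots of unity. -/
theorem exists_eq_one_tmul_root (hL : LeopoldtConjecture ℓ L) {α : AdicUnits ℓ L}
    (hα : α ∈ pseudoInfinitesimal ℓ L) (h0 : divisor ℓ L α = 0) :
    ∃ (ζ : Lˣ) (n : ℕ), ζ ^ ℓ ^ n = 1 ∧ α = 1 ⊗ₜ Additive.ofMul ζ := by
  have hp : ℓ.Prime := Fact.out
  rw [mem_pseudoInfinitesimal_iff] at hα
  have hord : ∀ w, adifyInt ℓ (ordHom w) α = 0 := fun w ↦ by
    by_cases hw : (ℓ : 𝓞 L) ∈ w.asIdeal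
    · exact adifyInt_ordHom_eq_zero w (hα w hw)
    · rw [← divisor_apply α ⟨w, hw⟩, h0, Finsupp.zero_apply]
  -- All valuations vanish, so by flatness `α` comes from `ℤ_ℓ ⊗ 𝓞_L^×`. A power of `ℓ` kills its
  -- local images above `ℓ`; Leopoldt then makes it torsion, that is, a root of unity.
  obtain ⟨ε, rfl⟩ := (adify_exact ℓ exact_units_ordAll α).mp (eq_zero_of_adifyInt_eq_zero _ fun w ↦ by
    rw [adifyInt_adify]
    exact hord w)
  have hk : ∀ w : {w : HeightOneSpectrum (𝓞 L) // (ℓ : 𝓞 L) ∈ w.asIdeal}, ∃ k,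
      ℓ ^ k • localization ℓ L w.1 (adify ℓ
        (MonoidHom.toAdditive (Units.map (algebraMap (𝓞 L) L : 𝓞 L →* L))) ε) = 0 :=
    fun w ↦ exists_pow_smul_eq_zero_of_mem_completedRoots (hα w.1 w.2)
  choose k hk using hk
  have : Finite {w : HeightOneSpectrum (𝓞 L) // (ℓ : 𝓞 L) ∈ w.asIdeal} :=
    (finite_places_over (K := L) hp.ne_zero).to_subtype
  cases nonempty_fintype {w : HeightOneSpectrum (𝓞 L) // (ℓ : 𝓞 L) ∈ w.asIdeal}
  have h1 : ℓ ^ (∑ w, k w) • ε = 0 := hL _ fun w hw ↦ by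
    rw [map_nsmul, map_nsmul]
    obtain ⟨d, hd⟩ := Nat.exists_eq_add_of_le
      (Finset.single_le_sum (fun w _ ↦ Nat.zero_le (k w)) (Finset.mem_univ ⟨w, hw⟩))
    rw [hd, add_comm, pow_add, mul_smul]
    exact (congrArg _ (hk ⟨w, hw⟩)).trans (smul_zero _)
  obtain ⟨u, hu, rfl⟩ := exists_torsion_of_smul_eq_zero ℓ _ ε h1
  refine ⟨Units.map (algebraMap (𝓞 L) L : 𝓞 L →* L) u.toMul, ∑ w, k w, ?_, rfl⟩
  rw [← map_pow]
  exact (congrArg _ (congrArg Additive.toMul hu)).trans (map_one _)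

end Leopoldt

/-! ### Extension of divisors in towers -/

section ExtendDivisor

variable {K L : Type*} [Field K] [NumberField K] [Field L] [NumberField L] [Algebra K L]
  {ℓ : ℕ} [Fact ℓ.Prime]

theorem ramificationIdx_ne_zero (w : HeightOneSpectrum (𝓞 L)) :
    (w.under (𝓞 K)).asIdeal.ramificationIdx' w.asIdeal ≠ 0 :=
  Ideal.IsDedekindDomain.ramificationIdx'_ne_zero_of_liesOver w.asIdeal (w.under (𝓞 K)).ne_bot

theorem extendDivisor_injective : Function.Injective (extendDivisor ℓ K L) := by
  rw [injective_iff_map_eq_zero]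
  intro a ha
  refine Finsupp.ext fun v ↦ ?_
  obtain ⟨w, hw⟩ := exists_under_eq (L := L) v.1
  have hwt : (ℓ : 𝓞 L) ∉ w.asIdeal := fun h ↦ v.2 (hw ▸ (natCast_mem_under ℓ w).mpr h)
  have hv : TamePlace.under K (⟨w, hwt⟩ : TamePlace ℓ L) = v := Subtype.ext hw
  have h1 := DFunLike.congr_fun ha ⟨w, hwt⟩
  rw [extendDivisor_apply, Finsupp.zero_apply, mul_eq_zero, hv] at h1
  refine h1.resolve_left fun h ↦ ramificationIdx_ne_zero (K := K) w ?_
  subst hv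
  exact_mod_cast h

theorem extendDivisor_extendDivisor {F : Type*} [Field F] [NumberField F] [Algebra K F]
    [Algebra F L] [IsScalarTower K F L] (a : Divisor ℓ K) :
    extendDivisor ℓ F L (extendDivisor ℓ K F a) = extendDivisor ℓ K L a := by
  refine Finsupp.ext fun w ↦ ?_
  have h1 : (w.under F).under K = w.under K := Subtype.ext (under_under w.1)
  rw [extendDivisor_apply, extendDivisor_apply, extendDivisor_apply, ← mul_assoc, h1]
  congr 1
  -- Multiplicativity of ramification indices is read off from the valuation of a uniformizer of the
  -- base, computed directly and through `F`.
  obtain ⟨π, hπ⟩ := exists_ord_eq_one (w.under K).1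
  have h2 := ord_under (K := K) w.1 π
  have h3 := ord_under (K := F) w.1 (Units.map (algebraMap K F : K →* F) π)
  have h4 := ord_under (K := K) (w.under F).1 π
  have h5 : Units.map (algebraMap F L : F →* L) (Units.map (algebraMap K F : K →* F) π) =
      Units.map (algebraMap K L : K →* L) π :=
    Units.ext (IsScalarTower.algebraMap_apply K F L π).symm
  have h6 : (w.1.under (𝓞 F)).under (𝓞 K) = w.1.under (𝓞 K) := under_under w.1
  have hπ' : ord (w.1.under (𝓞 K)) π = 1 := hπ
  rw [hπ', mul_one] at h2
  change ord (w.1.under (𝓞 F)) _ = ((((w.1.under (𝓞 F)).under (𝓞 K)).asIdeal.ramificationIdx'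
    (w.1.under (𝓞 F)).asIdeal : ℕ) : ℤ) * ord ((w.1.under (𝓞 F)).under (𝓞 K)) π at h4
  rw [h6, hπ', mul_one] at h4
  rw [h5, h2, h4] at h3
  exact_mod_cast congrArg (Int.cast : ℤ → ℤ_[ℓ]) h3.symm

theorem map_galois_mem_pseudoInfinitesimal (τ : Gal(L/K)) {α : AdicUnits ℓ L}
    (hα : α ∈ pseudoInfinitesimal ℓ L) :
    AdicUnits.map ℓ (τ : L →+* L) α ∈ pseudoInfinitesimal ℓ L :=
  @map_mem_pseudoInfinitesimal ℓ _ L L _ _ _ _ (τ : L →+* L).toAlgebra α hα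

/-- Regard `τ` as an algebra structure of `L` over itself: extending `a` to `L` and then along `τ`
is again extending `a` from `K`, because `τ` fixes `K`. -/
theorem divisor_map_galois (τ : Gal(L/K)) {α : AdicUnits ℓ L} {a : Divisor ℓ K}
    (h : divisor ℓ L α = extendDivisor ℓ K L a) :
    divisor ℓ L (AdicUnits.map ℓ (τ : L →+* L) α) = divisor ℓ L α := by
  have h1 := @extendDivisor_divisor ℓ _ L L _ _ _ _ (τ : L →+* L).toAlgebra α
  refine h1.symm.trans ?_
  rw [h]
  refine @extendDivisor_extendDivisor K L _ _ _ _ _ ℓ _ L _ _ _ (τ : L →+* L).toAlgebra ?_ a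
  exact @IsScalarTower.of_algebraMap_eq K L L _ _ _ _ (τ : L →+* L).toAlgebra _
    fun x ↦ (τ.commutes x).symm

end ExtendDivisor

/-! ### Global roots of unity inside `ℤ_ℓ ⊗ F^×` -/

section Roots

variable {F : Type*} [Field F] (ℓ : ℕ) [Fact ℓ.Prime]

variable (F) in
/-- The map `μ_F → ℤ_ℓ ⊗ F^×`. -/
def rootsTensor : Additive (rootsOfUnityPrimary ℓ F) →+ AdicUnits ℓ F :=
  (TensorProduct.mk ℤ ℤ_[ℓ] (Additive Fˣ) 1).toAddMonoidHom.comp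
    (MonoidHom.toAdditive (rootsOfUnityPrimary ℓ F).subtype)

theorem rootsTensor_apply (ζ : Additive (rootsOfUnityPrimary ℓ F)) :
    rootsTensor F ℓ ζ = 1 ⊗ₜ Additive.ofMul ((ζ.toMul : rootsOfUnityPrimary ℓ F) : Fˣ) := rfl

variable [NumberField F]

/-- It suffices to look at one finite place, where the primary torsion is finite and so embeds in
the completion. -/
theorem rootsTensor_injective : Function.Injective (rootsTensor F ℓ) := by
  rw [injective_iff_map_eq_zero]
  intro ζ hζ
  obtain ⟨M, hM⟩ := Ideal.exists_maximal (𝓞 F)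
  let w : HeightOneSpectrum (𝓞 F) :=
    ⟨M, hM.isPrime, Ring.ne_bot_of_isMaximal_of_not_isField hM (RingOfIntegers.not_isField F)⟩
  obtain ⟨n, hn⟩ := ζ.toMul.2
  rw [rootsTensor_apply] at hζ
  have h1 := eq_one_of_localization_eq_zero (ℓ := ℓ) w hn (by rw [hζ, map_zero])
  exact Additive.toMul.injective (Subtype.ext h1)

variable {ℓ}

theorem mem_pseudoInfinitesimal_root {ζ : Fˣ} {n : ℕ} (hζ : ζ ^ ℓ ^ n = 1) :
    (1 : ℤ_[ℓ]) ⊗ₜ[ℤ] Additive.ofMul ζ ∈ pseudoInfinitesimal ℓ F := by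
  rw [mem_pseudoInfinitesimal_iff]
  intro v _
  refine mem_completedRoots_of_pow_smul_eq_zero v (k := n) ?_
  rw [← map_nsmul, ← TensorProduct.tmul_smul, ← ofMul_pow, hζ, ofMul_one, TensorProduct.tmul_zero,
    map_zero]

theorem divisor_root {ζ : Fˣ} {n : ℕ} (hζ : ζ ^ ℓ ^ n = 1) :
    divisor ℓ F ((1 : ℤ_[ℓ]) ⊗ₜ[ℤ] Additive.ofMul ζ) = 0 := by
  have h1 : ℓ ^ n • divisor ℓ F ((1 : ℤ_[ℓ]) ⊗ₜ[ℤ] Additive.ofMul ζ) = 0 := by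
    rw [← map_nsmul, ← TensorProduct.tmul_smul, ← ofMul_pow, hζ, ofMul_one,
      TensorProduct.tmul_zero, map_zero]
  exact (smul_eq_zero.mp h1).resolve_left (pow_ne_zero n (Fact.out : ℓ.Prime).ne_zero)

end Roots

/-! ### Descent of pseudo-infinitesimal elements and their construction from radicals -/

section Capitulation

variable {K L : Type*} [Field K] [NumberField K] [Field L] [NumberField L] [Algebra K L]
  {ℓ : ℕ} [Fact ℓ.Prime]

/-- The Galois group acts on the pseudo-infinitesimal elements with divisor coming from the base
through translations by roots of unity. -/
theorem exists_galois_eq_add_root (hL : LeopoldtConjecture ℓ L) {α : AdicUnits ℓ L}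
    (hα : α ∈ pseudoInfinitesimal ℓ L) {a : Divisor ℓ K}
    (ha : divisor ℓ L α = extendDivisor ℓ K L a) (τ : Gal(L/K)) :
    ∃ (ζ : Lˣ) (n : ℕ), ζ ^ ℓ ^ n = 1 ∧
      AdicUnits.map ℓ (τ : L →+* L) α = α + 1 ⊗ₜ Additive.ofMul ζ := by
  obtain ⟨ζ, n, hζ, h⟩ := exists_eq_one_tmul_root hL
    (sub_mem (map_galois_mem_pseudoInfinitesimal τ hα) hα)
    (by rw [map_sub, divisor_map_galois τ ha, sub_self])
  exact ⟨ζ, n, hζ, by rw [← h, add_sub_cancel]⟩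

theorem adicUnitsMap_galois_mul {K L : Type*} [Field K] [Field L] [Algebra K L]
    (σ τ : Gal(L/K)) (α : AdicUnits ℓ L) :
    AdicUnits.map ℓ ((σ * τ : Gal(L/K)) : L →+* L) α =
      AdicUnits.map ℓ (σ : L →+* L) (AdicUnits.map ℓ (τ : L →+* L) α) := by
  exact (adify_comp ℓ (MonoidHom.toAdditive (Units.map ((σ : L →+* L) : L →* L)))
    (MonoidHom.toAdditive (Units.map ((τ : L →+* L) : L →* L))) α).symm

theorem adicUnitsMap_one {K L : Type*} [Field K] [Field L] [Algebra K L] (α : AdicUnits ℓ L) :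
    AdicUnits.map ℓ ((1 : Gal(L/K)) : L →+* L) α = α :=
  DFunLike.congr_fun (LinearMap.lTensor_id ℤ_[ℓ] (Additive Lˣ) (R := ℤ)) α

/-- The stabilizer in the Galois group of an element of `ℤ_ℓ ⊗ L^×`. -/
def galoisStabilizer (α : AdicUnits ℓ L) : Subgroup Gal(L/K) where
  carrier := {τ | AdicUnits.map ℓ (τ : L →+* L) α = α}
  mul_mem' {σ τ} hσ hτ := by
    change AdicUnits.map ℓ ((σ * τ : Gal(L/K)) : L →+* L) α = α
    rw [adicUnitsMap_galois_mul, hτ, hσ]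
  one_mem' := adicUnitsMap_one α
  inv_mem' {σ} hσ := by
    have h := adicUnitsMap_galois_mul σ⁻¹ σ α
    rw [hσ, inv_mul_cancel] at h
    exact h.symm.trans (adicUnitsMap_one α)

theorem mem_pseudoInfinitesimal_local {α : AdicUnits ℓ L}
    (hα : α ∈ pseudoInfinitesimal ℓ L) {a : Divisor ℓ K}
    (ha : divisor ℓ L α = extendDivisor ℓ K L a) (w : HeightOneSpectrum (𝓞 L)) :
    localization ℓ L w α ∈ LinearMap.range (CompletedUnits.map ℓ (localExtension K w)) ⊔
      completedRoots ℓ (w.adicCompletion L) := by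
  by_cases hw : (ℓ : 𝓞 L) ∈ w.asIdeal
  · exact Submodule.mem_sup_right (mem_pseudoInfinitesimal_iff.mp hα w hw)
  · exact localization_mem_of_divisor_eq ⟨w, hw⟩ ha

/-- Locally `x` equals `b v` up to a root of unity. Dividing by a `κ` with the same images as the `b
v` above `ℓ` makes `x` pseudo-infinitesimal, while the valuations of `b v` at the other places show
that the divisor of `x` comes from `K`. -/
theorem exists_pseudoInfinitesimal_of_local_root {x : Lˣ} {n : ℕ} {a : Kˣ}
    (ha : algebraMap K L a = (x : L) ^ ℓ ^ n)
    (hb : ∀ v : HeightOneSpectrum (𝓞 K), ∃ (b : (v.adicCompletion K)ˣ) (m : ℕ),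
      (b : v.adicCompletion K) ^ ℓ ^ (n + m) = algebraMap K (v.adicCompletion K) a ^ ℓ ^ m) :
    ∃ (κ : AdicUnits ℓ K) (c : Divisor ℓ K),
      1 ⊗ₜ Additive.ofMul x - AdicUnits.map ℓ (algebraMap K L) κ ∈ pseudoInfinitesimal ℓ L ∧
      divisor ℓ L (1 ⊗ₜ Additive.ofMul x - AdicUnits.map ℓ (algebraMap K L) κ) =
        extendDivisor ℓ K L c := by
  have hp : ℓ.Prime := Fact.out
  choose b m hb using hb
  have hxa : ℓ ^ n • ((1 : ℤ_[ℓ]) ⊗ₜ[ℤ] Additive.ofMul x) =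
      AdicUnits.map ℓ (algebraMap K L) (1 ⊗ₜ Additive.ofMul a) := by
    rw [← TensorProduct.tmul_smul, ← ofMul_pow]
    exact congrArg (fun u ↦ (1 : ℤ_[ℓ]) ⊗ₜ[ℤ] Additive.ofMul u) (Units.ext ha.symm)
  have hbu : ∀ v, ℓ ^ (n + m v) • Additive.ofMul (b v) = ℓ ^ m v •
      Additive.ofMul (Units.map (algebraMap K (v.adicCompletion K) : K →* _) a) := fun v ↦
    Additive.toMul.injective (Units.ext (hb v))
  obtain ⟨κ, hκ⟩ := exists_localization_eq ℓ (K := K) fun v ↦ b v.1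
  have hdvd : ∀ v, ord v a = ℓ ^ n • localOrd v (Additive.ofMul (b v)) := by
    intro v
    have h1 := congrArg (localOrd v) (hbu v)
    rw [map_nsmul, map_nsmul, localOrd_map, add_comm, pow_add, mul_smul] at h1
    exact (smul_right_injective ℤ (pow_ne_zero (m v) hp.ne_zero) h1).symm
  obtain ⟨c, hc⟩ : ∃ c : Divisor ℓ K, ℓ ^ n • c = divisor ℓ K (1 ⊗ₜ Additive.ofMul a) := by
    refine ⟨Finsupp.onFinset (divisor ℓ K (1 ⊗ₜ Additive.ofMul a)).support
      (fun v ↦ (localOrd v.1 (Additive.ofMul (b v.1)) : ℤ_[ℓ])) fun v hv ↦ ?_,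
      Finsupp.ext fun v ↦ ?_⟩
    · rw [Finsupp.mem_support_iff, divisor_tmul, hdvd, one_mul, nsmul_eq_mul]
      push_cast
      exact mul_ne_zero (pow_ne_zero n (by exact_mod_cast hp.ne_zero)) hv
    · rw [divisor_tmul, hdvd, one_mul, nsmul_eq_mul, Finsupp.smul_apply, Finsupp.onFinset_apply,
        nsmul_eq_mul]
      push_cast
      rfl
  refine ⟨κ, c - divisor ℓ K κ, ?_, ?_⟩
  · rw [mem_pseudoInfinitesimal_iff]
    intro w hw
    have h1 := hκ ⟨w.under (𝓞 K), (natCast_mem_under ℓ w).mpr hw⟩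
    refine mem_completedRoots_of_pow_smul_eq_zero w (k := n + m (w.under (𝓞 K))) ?_
    have h2 : ℓ ^ (n + m (w.under (𝓞 K))) • localization ℓ K (w.under (𝓞 K)) κ =
        ℓ ^ m (w.under (𝓞 K)) • localization ℓ K (w.under (𝓞 K)) (1 ⊗ₜ Additive.ofMul a) := by
      rw [h1, ← map_nsmul, ← TensorProduct.tmul_smul, hbu, TensorProduct.tmul_smul, map_nsmul]
      rfl
    rw [map_sub, smul_sub, localization_map, ← map_nsmul (CompletedUnits.map ℓ (localExtension K w)),
      h2, map_nsmul (CompletedUnits.map ℓ (localExtension K w)), ← localization_map, ← hxa,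
      map_nsmul, ← mul_smul, ← pow_add, add_comm n, sub_self]
  · have h1 : ℓ ^ n • extendDivisor ℓ K L c = ℓ ^ n • divisor ℓ L (1 ⊗ₜ Additive.ofMul x) := by
      rw [← map_nsmul, hc, extendDivisor_divisor, ← hxa, map_nsmul]
    rw [map_sub, map_sub, extendDivisor_divisor,
      smul_right_injective (Divisor ℓ L) (pow_ne_zero n hp.ne_zero) h1]

variable [IsGalois K L]

/-- A pseudo-infinitesimal element with divisor coming from the base comes from the maximal locally
cyclotomic subextension. -/
theorem exists_map_eq_of_divisor_eq (hℓ : ℓ ≠ 2) (hG : IsPGroup ℓ Gal(L/K))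
    (hL : LeopoldtConjecture ℓ L) {α : AdicUnits ℓ L} (hα : α ∈ pseudoInfinitesimal ℓ L)
    {a : Divisor ℓ K} (ha : divisor ℓ L α = extendDivisor ℓ K L a) :
    ∃ β : AdicUnits ℓ (maxLocallyCyclotomic ℓ K L),
      AdicUnits.map ℓ (algebraMap (maxLocallyCyclotomic ℓ K L) L) β = α := by
  have : FiniteDimensional K L := Module.Finite.of_restrictScalars_finite ℚ K L
  set F := maxLocallyCyclotomic ℓ K L with hF
  have h1 : ∀ w, (localCyclotomic K ℓ w).fixingSubgroup ≤ galoisStabilizer α := by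
    intro w τ hτ
    obtain ⟨ζ, n, hζ, h⟩ := exists_galois_eq_add_root hL hα ha τ
    obtain rfl := eq_one_of_localization_mem hG w
      ((IntermediateField.mem_fixingSubgroup_iff _ _).mp hτ)
      (mem_pseudoInfinitesimal_local hα ha w) hζ h
    change _ = _
    rw [h, ofMul_one, TensorProduct.tmul_zero, add_zero]
  -- The fixed field of the stabilizer lies in every local cyclotomic part, hence in their
  -- intersection `F`.
  have h2 : F.fixingSubgroup ≤ galoisStabilizer α := by
    rw [← IntermediateField.fixingSubgroup_fixedField (galoisStabilizer α)]
    refine IntermediateField.fixingSubgroup_le fun x hx ↦ ?_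
    rw [hF, mem_maxLocallyCyclotomic_iff hℓ hG]
    intro w
    rw [← IsGalois.fixedField_fixingSubgroup (localCyclotomic K ℓ w)]
    exact IntermediateField.fixedField_antitone (h1 w) hx
  refine exists_adify_of_fixed _ (fun τ : F.fixingSubgroup ↦
    MonoidHom.toAdditive (Units.map ((τ.1 : L →+* L) : L →* L))) ?_ α fun τ ↦ h2 τ.2
  intro b hb
  have h3 : (b.toMul : L) ∈ F := by
    rw [← IsGalois.fixedField_fixingSubgroup F]
    rintro ⟨τ, hτ⟩
    exact congrArg Units.val (congrArg Additive.toMul (hb ⟨τ, hτ⟩))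
  have h4 : (⟨b.toMul, h3⟩ : F) ≠ 0 := fun h ↦ b.toMul.ne_zero (congrArg Subtype.val h)
  exact ⟨Additive.ofMul (Units.mk0 _ h4), Additive.toMul.injective (Units.ext rfl)⟩

/-- A suitable power of `ζ` has order `ℓ`, and an `ℓ`-group acts trivially on `μ_ℓ` since `(ℤ/ℓ)^×`
has order `ℓ - 1`. -/
theorem exists_primitiveRoot_base (hG : IsPGroup ℓ Gal(L/K)) {ζ : Lˣ} (h1 : ζ ≠ 1) {n : ℕ}
    (hζ : ζ ^ ℓ ^ n = 1) : ∃ z : K, IsPrimitiveRoot z ℓ := by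
  have hp : ℓ.Prime := Fact.out
  have : FiniteDimensional K L := Module.Finite.of_restrictScalars_finite ℚ K L
  obtain ⟨m, -, hm⟩ := (Nat.dvd_prime_pow hp).mp (orderOf_dvd_of_pow_eq_one hζ)
  obtain _ | m := m
  · exact absurd (orderOf_eq_one_iff.mp hm) h1
  have hξ : IsPrimitiveRoot ((ζ : L) ^ ℓ ^ m) ℓ := by
    refine IsPrimitiveRoot.pow (pow_pos hp.pos (m + 1)) ?_ (pow_succ ℓ m)
    rw [IsPrimitiveRoot.coe_units_iff, ← hm]
    exact IsPrimitiveRoot.orderOf ζ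
  obtain ⟨z, hz⟩ := (IsGalois.mem_range_algebraMap_iff_fixed (F := K) ((ζ : L) ^ ℓ ^ m)).mpr
    fun σ ↦ by
      have : NeZero ℓ := ⟨hp.ne_zero⟩
      obtain ⟨k, hk⟩ := hG σ
      have h2 : ((hξ.autToPow K σ : (ZMod ℓ)ˣ) : ZMod ℓ) = 1 := by
        rw [← ZMod.pow_card_pow (n := k) ((hξ.autToPow K σ : (ZMod ℓ)ˣ) : ZMod ℓ),
          ← Units.val_pow_eq_pow_val, ← map_pow, hk, map_one, Units.val_one]
      have h3 := hξ.autToPow_spec K σ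
      rw [h2, ZMod.val_one_eq_one_mod, Nat.mod_eq_of_lt hp.one_lt, pow_one] at h3
      exact h3.symm
  exact ⟨z, IsPrimitiveRoot.of_map_of_injective (f := algebraMap K L) (by rw [hz]; exact hξ)
    (algebraMap K L).injective⟩

theorem exists_local_root (hℓ : ℓ ≠ 2) {z : K} (hz : IsPrimitiveRoot z ℓ) {x : Lˣ}
    (hx : ∀ w, (x : L) ∈ localCyclotomic K ℓ w) {n : ℕ}
    (hxn : ∀ σ : Gal(L/K), (σ (x : L) / x) ^ ℓ ^ n = 1) {a : Kˣ}
    (ha : algebraMap K L a = (x : L) ^ ℓ ^ n) (v : HeightOneSpectrum (𝓞 K)) :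
    ∃ (b : (v.adicCompletion K)ˣ) (m : ℕ),
      (b : v.adicCompletion K) ^ ℓ ^ (n + m) = algebraMap K (v.adicCompletion K) a ^ ℓ ^ m := by
  obtain ⟨w, rfl⟩ := exists_under_eq (L := L) v
  obtain ⟨b, ζ, m, hζ, hb⟩ := exists_local_eq_mul_root hℓ hz w x.ne_zero (hx w) hxn
  have hb0 : b ≠ 0 := by
    rintro rfl
    rw [map_zero, zero_mul, map_eq_zero] at hb
    exact x.ne_zero hb
  refine ⟨Units.mk0 b hb0, m, (localExtension K w).injective ?_⟩
  rw [Units.val_mk0, map_pow, map_pow, localExtension_algebraMap, ha, map_pow, hb, ← pow_mul,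
    ← pow_add, mul_pow, pow_add ℓ n m, mul_comm (ℓ ^ n), pow_mul ζ, hζ, one_pow, mul_one]

end Capitulation

/-! ### The capitulation kernel -/

/-- `R` is the graph of the isomorphism. Working with a correspondence avoids choosing `a`, `β` and
the cocycle coherently. -/
theorem nonempty_addEquiv_of_subgroup {A B : Type*} [AddCommGroup A] [AddCommGroup B]
    (R : AddSubgroup (A × B)) (hA : ∀ a, ∃ b, (a, b) ∈ R) (hB : ∀ b, ∃ a, (a, b) ∈ R)
    (h₁ : ∀ b, (0, b) ∈ R → b = 0) (h₂ : ∀ a, (a, 0) ∈ R → a = 0) : Nonempty (A ≃+ B) := by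
  have hf : Function.Bijective ((AddMonoidHom.fst A B).comp R.subtype) := by
    refine ⟨(injective_iff_map_eq_zero _).mpr ?_, fun a ↦ ?_⟩
    · rintro ⟨⟨a, b⟩, h⟩ (rfl : a = 0)
      exact Subtype.ext (Prod.ext rfl (h₁ b h))
    · obtain ⟨b, h⟩ := hA a
      exact ⟨⟨_, h⟩, rfl⟩
  have hg : Function.Bijective ((AddMonoidHom.snd A B).comp R.subtype) := by
    refine ⟨(injective_iff_map_eq_zero _).mpr ?_, fun b ↦ ?_⟩
    · rintro ⟨⟨a, b⟩, h⟩ (rfl : b = 0)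
      exact Subtype.ext (Prod.ext (h₂ a h) rfl)
    · obtain ⟨a, h⟩ := hB b
      exact ⟨⟨_, h⟩, rfl⟩
  exact ⟨(AddEquiv.ofBijective _ hf).symm.trans (AddEquiv.ofBijective _ hg)⟩

/-! ### The first cohomology group of the roots of unity -/

section RootsCohomology

open groupCohomology

variable (ℓ : ℕ) [Fact ℓ.Prime] (K F : Type) [Field K] [Field F] [Algebra K F]

/-- The Galois module `μ_F`. -/
abbrev rootsRep : Rep ℤ Gal(F/K) := Rep.ofMulDistribMulAction Gal(F/K) (rootsOfUnityPrimary ℓ F)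

variable {K F}

/-- The map `μ_F → ℤ_ℓ ⊗ F^×` on the Galois module `μ_F`. -/
def rootsRepTensor : rootsRep ℓ K F →+ AdicUnits ℓ F := rootsTensor F ℓ

theorem map_rootsRepTensor (σ : Gal(F/K)) (ζ : rootsRep ℓ K F) :
    AdicUnits.map ℓ (σ : F →+* F) (rootsRepTensor ℓ ζ) = rootsRepTensor ℓ ((rootsRep ℓ K F).ρ σ ζ) :=
  rfl

theorem rootsRepTensor_injective [NumberField F] :
    Function.Injective (rootsRepTensor ℓ (K := K) (F := F)) :=
  rootsTensor_injective ℓ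

theorem exists_H1π_eq {ℓ : ℕ} (h : rootsH1 ℓ K F) : ∃ f, H1π (rootsRep ℓ K F) f = h := by
  induction h using H1_induction_on with
  | h f => exact ⟨f, rfl⟩

theorem exists_pow_smul_rootsH1 [Finite Gal(F/K)] (h : rootsH1 ℓ K F) : ∃ N, ℓ ^ N • h = 0 := by
  obtain ⟨f, rfl⟩ := exists_H1π_eq h
  have hn : ∀ σ : Gal(F/K), ∃ n, ℓ ^ n • f σ = 0 := fun σ ↦ by
    obtain ⟨n, hn⟩ := (Additive.toMul (f σ : Additive (rootsOfUnityPrimary ℓ F))).2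
    exact ⟨n, Additive.toMul.injective (Subtype.ext hn)⟩
  choose n hn using hn
  cases nonempty_fintype Gal(F/K)
  refine ⟨∑ σ, n σ, ?_⟩
  rw [← map_nsmul]
  have h0 : ℓ ^ (∑ σ, n σ) • f = 0 := by
    refine cocycles₁_ext fun σ ↦ ?_
    obtain ⟨d, hd⟩ := Nat.exists_eq_add_of_le
      (Finset.single_le_sum (fun σ _ ↦ Nat.zero_le (n σ)) (Finset.mem_univ σ))
    change ℓ ^ (∑ σ, n σ) • f σ = 0
    rw [hd, add_comm, pow_add, mul_smul, hn, smul_zero]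
  rw [h0, map_zero]

end RootsCohomology

/-! ### The correspondence between capitulating classes and cohomology classes -/

section Main

open groupCohomology

variable {K L : Type} [Field K] [NumberField K] [Field L] [NumberField L] [Algebra K L]
  {ℓ : ℕ} [Fact ℓ.Prime]

variable (ℓ) in
/-- The correspondence between the classes of `K` that capitulate in `L` and the cohomology classes
of roots of unity: the class of `a` corresponds to the class of `σ ↦ σβ - β` when the divisor of
the pseudo-infinitesimal element `β` is the extension of `a`. -/
def capitulationRel (F : IntermediateField K L) :
    AddSubgroup (LinearMap.ker (extendClass ℓ K L) × rootsH1 ℓ K F) where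
  carrier := {p | ∃ (a : Divisor ℓ K) (β : AdicUnits ℓ F) (f : cocycles₁ (rootsRep ℓ K F)),
    (p.1 : ClBP ℓ K) = Submodule.Quotient.mk a ∧ p.2 = H1π (rootsRep ℓ K F) f ∧
    AdicUnits.map ℓ (algebraMap F L) β ∈ pseudoInfinitesimal ℓ L ∧
    divisor ℓ L (AdicUnits.map ℓ (algebraMap F L) β) = extendDivisor ℓ K L a ∧
    ∀ σ : Gal(F/K), AdicUnits.map ℓ (σ : F →+* F) β = β + rootsRepTensor ℓ (f σ)}
  zero_mem' := ⟨0, 0, 0, rfl, (map_zero _).symm, by rw [map_zero]; exact zero_mem _, by simp,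
    fun σ ↦ by
      change _ = 0 + rootsRepTensor ℓ (0 : rootsRep ℓ K F)
      simp⟩
  add_mem' := by
    rintro ⟨p, q⟩ ⟨p', q'⟩ ⟨a, β, f, h1, h2, h3, h4, h5⟩ ⟨a', β', f', h1', h2', h3', h4', h5'⟩
    refine ⟨a + a', β + β', f + f', ?_, ?_, ?_, ?_, fun σ ↦ ?_⟩
    · exact congrArg₂ (· + ·) h1 h1'
    · rw [map_add]
      exact congrArg₂ (· + ·) h2 h2'
    · rw [map_add]
      exact add_mem h3 h3'
    · rw [map_add, map_add, map_add, h4, h4']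
    · change _ = _ + rootsRepTensor ℓ (f σ + f' σ)
      rw [map_add, map_add, h5, h5', add_add_add_comm]
  neg_mem' := by
    rintro ⟨p, q⟩ ⟨a, β, f, h1, h2, h3, h4, h5⟩
    refine ⟨-a, -β, -f, ?_, ?_, ?_, ?_, fun σ ↦ ?_⟩
    · exact congrArg Neg.neg h1
    · rw [map_neg]
      exact congrArg Neg.neg h2
    · rw [map_neg]
      exact neg_mem h3
    · rw [map_neg, map_neg, map_neg, h4]
    · change _ = _ + rootsRepTensor ℓ (-f σ)
      rw [map_neg, map_neg, h5, neg_add]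

theorem adicUnitsMap_algebraMap {K L : Type*} [Field K] [Field L] [Algebra K L] 
    (F : IntermediateField K L) (κ : AdicUnits ℓ K) :
    AdicUnits.map ℓ (algebraMap F L) (AdicUnits.map ℓ (algebraMap K F) κ) =
      AdicUnits.map ℓ (algebraMap K L) κ :=
  adify_comp ℓ (MonoidHom.toAdditive (Units.map (algebraMap F L : F →* L)))
    (MonoidHom.toAdditive (Units.map (algebraMap K F : K →* F))) κ

theorem adicUnitsMap_injective {K L : Type*} [Field K] [Field L] [Algebra K L] 
    {F : IntermediateField K L} :
    Function.Injective (AdicUnits.map ℓ (algebraMap F L)) :=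
  adify_injective ℓ (f := MonoidHom.toAdditive (Units.map (algebraMap F L : F →* L)))
    (Units.map_injective (algebraMap F L).injective)

theorem adicUnitsMap_galois_algebraMap {K F : Type*} [Field K] [Field F] [Algebra K F]
    (σ : Gal(F/K))
    (κ : AdicUnits ℓ K) :
    AdicUnits.map ℓ (σ : F →+* F) (AdicUnits.map ℓ (algebraMap K F) κ) =
      AdicUnits.map ℓ (algebraMap K F) κ := by
  refine (adify_comp ℓ (MonoidHom.toAdditive (Units.map ((σ : F →+* F) : F →* F)))
    (MonoidHom.toAdditive (Units.map (algebraMap K F : K →* F))) κ).trans ?_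
  refine congrArg (fun g ↦ adify ℓ g κ) (AddMonoidHom.ext fun x ↦ ?_)
  exact Additive.toMul.injective (Units.ext (σ.commutes (x.toMul : K)))

variable {F : IntermediateField K L}

theorem map_rootsRepTensor_mem (ζ : rootsRep ℓ K F) :
    AdicUnits.map ℓ (algebraMap F L) (rootsRepTensor ℓ ζ) ∈ pseudoInfinitesimal ℓ L ∧
      divisor ℓ L (AdicUnits.map ℓ (algebraMap F L) (rootsRepTensor ℓ ζ)) = 0 := by
  obtain ⟨n, hn⟩ := (Additive.toMul (ζ : Additive (rootsOfUnityPrimary ℓ F))).2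
  have h : (Units.map (algebraMap F L : F →* L)
      (Additive.toMul (ζ : Additive (rootsOfUnityPrimary ℓ F))).1) ^ ℓ ^ n = 1 := by
    rw [← map_pow, hn, map_one]
  exact ⟨mem_pseudoInfinitesimal_root h, divisor_root h⟩

/-- The roots of unity of `L` are those of `F`. -/
theorem exists_rootsRep_eq {K L : Type} [Field K] [Field L] [Algebra K L]
    {F : IntermediateField K L} (hF : (rootsOfUnityPrimary ℓ F).map
      (Units.map (algebraMap F L : F →* L)) = rootsOfUnityPrimary ℓ L) {ζ : Lˣ} {n : ℕ}
    (hζ : ζ ^ ℓ ^ n = 1) : ∃ ξ : rootsRep ℓ K F,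
      AdicUnits.map ℓ (algebraMap F L) (rootsRepTensor ℓ ξ) = 1 ⊗ₜ Additive.ofMul ζ := by
  have h1 : ζ ∈ rootsOfUnityPrimary ℓ L := ⟨n, hζ⟩
  rw [← hF] at h1
  obtain ⟨ξ, hξ, rfl⟩ := h1
  exact ⟨Additive.ofMul (⟨ξ, hξ⟩ : rootsOfUnityPrimary ℓ F), rfl⟩

/-- When `a` is the divisor of a pseudo-infinitesimal `κ`, Leopoldt makes `β` and `κ` differ by a
root of unity `ξ`, and the cocycle is the coboundary of `ξ`. -/
theorem eq_zero_of_capitulationRel_left (hL : LeopoldtConjecture ℓ L)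
    (hF : (rootsOfUnityPrimary ℓ F).map (Units.map (algebraMap F L : F →* L)) =
      rootsOfUnityPrimary ℓ L) (h : rootsH1 ℓ K F) (hR : (0, h) ∈ capitulationRel ℓ F) : h = 0 := by
  obtain ⟨a, β, f, h1, h2, h3, h4, h5⟩ := hR
  obtain ⟨κ, hκ, rfl⟩ := (Submodule.Quotient.mk_eq_zero _).mp h1.symm
  obtain ⟨ζ, n, hζ, hβ⟩ := exists_eq_one_tmul_root hL
    (sub_mem h3 (map_mem_pseudoInfinitesimal ℓ L hκ))
    (by rw [map_sub, h4, extendDivisor_divisor, sub_self])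
  obtain ⟨ξ, hξ⟩ := exists_rootsRep_eq hF hζ
  have hβ' : β = AdicUnits.map ℓ (algebraMap K F) κ + rootsRepTensor ℓ ξ := by
    refine adicUnitsMap_injective ?_
    rw [map_add, hξ, adicUnitsMap_algebraMap, ← hβ, add_sub_cancel]
  have h6 : ∀ σ, f σ = (rootsRep ℓ K F).ρ σ ξ - ξ := fun σ ↦ by
    refine rootsRepTensor_injective ℓ ?_
    have h7 := h5 σ
    rw [hβ', map_add, adicUnitsMap_galois_algebraMap, map_rootsRepTensor, add_assoc,
      add_right_inj] at h7
    rw [map_sub, h7, add_sub_cancel_left]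
  change h = _ at h2
  rw [h2, H1π_eq_zero_iff]
  exact ⟨ξ, funext fun σ ↦ (h6 σ).symm⟩

/-- If the cocycle is the coboundary of `ξ`, then `β - ξ` is Galois invariant and comes from `ℛ_K`.
Pseudo-infinitesimality and the divisor both descend, so `a` is principal. -/
theorem eq_zero_of_capitulationRel_right [IsGalois K F]
    (c : LinearMap.ker (extendClass ℓ K L)) (hR : (c, 0) ∈ capitulationRel ℓ F) : c = 0 := by
  obtain ⟨a, β, f, h1, h2, h3, h4, h5⟩ := hR
  obtain ⟨ξ, hξ⟩ := (H1π_eq_zero_iff f).mp h2.symm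
  have : FiniteDimensional K F := Module.Finite.of_restrictScalars_finite ℚ K F
  obtain ⟨κ, hκ⟩ := exists_adify_of_fixed
    (MonoidHom.toAdditive (Units.map (algebraMap K F : K →* F)))
    (fun σ : Gal(F/K) ↦ MonoidHom.toAdditive (Units.map ((σ : F →+* F) : F →* F)))
    (fun b hb ↦ by
      obtain ⟨x, hx⟩ := (IsGalois.mem_range_algebraMap_iff_fixed (F := K) (E := F) b.toMul).mpr
        fun σ ↦ congrArg Units.val (congrArg Additive.toMul (hb σ))
      have hx0 : x ≠ 0 := by
        rintro rfl
        exact b.toMul.ne_zero (hx.symm.trans (map_zero _))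
      exact ⟨Additive.ofMul (Units.mk0 x hx0), Additive.toMul.injective (Units.ext hx)⟩)
    (β - rootsRepTensor ℓ (K := K) ξ) (fun σ : Gal(F/K) ↦ by
      change AdicUnits.map ℓ (σ : F →+* F) (β - rootsRepTensor ℓ (K := K) ξ) = _
      rw [map_sub, h5, map_rootsRepTensor, ← congrFun hξ σ]
      change _ + rootsRepTensor ℓ (K := K) ((rootsRep ℓ K F).ρ σ ξ - ξ) - _ = _
      rw [map_sub]
      abel)
  have hκ' : AdicUnits.map ℓ (algebraMap K L) κ =
      AdicUnits.map ℓ (algebraMap F L) (β - rootsRepTensor ℓ (K := K) ξ) := by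
    rw [← adicUnitsMap_algebraMap F, ← hκ]
    rfl
  obtain ⟨h6, h7⟩ := map_rootsRepTensor_mem (K := K) (L := L) (ℓ := ℓ) ξ
  refine Subtype.ext (h1.trans ((Submodule.Quotient.mk_eq_zero _).mpr ⟨κ, ?_, ?_⟩))
  · refine mem_pseudoInfinitesimal_of_map (L := L) ?_
    rw [hκ', map_sub]
    exact sub_mem h3 h6
  · refine extendDivisor_injective (L := L) ?_
    rw [extendDivisor_divisor, hκ', map_sub, map_sub, h7, sub_zero, h4]

variable [IsGalois K L]

theorem exists_capitulationRel_right (hℓ : ℓ ≠ 2) (hG : IsPGroup ℓ Gal(L/K))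
    (hL : LeopoldtConjecture ℓ L) (c : LinearMap.ker (extendClass ℓ K L)) :
    ∃ h, (c, h) ∈ capitulationRel ℓ (maxLocallyCyclotomic ℓ K L) := by
  have := isGalois_maxLocallyCyclotomic hℓ hG
  have hF := map_rootsOfUnityPrimary_eq hℓ hG
  set F := maxLocallyCyclotomic ℓ K L with hFdef
  obtain ⟨a, ha⟩ := Submodule.Quotient.mk_surjective _ (c : ClBP ℓ K)
  obtain ⟨α, hα, hαa⟩ : extendDivisor ℓ K L a ∈ principalBP ℓ L := by
    have h1 : extendClass ℓ K L (c : ClBP ℓ K) = 0 := c.2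
    rw [← ha] at h1
    exact (Submodule.Quotient.mk_eq_zero _).mp h1
  obtain ⟨β, rfl⟩ := exists_map_eq_of_divisor_eq hℓ hG hL hα hαa
  have h1 : ∀ σ : Gal(F/K), ∃ ξ : rootsRep ℓ K F,
      AdicUnits.map ℓ (σ : F →+* F) β = β + rootsRepTensor ℓ ξ := fun σ ↦ by
    obtain ⟨τ, rfl⟩ := AlgEquiv.restrictNormalHom_surjective (F := K) (K₁ := F) L σ
    obtain ⟨ζ, n, hζ, h⟩ := exists_galois_eq_add_root hL hα hαa τ
    obtain ⟨ξ, hξ⟩ := exists_rootsRep_eq hF hζ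
    refine ⟨ξ, adicUnitsMap_injective ?_⟩
    rw [map_add, hξ, ← h]
    refine (adify_comp ℓ _ _ β).trans (Eq.trans ?_ (adify_comp ℓ _ _ β).symm)
    refine congrArg (fun g ↦ adify ℓ g β) (AddMonoidHom.ext fun x ↦ ?_)
    exact Additive.toMul.injective (Units.ext (τ.restrictNormal_commutes F (x.toMul : F)))
  choose f hf using h1
  -- Injectivity of `μ_F → ℛ_F` turns the identity for `(σ τ) β` into the cocycle relation.
  have hcoc : f ∈ cocycles₁ (rootsRep ℓ K F) := (mem_cocycles₁_iff f).mpr fun σ τ ↦ by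
    refine rootsRepTensor_injective ℓ (add_left_cancel (a := β) ?_)
    rw [← hf, adicUnitsMap_galois_mul, hf, map_add, hf, map_rootsRepTensor, map_add, add_assoc,
      add_comm (rootsRepTensor ℓ (f σ))]
  exact ⟨_, a, β, ⟨f, hcoc⟩, ha.symm, rfl, hα, hαa, hf⟩

theorem exists_capitulationRel_left (hℓ : ℓ ≠ 2) (hG : IsPGroup ℓ Gal(L/K)) [IsGalois K F]
    (hF : ∀ x ∈ F, ∀ w, x ∈ localCyclotomic K ℓ w) (h : rootsH1 ℓ K F) :
    ∃ c, (c, h) ∈ capitulationRel ℓ F := by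
  obtain ⟨f, rfl⟩ := exists_H1π_eq h
  have : FiniteDimensional K L := Module.Finite.of_restrictScalars_finite ℚ K L
  have : FiniteDimensional K F := Module.Finite.of_restrictScalars_finite ℚ K F
  -- A nonzero cocycle takes a nontrivial value; this is what guarantees `μ_ℓ ⊆ K`, needed for the
  -- local Kummer argument.
  by_cases hf0 : f = 0
  · exact ⟨0, by rw [hf0, map_zero]; exact zero_mem _⟩
  let g : Gal(F/K) → rootsOfUnityPrimary ℓ F := fun σ ↦ Additive.toMul (f σ : Additive _)
  have hg : IsMulCocycle₁ g := isMulCocycle₁_of_mem_cocycles₁ _ f.2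
  -- Hilbert 90 writes the cocycle as `σ y / y`. Then `y ^ ℓ ^ N` is invariant, so `y` is a Kummer
  -- radical over `K`.
  obtain ⟨y, hy⟩ := isMulCoboundary₁_of_isMulCocycle₁_of_aut_to_units (fun σ ↦ (g σ : Fˣ))
    fun σ τ ↦ congrArg Subtype.val (hg σ τ)
  have hy' : ∀ σ : Gal(F/K), σ (y : F) / y = ((g σ : Fˣ) : F) := fun σ ↦ by
    refine Eq.trans ?_ (congrArg Units.val (hy σ))
    rw [Units.val_div_eq_div_val]
    rfl
  choose n hn using fun σ ↦ (g σ).2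
  cases nonempty_fintype Gal(F/K)
  set N := ∑ σ, n σ with hN
  have hgN : ∀ σ, (g σ : Fˣ) ^ ℓ ^ N = 1 := fun σ ↦ by
    obtain ⟨d, hd⟩ := Nat.exists_eq_add_of_le
      (Finset.single_le_sum (fun σ _ ↦ Nat.zero_le (n σ)) (Finset.mem_univ σ))
    rw [hN, hd, pow_add, pow_mul, hn, one_pow]
  obtain ⟨σ, hσ⟩ : ∃ σ, (g σ : Fˣ) ≠ 1 := by
    by_contra! hcon
    exact hf0 (cocycles₁_ext fun σ ↦ Additive.toMul.injective (Subtype.ext (hcon σ)))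
  obtain ⟨z, hz⟩ := exists_primitiveRoot_base (L := L) hG
    (ζ := Units.map (algebraMap F L : F →* L) (g σ : Fˣ)) (n := N)
    (fun h1 ↦ hσ (Units.map_injective (algebraMap F L).injective (h1.trans (map_one _).symm)))
    (by rw [← map_pow, hgN, map_one])
  set x : Lˣ := Units.map (algebraMap F L : F →* L) y with hx
  have hxN : ∀ τ : Gal(L/K), (τ (x : L) / x) ^ ℓ ^ N = 1 := fun τ ↦ by
    have h1 : τ (x : L) = algebraMap F L (τ.restrictNormal F (y : F)) :=
      (τ.restrictNormal_commutes F (y : F)).symm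
    rw [h1, hx, Units.coe_map, MonoidHom.coe_coe, ← map_div₀, hy', ← map_pow,
      ← Units.val_pow_eq_pow_val, hgN, Units.val_one, map_one]
  obtain ⟨a, ha⟩ := (IsGalois.mem_range_algebraMap_iff_fixed (F := K) ((x : L) ^ ℓ ^ N)).mpr
    fun τ ↦ by
      have h1 := hxN τ
      rwa [div_pow, div_eq_one_iff_eq (pow_ne_zero _ x.ne_zero), ← map_pow] at h1
  have ha0 : a ≠ 0 := by
    rintro rfl
    exact pow_ne_zero (ℓ ^ N) x.ne_zero (ha.symm.trans (map_zero _))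
  obtain ⟨κ, d, hκ, hd⟩ := exists_pseudoInfinitesimal_of_local_root (ℓ := ℓ) (x := x) (n := N)
    (a := Units.mk0 a ha0) ha
    (exists_local_root hℓ hz (hF _ (y : F).2) hxN ha)
  have hβ : AdicUnits.map ℓ (algebraMap F L)
      (1 ⊗ₜ Additive.ofMul y - AdicUnits.map ℓ (algebraMap K F) κ) =
      1 ⊗ₜ Additive.ofMul x - AdicUnits.map ℓ (algebraMap K L) κ := by
    rw [map_sub, adicUnitsMap_algebraMap]
    rfl
  refine ⟨⟨Submodule.Quotient.mk d, (Submodule.Quotient.mk_eq_zero _).mpr ⟨_, hκ, hd⟩⟩, d,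
    1 ⊗ₜ Additive.ofMul y - AdicUnits.map ℓ (algebraMap K F) κ, f, rfl, rfl, by rwa [hβ],
    by rwa [hβ], fun σ ↦ ?_⟩
  have h1 : AdicUnits.map ℓ (σ : F →+* F) (1 ⊗ₜ Additive.ofMul y) =
      1 ⊗ₜ Additive.ofMul y + rootsRepTensor ℓ (f σ) := by
    refine Eq.trans ?_ (TensorProduct.tmul_add (1 : ℤ_[ℓ]) (Additive.ofMul y)
      (Additive.ofMul (g σ : Fˣ)))
    refine congrArg (fun u ↦ (1 : ℤ_[ℓ]) ⊗ₜ[ℤ] Additive.ofMul u) (Units.ext ?_)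
    change σ (y : F) = y * ((g σ : Fˣ) : F)
    rw [← hy', mul_div_cancel₀ _ y.ne_zero]
  rw [map_sub, h1, adicUnitsMap_galois_algebraMap]
  abel

theorem nonempty_ker_extendClass_addEquiv (hℓ : ℓ ≠ 2) (hG : IsPGroup ℓ Gal(L/K))
    (hL : LeopoldtConjecture ℓ L) :
    Nonempty (LinearMap.ker (extendClass ℓ K L) ≃+
      rootsH1 ℓ K (maxLocallyCyclotomic ℓ K L)) := by
  have := isGalois_maxLocallyCyclotomic hℓ hG
  exact nonempty_addEquiv_of_subgroup (capitulationRel ℓ (maxLocallyCyclotomic ℓ K L))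
    (exists_capitulationRel_right hℓ hG hL)
    (exists_capitulationRel_left hℓ hG fun x ↦ (mem_maxLocallyCyclotomic_iff hℓ hG x).mp)
    (eq_zero_of_capitulationRel_left hL (map_rootsOfUnityPrimary_eq hℓ hG))
    eq_zero_of_capitulationRel_right

/-- The kernel on the full class groups consists of torsion classes, because every element of `H^1`
is killed by a power of `ℓ`; the two kernels therefore coincide. -/
theorem nonempty_ker_extendTorsion_addEquiv (hℓ : ℓ ≠ 2) (hG : IsPGroup ℓ Gal(L/K))
    (hL : LeopoldtConjecture ℓ L) :
    Nonempty (LinearMap.ker (extendTorsion ℓ K L) ≃+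
      rootsH1 ℓ K (maxLocallyCyclotomic ℓ K L)) := by
  have : FiniteDimensional K L := Module.Finite.of_restrictScalars_finite ℚ K L
  obtain ⟨e⟩ := nonempty_ker_extendClass_addEquiv hℓ hG hL
  have htors : ∀ c : LinearMap.ker (extendClass ℓ K L), (c : ClBP ℓ K) ∈ TorsionBP ℓ K := by
    intro c
    obtain ⟨N, hN⟩ := exists_pow_smul_rootsH1 ℓ (e c)
    rw [← map_nsmul, map_eq_zero_iff e e.injective] at hN
    have h0 : (ℓ : ℤ_[ℓ]) ^ N ≠ 0 := pow_ne_zero N (by exact_mod_cast (Fact.out : ℓ.Prime).ne_zero)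
    refine ⟨⟨(ℓ : ℤ_[ℓ]) ^ N, mem_nonZeroDivisors_of_ne_zero h0⟩, ?_⟩
    change (ℓ : ℤ_[ℓ]) ^ N • (c : ClBP ℓ K) = 0
    rw [← Nat.cast_pow, Nat.cast_smul_eq_nsmul]
    exact congrArg Subtype.val hN
  let i : LinearMap.ker (extendTorsion ℓ K L) →+ LinearMap.ker (extendClass ℓ K L) :=
    { toFun := fun x ↦ ⟨x.1.1, congrArg Subtype.val x.2⟩
      map_zero' := rfl
      map_add' := fun _ _ ↦ rfl }
  have hi : Function.Bijective i :=
    ⟨fun x y h ↦ by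
        have h' := congrArg Subtype.val h
        exact Subtype.ext (Subtype.ext h'),
      fun c ↦ ⟨⟨⟨c.1, htors c⟩, Subtype.ext c.2⟩, rfl⟩⟩
  exact ⟨(AddEquiv.ofBijective i hi).trans e⟩

end Main

end

end BertrandiasPayan

theorem mainTheorem1 (ℓ : ℕ) [Fact ℓ.Prime] (hℓ : ℓ ≠ 2) (K L : Type) [Field K] [NumberField K]
    [Field L] [NumberField L] [Algebra K L] [IsGalois K L] (hG : IsPGroup ℓ Gal(L/K))
    (hLeopoldt : BertrandiasPayan.LeopoldtConjecture ℓ L) :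
    IsGreatest {F : IntermediateField K L | BertrandiasPayan.IsLocallyCyclotomic ℓ K F}
        (BertrandiasPayan.maxLocallyCyclotomic ℓ K L) ∧
      IsGalois K (BertrandiasPayan.maxLocallyCyclotomic ℓ K L) ∧
      (BertrandiasPayan.rootsOfUnityPrimary ℓ (BertrandiasPayan.maxLocallyCyclotomic ℓ K L)).map
          (Units.map
            (algebraMap (BertrandiasPayan.maxLocallyCyclotomic ℓ K L) L :
              BertrandiasPayan.maxLocallyCyclotomic ℓ K L →* L)) =
        BertrandiasPayan.rootsOfUnityPrimary ℓ L ∧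
      Nonempty (LinearMap.ker (BertrandiasPayan.extendClass ℓ K L) ≃+
        BertrandiasPayan.rootsH1 ℓ K (BertrandiasPayan.maxLocallyCyclotomic ℓ K L)) ∧
      Nonempty (LinearMap.ker (BertrandiasPayan.extendTorsion ℓ K L) ≃+
        BertrandiasPayan.rootsH1 ℓ K (BertrandiasPayan.maxLocallyCyclotomic ℓ K L)) :=
  ⟨BertrandiasPayan.isGreatest_maxLocallyCyclotomic hℓ hG,
    BertrandiasPayan.isGalois_maxLocallyCyclotomic hℓ hG,
    BertrandiasPayan.map_rootsOfUnityPrimary_eq hℓ hG,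
    BertrandiasPayan.nonempty_ker_extendClass_addEquiv hℓ hG hLeopoldt,
    BertrandiasPayan.nonempty_ker_extendTorsion_addEquiv hℓ hG hLeopoldt⟩
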